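/- Setting. A typical user sits at the origin of the plane. Let $\Phi_0,\dots,\Phi_M$ ($M\ge 0$) be independent homogeneous Poisson point processes in $\mathbb R^2$ with intensities $\lambda_0=\lambda,\lambda_1,\dots,\lambda_M>0$. Let $d_1\le d_2\le\cdots$ be the ordered distances from the user to the points of the transmitter tier $\Phi_0$, and $d_{i,m}$, $i\ge 1$, the distances of the points of the interfering tier $\Phi_m$, $1\le m\le M$. The $K\ge 1$ closest transmitters of $\Phi_0$ jointly serve the user. The channel power gains $H_i,H_{i,m}$ are $\exp(1)$ distributed; the activity indicators $\mathbb 1_i,\mathbb 1_{i,m}$ are Bernoulli with $\Pr[\mathbb 1_i=1]=1-q_{\mathrm{tr},i}$ for $i\le K$, $\Pr[\mathbb 1_i=1]=1-q_{\mathrm{tr},o}$ for $i>K$ and $\Pr[\mathbb 1_{i,m}=1]=p_{\mathrm{tr}}^{(m)}$, with all transmission probabilities in $(0,1]$; all gains, indicators and the point processes are mutually independent. With path-loss exponent $\eta>2$, noise power $\sigma^2\ge 0$ and normalized transmit powers $P_m>0$, the SINR is $$\gamma=\frac{\sum_{i=1}^K \mathbb 1_i d_i^{-\eta}H_i}{\sum_{i>K}\mathbb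 1_i d_i^{-\eta}H_i+\sum_{m=1}^M\sum_i \mathbb 1_{i,m}P_m d_{i,m}^{-\eta}H_{i,m}+\sigma^2}.$$ Let $\bar F_\gamma(K,\theta)=\Pr[\gamma>\theta\mid d_1,\dots,d_K]$ be the CCDF of $\gamma$ for given cluster geometry $(d_1,\dots,d_K)$ (which is almost surely distinct). Notation. $\omega_i=d_i/d_K$; $G=\prod_{i=1}^K q_{\mathrm{tr},i}$; $\Omega=\{\omega_1^\eta,\dots,\omega_K^\eta\}$ and $\hat\Omega=\{\omega_1^\eta/q_{\mathrm{tr},1},\dots,\omega_K^\eta/q_{\mathrm{tr},K}\}$ as multisets; $\alpha_i(\Omega)=(-1)^i$ times the sum of all products of the elements of $\Omega$ taken $K-i$ at a time, and likewise $\alpha_i(\hat\Omega)$; $$\mathrm C_j(\theta)=e^{-d_j^\eta\theta\sigma^2}\,e^{-\pi(1-q_{\mathrm{tr},o})\lambda d_K^2\mathcal F(\omega_j^\eta\theta,\eta)}\prod_{m=1}^M e^{-\pi p_{\mathrm{tr}}^{(m)}\lambda_m d_j^2(\theta P_m)^{2/\eta}\Gamma(1+\frac2\eta)\Gamma(1-\frac2\eta)},$$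 $$\mathcal F(t_1,t_2)=\frac{2t_1}{t_2-2}\;{}_2F_1\!\left(1,1-\tfrac2{t_2};2-\tfrac2{t_2};-t_1\right),$$ where ${}_2F_1$ is the Gauss hypergeometric function (continued analytically to $(-\infty,1)$). Statement. Suppose that $q_{\mathrm{tr},1}=\dots=q_{\mathrm{tr},K}=q_{\mathrm{tr},o}=q_{\mathrm{tr}}$. Then for every $\theta\ge 0$, almost surely, $$\bar F_\gamma(K,\theta)=\sum_{j=1}^K\frac{\sum_{i=0}^{K-1}\alpha_i(\Omega)\left(q_{\mathrm{tr}}^i-q_{\mathrm{tr}}^K\right)(\omega_j^\eta)^i}{\omega_j^\eta\prod_{l\ne j}\left(\omega_l^\eta-\omega_j^\eta\right)}\,\mathrm C_j(\theta).$$ Moreover, if $q_{\mathrm{tr}}>0$ (so that $\hat\Omega$ is defined), then for all $0<d_1<\dots<d_K$ one has $G\left(\alpha_i(\hat\Omega)-\alpha_i(\Omega)\right)=\alpha_i(\Omega)\left(q_{\mathrm{tr}}^i-q_{\mathrm{tr}}^K\right)$ for $0\le i\le K-1$, so that the right-hand side above is what the general expression $$G\sum_{j=1}^K\frac{\sum_{i=0}^{K-1}\left(\alpha_i(\hat\Omega)-\alpha_i(\Omega)\right)(\omega_j^\eta)^i}{\omega_j^\eta\prod_{l\ne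 j}\left(\omega_l^\eta-\omega_j^\eta\right)}\,\mathrm C_j(\theta)$$ reduces to, for every $\theta\ge 0$. -/

import Mathlib

open MeasureTheory ProbabilityTheory
open scoped ENNReal

namespace CoopNetwork

/-! ### The Gauss hypergeometric function on the real half-line below one -/

/-- `f` is real-analytic on `(-∞, 1)` and is given on `(-1, 1)` by the Gauss series
`∑ (a)ₙ (b)ₙ / (c)ₙ * xⁿ / n!` (Mathlib's `₂F₁`, which is only meaningful there). -/
def IsGaussContinuation (a b c : ℝ) (f : ℝ → ℝ) : Prop :=
  AnalyticOnNhd ℝ f (Set.Iio 1) ∧ ∀ x : ℝ, |x| < 1 → f x = ₂F₁ a b c x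

open Classical in
/-- The Gauss hypergeometric function `₂F₁(a, b; c; z)` for real `z < 1`: the analytic continuation
of the Gauss series from `(-1, 1)` to `(-∞, 1)`. -/
noncomputable def gaussHypergeometric (a b c z : ℝ) : ℝ :=
  if h : ∃ f : ℝ → ℝ, IsGaussContinuation a b c f then h.choose z else 0

/-- The continuation is unique, so that `gaussHypergeometric` does not depend on a choice. -/
theorem gaussHypergeometric_eq {a b c : ℝ} {f : ℝ → ℝ} (hf : IsGaussContinuation a b c f)
    {z : ℝ} (hz : z < 1) : gaussHypergeometric a b c z = f z := by
  have h : ∃ f : ℝ → ℝ, IsGaussContinuation a b c f := ⟨f, hf⟩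
  have hs := h.choose_spec
  rw [gaussHypergeometric, dif_pos h]
  refine hs.1.eqOn_of_preconnected_of_eventuallyEq hf.1 isPreconnected_Iio
    (z₀ := 0) (by simp) ?_ hz
  filter_upwards [Metric.ball_mem_nhds (0 : ℝ) one_pos] with x hx
  have hx' : |x| < 1 := by simpa using hx
  rw [hs.2 x hx', hf.2 x hx']

/-- `𝓕(t₁, t₂) = 2 t₁ / (t₂ - 2) * ₂F₁(1, 1 - 2 / t₂; 2 - 2 / t₂; -t₁)`. -/
noncomputable def interfF (t₁ t₂ : ℝ) : ℝ :=
  2 * t₁ / (t₂ - 2) * gaussHypergeometric 1 (1 - 2 / t₂) (2 - 2 / t₂) (-t₁)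

/-! ### The coefficients `α_i` -/

/-- `α_i(s) = (-1)^i * (sum of all products of the elements of s taken |s| - i at a time)`,
for `0 ≤ i ≤ |s|`. -/
noncomputable def alpha (s : Multiset ℝ) (i : ℕ) : ℝ :=
  (-1) ^ i * s.esymm (s.card - i)

/-! ### Network parameters -/

/-- The deterministic parameters of the network: the transmitter tier (tier `0`), which serves the
user, and `M` interfering tiers (tiers `1, …, M`). -/
structure Params where
  /-- cluster size -/
  K : ℕ
  K_pos : 0 < K
  /-- number of interfering tiers -/
  M : ℕ
  /-- path-loss exponent -/
  eta : ℝ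
  two_lt_eta : 2 < eta
  /-- noise variance `σ²` -/
  noise : ℝ
  noise_nonneg : 0 ≤ noise
  /-- intensities `λ_0, …, λ_M` of the tiers -/
  lam : Fin (M + 1) → ℝ
  lam_pos : ∀ t, 0 < lam t
  /-- transmit powers of the interfering tiers, normalized by that of the transmitter tier -/
  power : Fin M → ℝ
  power_pos : ∀ m, 0 < power m
  /-- `q_{tr,i}`: one minus the transmission probability of the `i`-th in-cluster transmitter -/
  qIn : Fin K → ℝ
  qIn_mem : ∀ i, qIn i ∈ Set.Ico (0 : ℝ) 1
  /-- `q_{tr,o}`: the same for the out-of-cluster nodes of the transmitter tier -/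
  qOut : ℝ
  qOut_mem : qOut ∈ Set.Ico (0 : ℝ) 1
  /-- `q_tr^{(m)}`: the same for the nodes of the interfering tiers -/
  qTier : Fin M → ℝ
  qTier_mem : ∀ m, qTier m ∈ Set.Ico (0 : ℝ) 1

namespace Params

variable (N : Params)

/-- The index of the farthest in-cluster transmitter. -/
def last : Fin N.K := ⟨N.K - 1, Nat.sub_lt N.K_pos one_pos⟩

/-- `G = ∏ q_{tr,i}`. -/
noncomputable def G : ℝ := ∏ i, N.qIn i

/-- Normalized distances `ω_i = d_i / d_K`. -/
noncomputable def omega (d : Fin N.K → ℝ) (i : Fin N.K) : ℝ := d i / d N.last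

/-- The multiset `Ω = {ω_1^η, …, ω_K^η}`. -/
noncomputable def Omega (d : Fin N.K → ℝ) : Multiset ℝ :=
  (Finset.univ : Finset (Fin N.K)).val.map fun i => N.omega d i ^ N.eta

/-- The multiset `Ω̂ = {ω_1^η / q_{tr,1}, …, ω_K^η / q_{tr,K}}`. -/
noncomputable def OmegaHat (d : Fin N.K → ℝ) : Multiset ℝ :=
  (Finset.univ : Finset (Fin N.K)).val.map fun i => N.omega d i ^ N.eta / N.qIn i

/-- `D_j(M)`, the factor due to the interfering tiers. -/
noncomputable def D (theta : ℝ) (d : Fin N.K → ℝ) (j : Fin N.K) : ℝ :=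
  ∏ m : Fin N.M, Real.exp (-Real.pi * (1 - N.qTier m) * N.lam m.succ * d j ^ 2 *
    (theta * N.power m) ^ (2 / N.eta) * Real.Gamma (1 + 2 / N.eta) * Real.Gamma (1 - 2 / N.eta))

/-- `C_j(θ)`. -/
noncomputable def C (theta : ℝ) (d : Fin N.K → ℝ) (j : Fin N.K) : ℝ :=
  Real.exp (-(d j ^ N.eta * theta * N.noise)) *
    Real.exp (-Real.pi * (1 - N.qOut) * N.lam 0 * d N.last ^ 2 *
      interfF (N.omega d j ^ N.eta * theta) N.eta) *
    N.D theta d j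

/-- The expression
`∑_j (∑_{i<K} c_i (ω_j^η)^i) / (ω_j^η ∏_{l≠j} (ω_l^η - ω_j^η)) * C_j(θ)` for given coefficients
`c_0, …, c_{K-1}`. -/
noncomputable def mixture (c : ℕ → ℝ) (theta : ℝ) (d : Fin N.K → ℝ) : ℝ :=
  ∑ j, (∑ i ∈ Finset.range N.K, c i * (N.omega d j ^ N.eta) ^ i) /
    (N.omega d j ^ N.eta *
      ∏ l ∈ Finset.univ.erase j, (N.omega d l ^ N.eta - N.omega d j ^ N.eta)) *
    N.C theta d j

end Params

/-! ### The random network -/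

/-- The plane; the typical user sits at the origin. -/
abbrev Plane : Type := EuclideanSpace ℝ (Fin 2)

variable {Ω : Type*} [MeasurableSpace Ω]

/-- The number of points (with multiplicity) that the point process `X_0, X_1, …` has in `B`. -/
noncomputable def count (X : ℕ → Ω → Plane) (B : Set Plane) (ω : Ω) : ℕ∞ :=
  {i : ℕ | X i ω ∈ B}.encard

/-- The random points `X_0, X_1, …` form a homogeneous Poisson point process of intensity `lam` on
the plane: the number of points in a Borel set of finite area is Poisson with mean `lam * area`,
and the numbers of points in disjoint Borel sets are independent. -/
structure IsHomogeneousPPP (X : ℕ → Ω → Plane) (lam : ℝ) (P : Measure Ω) : Prop where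
  measurable : ∀ i, Measurable (X i)
  poisson : ∀ B : Set Plane, MeasurableSet B → volume B ≠ ∞ → ∀ n : ℕ,
    P {ω | count X B ω = n} = poissonMeasure (lam * volume.real B).toNNReal {n}
  indep : ∀ (n : ℕ) (B : Fin n → Set Plane), (∀ k, MeasurableSet (B k)) →
    Pairwise (Function.onFun Disjoint B) → iIndepFun (fun k => count X (B k)) P

/-- The random network with parameters `N`. Nodes are indexed by their tier `t` and, within a tier,
by `i : ℕ`; tier `0` is the transmitter tier, whose nodes are numbered (from `0`) by increasing
distance to the user. -/
structure Network (N : Params) (P : Measure Ω) where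
  /-- node locations -/
  loc : Fin (N.M + 1) → ℕ → Ω → Plane
  /-- whether the node transmits -/
  active : Fin (N.M + 1) → ℕ → Ω → Bool
  /-- channel power gain from the node to the user -/
  gain : Fin (N.M + 1) → ℕ → Ω → ℝ
  ppp : ∀ t, IsHomogeneousPPP (loc t) (N.lam t) P
  sorted : ∀ᵐ ω ∂P, Monotone fun i => ‖loc 0 i ω‖
  active_measurable : ∀ t i, Measurable (active t i)
  active_in : ∀ i : Fin N.K, P.real {ω | active 0 i ω = true} = 1 - N.qIn i
  active_out : ∀ i : ℕ, N.K ≤ i → P.real {ω | active 0 i ω = true} = 1 - N.qOut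
  active_tier : ∀ (m : Fin N.M) (i : ℕ),
    P.real {ω | active m.succ i ω = true} = 1 - N.qTier m
  gain_measurable : ∀ t i, Measurable (gain t i)
  gain_law : ∀ t i, HasLaw (gain t i) (expMeasure 1) P
  /- Tiers, activity indicators and gains are all mutually independent. -/
  indep_loc : iIndepFun (fun t ω i => loc t i ω) P
  indep_active : iIndepFun (fun (k : Fin (N.M + 1) × ℕ) ω => active k.1 k.2 ω) P
  indep_gain : iIndepFun (fun (k : Fin (N.M + 1) × ℕ) ω => gain k.1 k.2 ω) P
  indep_marks : IndepFun (fun ω t i => active t i ω) (fun ω t i => gain t i ω) P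
  indep_loc_marks :
    IndepFun (fun ω t i => loc t i ω) (fun ω => (fun t i => active t i ω, fun t i => gain t i ω)) P

namespace Network

variable {N : Params} {P : Measure Ω} (W : Network N P)

/-- Power received at the user from node `i` of tier `t`, if that node transmits with power `p`:
`1_{t,i} * p * d_{t,i}^{-η} * H_{t,i}`. -/
noncomputable def received (p : ℝ) (t : Fin (N.M + 1)) (i : ℕ) (ω : Ω) : ℝ≥0∞ :=
  if W.active t i ω = true then ENNReal.ofReal (p * ‖W.loc t i ω‖ ^ (-N.eta) * W.gain t i ω) else 0

/-- Useful power, received from the `K` closest transmitters. -/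
noncomputable def signal (ω : Ω) : ℝ≥0∞ := ∑ i ∈ Finset.range N.K, W.received 1 0 i ω

/-- Intrinsic plus extrinsic interference. -/
noncomputable def interference (ω : Ω) : ℝ≥0∞ :=
  (∑' i : ℕ, W.received 1 0 (N.K + i) ω) +
    ∑ m : Fin N.M, ∑' i : ℕ, W.received (N.power m) m.succ i ω

/-- The signal-to-interference-plus-noise ratio `γ`, with values in `[0, ∞]`. -/
noncomputable def sinr (ω : Ω) : ℝ≥0∞ :=
  W.signal ω / (W.interference ω + ENNReal.ofReal N.noise)

/-- The cluster geometry `(d_1, …, d_K)`: the distances of the `K` closest transmitters. -/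
noncomputable def dist (ω : Ω) (i : Fin N.K) : ℝ := ‖W.loc 0 i ω‖

/-- The σ-algebra generated by the cluster geometry. -/
@[reducible] noncomputable def geometry : MeasurableSpace Ω := MeasurableSpace.comap W.dist inferInstance

/-- The CCDF `Pr[γ > θ]` for given cluster geometry, i.e. the conditional probability of `γ > θ`
given `(d_1, …, d_K)`. -/
noncomputable def ccdf (theta : ℝ) : Ω → ℝ :=
  P⟦{ω | ENNReal.ofReal theta < W.sinr ω} | W.geometry⟧

end Network

end CoopNetwork

/-! Freeze all node locations. The useful power is then a sum of independent variables, the `i`-th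
being zero with probability q and exponential of rate a_i = d_i^η otherwise. Its Laplace transform
at -z is ∏ (a_i - q z)/(a_i - z), a rational function with simple poles when the distances are
distinct. Its partial fractions give the tail ∑_j A_j exp(-a_j x) with A_j = (1 - q) ∏_{l≠j} (a_l -
q a_j)/(a_l - a_j) (`measureReal_lt_sum_thinnedExp`, `prod_eq_one_sub_sum_tailCoeff`).

At x = θ(I + σ²), with I the independent interference, each exponential splits into a noise factor
and exp(-a_j θ I). Only the Laplace transform of I given (d_1, …, d_K) remains to be found. By the
Poisson property the transmitters beyond the K-th form a Poisson process outside the disk of radius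
d_K, independent of the cluster geometry (`lintegral_expNeg_tsum_beyond`). The generating functional
then turns each tier into the exponential of a radial integral: an Euler integral for ₂F₁ outside
the disk (`lintegral_compl_closedBall_interf`), a product of two Gamma values over the whole plane
(`lintegral_interf`). Together with the noise factor these make up C_j(θ).

It remains to recognise the A_j. The α_i(Ω) are the coefficients of ∏_l (ω_l^η - x). The numerator
of the stated weight is the value of this polynomial at q ω_j^η minus q^K times its value at its
root ω_j^η, hence ∏_l (ω_l^η - q ω_j^η) (`sum_alpha_div_eq_tailCoeff`). The A_j are homogeneous of
degree zero in the rates, so dividing every a_i by d_K^η changes nothing. The comparison with the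
general expression is the homogeneity of elementary symmetric functions under scaling by 1/q.

Exponentials of sums are taken on [0, ∞] through `expNeg`, so the interference may be handled before
it is known to be finite. Its finiteness is read off from its Laplace transform near zero. -/

namespace CoopNetwork

open Filter Topology

/-! ### The function `exp (-x)` on `[0, ∞]` -/

/-- `exp (-x)` for `x ∈ [0, ∞]`. -/
noncomputable def expNeg (x : ℝ≥0∞) : ℝ≥0∞ := EReal.exp (-(x : EReal))

theorem expNeg_zero : expNeg 0 = 1 := by simp [expNeg]

theorem expNeg_top : expNeg ∞ = 0 := by simp [expNeg]

theorem continuous_expNeg : Continuous expNeg :=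
  ENNReal.continuous_exp.comp (continuous_neg.comp continuous_coe_ennreal_ereal)

theorem measurable_expNeg : Measurable expNeg := continuous_expNeg.measurable

theorem expNeg_add (x y : ℝ≥0∞) : expNeg (x + y) = expNeg x * expNeg y := by
  rw [expNeg, expNeg, expNeg, ← EReal.exp_add, EReal.coe_ennreal_add, EReal.neg_add,
    sub_eq_add_neg]
  · exact Or.inl (EReal.coe_ennreal_ne_bot x)
  · exact Or.inr (EReal.coe_ennreal_ne_bot y)

theorem expNeg_antitone : Antitone expNeg := fun _ _ h =>
  EReal.exp_monotone (EReal.neg_le_neg_iff.2 (EReal.coe_ennreal_le_coe_ennreal_iff.2 h))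

theorem expNeg_le_one (x : ℝ≥0∞) : expNeg x ≤ 1 :=
  (expNeg_antitone zero_le).trans_eq expNeg_zero

theorem expNeg_ne_top (x : ℝ≥0∞) : expNeg x ≠ ∞ :=
  ((expNeg_le_one x).trans_lt ENNReal.one_lt_top).ne

theorem expNeg_ofReal {x : ℝ} (hx : 0 ≤ x) :
    expNeg (ENNReal.ofReal x) = ENNReal.ofReal (Real.exp (-x)) := by
  rw [expNeg, EReal.coe_ennreal_ofReal, max_eq_left hx, ← EReal.coe_neg, EReal.exp_coe]

theorem expNeg_sum {ι : Type*} (s : Finset ι) (f : ι → ℝ≥0∞) :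
    expNeg (∑ i ∈ s, f i) = ∏ i ∈ s, expNeg (f i) := by
  classical
  induction s using Finset.induction_on with
  | empty => simp [expNeg_zero]
  | insert a s ha ih => rw [Finset.sum_insert ha, Finset.prod_insert ha, expNeg_add, ih]

theorem expNeg_mul_natCast (c : ℝ≥0∞) (n : ℕ) : expNeg (c * n) = expNeg c ^ n := by
  induction n with
  | zero => simp [expNeg_zero]
  | succ n ih => rw [Nat.cast_succ, mul_add, mul_one, expNeg_add, ih, pow_succ]

/-- The inverse of `expNeg`. -/
noncomputable def negLog (y : ℝ≥0∞) : ℝ≥0∞ := (-ENNReal.log y).toENNReal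

theorem expNeg_negLog {y : ℝ≥0∞} (hy : y ≤ 1) : expNeg (negLog y) = y := by
  rw [expNeg, negLog, EReal.coe_toENNReal, neg_neg, ENNReal.exp_log]
  rw [EReal.le_neg, neg_zero]
  exact ENNReal.log_le_zero_iff.2 hy

theorem continuous_negLog : Continuous negLog :=
  EReal.continuous_toENNReal.comp (continuous_neg.comp ENNReal.continuous_log)

theorem negLog_antitone : Antitone negLog := fun _ _ h =>
  EReal.toENNReal_le_toENNReal (EReal.neg_le_neg_iff.2 (ENNReal.log_monotone h))

/-! ### Limits of integrals and sums -/

/-- Fatou bounds the integral of the limit from above, and the domination by the limit itself bounds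
the upper limit. No integrability and no monotonicity in `n` is needed; the rounding approximations
used later are not monotone. -/
theorem tendsto_lintegral_of_le {α : Type*} [MeasurableSpace α] {μ : Measure α}
    {F : ℕ → α → ℝ≥0∞} {f : α → ℝ≥0∞} (hF : ∀ n, Measurable (F n)) (hle : ∀ n x, F n x ≤ f x)
    (hlim : ∀ x, Tendsto (fun n => F n x) atTop (𝓝 (f x))) :
    Tendsto (fun n => ∫⁻ x, F n x ∂μ) atTop (𝓝 (∫⁻ x, f x ∂μ)) := by
  refine tendsto_of_le_liminf_of_limsup_le ?_ ?_
  · calc ∫⁻ x, f x ∂μ = ∫⁻ x, liminf (fun n => F n x) atTop ∂μ := by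
          simp_rw [(hlim _).liminf_eq]
      _ ≤ liminf (fun n => ∫⁻ x, F n x ∂μ) atTop := lintegral_liminf_le hF
  · refine limsup_le_of_le (h := Eventually.of_forall fun n => ?_)
    exact lintegral_mono (hle n)

theorem tendsto_tsum_of_le {F : ℕ → ℕ → ℝ≥0∞} {f : ℕ → ℝ≥0∞} (hle : ∀ n i, F n i ≤ f i)
    (hlim : ∀ i, Tendsto (fun n => F n i) atTop (𝓝 (f i))) :
    Tendsto (fun n => ∑' i, F n i) atTop (𝓝 (∑' i, f i)) := by
  simpa [lintegral_count] using tendsto_lintegral_of_le (μ := Measure.count)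
    (fun n => measurable_of_countable (F n)) hle hlim

theorem tendsto_lintegral_of_le_one {α : Type*} [MeasurableSpace α] {μ : Measure α}
    [IsFiniteMeasure μ] {ι : Type*} {l : Filter ι} [l.IsCountablyGenerated]
    {F : ι → α → ℝ≥0∞} {f : α → ℝ≥0∞} (hF : ∀ n, Measurable (F n)) (hle : ∀ n x, F n x ≤ 1)
    (hlim : ∀ᵐ x ∂μ, Tendsto (fun n => F n x) l (𝓝 (f x))) :
    Tendsto (fun n => ∫⁻ x, F n x ∂μ) l (𝓝 (∫⁻ x, f x ∂μ)) :=
  tendsto_lintegral_filter_of_dominated_convergence (fun _ => 1) (Eventually.of_forall hF)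
    (Eventually.of_forall fun n => Eventually.of_forall (hle n)) (by simp) hlim

/-- The Laplace transform of a countable sum of independent random variables. -/
theorem lintegral_expNeg_tsum {Ω ι : Type*} [MeasurableSpace Ω] {P : Measure Ω}
    [IsProbabilityMeasure P] [Countable ι] {R : ι → Ω → ℝ≥0∞} (hR : ∀ i, Measurable (R i))
    (hind : iIndepFun R P) {g : ι → ℝ≥0∞} (hg : ∀ i, ∫⁻ ω, expNeg (R i ω) ∂P = expNeg (g i)) :
    ∫⁻ ω, expNeg (∑' i, R i ω) ∂P = expNeg (∑' i, g i) := by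
  -- Bounded convergence along the finite subsets of `ι`. Countability of `ι` makes this filter
  -- countably generated.
  have h1 : Tendsto (fun s : Finset ι => ∫⁻ ω, expNeg (∑ i ∈ s, R i ω) ∂P) atTop
      (𝓝 (∫⁻ ω, expNeg (∑' i, R i ω) ∂P)) := by
    refine tendsto_lintegral_of_le_one
      (fun s => measurable_expNeg.comp (Finset.measurable_fun_sum s fun i _ => hR i))
      (fun s ω => expNeg_le_one _) (Eventually.of_forall fun ω => ?_)
    exact (continuous_expNeg.tendsto _).comp ENNReal.summable.hasSum
  have h2 : Tendsto (fun s : Finset ι => expNeg (∑ i ∈ s, g i)) atTop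
      (𝓝 (expNeg (∑' i, g i))) :=
    (continuous_expNeg.tendsto _).comp ENNReal.summable.hasSum
  refine tendsto_nhds_unique h1 (h2.congr fun s => ?_)
  simp_rw [expNeg_sum]
  rw [lintegral_prod_eq_prod_lintegral_of_indepFun s (fun i ω => expNeg (R i ω))
    (hind.comp (fun _ => expNeg) fun _ => measurable_expNeg)
    fun i => measurable_expNeg.comp (hR i)]
  simp_rw [hg]

end CoopNetwork

/-! ### Counts of a Poisson process. -/

namespace CoopNetwork

open Filter Topology

variable {Ω : Type*} [MeasurableSpace Ω] {P : Measure Ω} {X : ℕ → Ω → Plane} {lam : ℝ}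

omit [MeasurableSpace Ω] in
theorem count_toENNReal (X : ℕ → Ω → Plane) (B : Set Plane) (ω : Ω) :
    (count X B ω : ℝ≥0∞) = ∑' i, B.indicator 1 (X i ω) := by
  rw [count, ← ENNReal.tsum_set_one]
  exact tsum_subtype {i | X i ω ∈ B} (fun _ => (1 : ℝ≥0∞))

theorem measurable_count (hX : ∀ i, Measurable (X i)) {B : Set Plane} (hB : MeasurableSet B) :
    Measurable (count X B) := by
  refine measurable_to_countable' fun n => ?_
  have h : Measurable fun ω => (count X B ω : ℝ≥0∞) := by
    simp_rw [count_toENNReal]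
    exact Measurable.tsum fun i => (measurable_one.indicator hB).comp (hX i)
  have h2 : count X B ⁻¹' {n} = (fun ω => (count X B ω : ℝ≥0∞)) ⁻¹' {(n : ℝ≥0∞)} := by
    ext ω; simp
  rw [h2]
  exact h (measurableSet_singleton _)

/-- The definition prescribes only the probabilities of finite values. These already sum to one, so
nothing is left for the value `⊤`: an inequality between two probability measures is an equality. -/
theorem IsHomogeneousPPP.map_count [IsProbabilityMeasure P] (hX : IsHomogeneousPPP X lam P)
    {B : Set Plane} (hB : MeasurableSet B) (hv : volume B ≠ ∞) :
    P.map (count X B) = (poissonMeasure (lam * volume.real B).toNNReal).map (Nat.cast : ℕ → ℕ∞) := by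
  have hm := measurable_count hX.measurable hB
  have : IsProbabilityMeasure (P.map (count X B)) := Measure.isProbabilityMeasure_map hm.aemeasurable
  have : IsProbabilityMeasure
      ((poissonMeasure (lam * volume.real B).toNNReal).map (Nat.cast : ℕ → ℕ∞)) :=
    Measure.isProbabilityMeasure_map (measurable_of_countable _).aemeasurable
  refine (Measure.eq_of_le_of_measure_univ_eq (Measure.le_iff.2 fun s _ => ?_) (by simp)).symm
  rw [Measure.map_apply (measurable_of_countable _) (MeasurableSet.of_discrete),
    Measure.map_apply hm (MeasurableSet.of_discrete)]
  calc poissonMeasure (lam * volume.real B).toNNReal (Nat.cast ⁻¹' s)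
      = ∑' n : (Nat.cast ⁻¹' s : Set ℕ), poissonMeasure (lam * volume.real B).toNNReal {(n : ℕ)} := by
        rw [← measure_biUnion (Set.to_countable (Nat.cast ⁻¹' s)) (fun a _ b _ h => by simpa using h)
          (fun _ _ => MeasurableSet.of_discrete), Set.biUnion_of_singleton]
    _ = ∑' n : (Nat.cast ⁻¹' s : Set ℕ), P (count X B ⁻¹' {((n : ℕ) : ℕ∞)}) := by
        refine tsum_congr fun n => (hX.poisson B hB hv n).symm
    _ = P (⋃ n ∈ (Nat.cast ⁻¹' s : Set ℕ), count X B ⁻¹' {((n : ℕ) : ℕ∞)}) := by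
        refine (measure_biUnion (μ := P) (f := fun n : ℕ => count X B ⁻¹' {(n : ℕ∞)})
          (Set.to_countable (Nat.cast ⁻¹' s)) (fun a _ b _ h => ?_)
          (fun _ _ => hm MeasurableSet.of_discrete)).symm
        exact Disjoint.preimage _ (by simpa using h)
    _ ≤ P (count X B ⁻¹' s) := by
        refine measure_mono (Set.iUnion₂_subset fun n hn ω hω => ?_)
        simp only [Set.mem_preimage, Set.mem_singleton_iff] at hω hn ⊢
        rwa [hω]

/-- The probability generating function exp(-r(1 - z)) of the Poisson law, by the exponential
series. -/
theorem lintegral_pow_poissonMeasure (r : NNReal) {z : ℝ≥0∞} (hz : z ≤ 1) :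
    ∫⁻ n, z ^ n ∂poissonMeasure r = expNeg (r * (1 - z)) := by
  lift z to NNReal using (hz.trans_lt ENNReal.one_lt_top).ne
  have hz' : (z : ℝ) ≤ 1 := by exact_mod_cast hz
  rw [poissonMeasure, lintegral_sum_measure]
  simp only [lintegral_smul_measure, lintegral_dirac]
  have h1 : HasSum (fun n : ℕ => Real.exp (-r) * ((r * z : ℝ) ^ n / n.factorial))
      (Real.exp (-r) * Real.exp (r * z)) := by
    have := NormedSpace.expSeries_div_hasSum_exp (𝔸 := ℝ) (r * z : ℝ)
    rw [← Real.exp_eq_exp_ℝ] at this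
    exact this.mul_left _
  have h2 : (r : ℝ≥0∞) * (1 - z) = ENNReal.ofReal (r * (1 - z)) := by
    rw [ENNReal.ofReal_mul r.coe_nonneg, ENNReal.ofReal_sub _ z.coe_nonneg]
    simp
  rw [h2, expNeg_ofReal (mul_nonneg r.coe_nonneg (by linarith)),
    show -((r : ℝ) * (1 - z)) = -r + r * z by ring, Real.exp_add, ← h1.tsum_eq,
    ENNReal.ofReal_tsum_of_nonneg (fun n => by positivity) h1.summable]
  refine tsum_congr fun n => ?_
  rw [← ENNReal.ofReal_coe_nnreal, ← ENNReal.ofReal_pow z.coe_nonneg, smul_eq_mul,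
    ← ENNReal.ofReal_mul (by positivity)]
  congr 1
  rw [mul_pow]; ring

/-- The generating function at z = exp(-c). The value c = ∞ is allowed and gives the void
probability. -/
theorem IsHomogeneousPPP.lintegral_expNeg_count [IsProbabilityMeasure P]
    (hX : IsHomogeneousPPP X lam P) {B : Set Plane} (hB : MeasurableSet B) (hv : volume B ≠ ∞)
    (c : ℝ≥0∞) :
    ∫⁻ ω, expNeg (c * count X B ω) ∂P =
      expNeg (ENNReal.ofReal lam * ((1 - expNeg c) * volume B)) := by
  have hm := measurable_count hX.measurable hB
  rw [← lintegral_map (f := fun n : ℕ∞ => expNeg (c * n)) (measurable_of_countable _) hm,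
    hX.map_count hB hv, lintegral_map (measurable_of_countable _) (measurable_of_countable _)]
  simp only [ENat.toENNReal_coe, expNeg_mul_natCast]
  rw [lintegral_pow_poissonMeasure _ (expNeg_le_one c)]
  congr 1
  rw [← ENNReal.ofReal_coe_nnreal, Real.coe_toNNReal', ENNReal.ofReal_max, ENNReal.ofReal_zero,
    max_eq_left zero_le, ENNReal.ofReal_mul' measureReal_nonneg, ofReal_measureReal hv]
  ring

/-- The numbers of points in disjoint Borel sets, indexed by a finite type, are independent. -/
theorem IsHomogeneousPPP.indep_finite (hX : IsHomogeneousPPP X lam P) {ι : Type*} [Finite ι]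
    {B : ι → Set Plane} (hB : ∀ k, MeasurableSet (B k))
    (hd : Pairwise (Function.onFun Disjoint B)) : iIndepFun (fun k => count X (B k)) P := by
  obtain ⟨n, ⟨e⟩⟩ := Finite.exists_equiv_fin ι
  have h := hX.indep n (fun k => B (e.symm k)) (fun k => hB _)
    fun a b hab => hd (e.symm.injective.ne hab)
  exact (iIndepFun_precomp_of_bijective e.symm.bijective).1 h


/-! ### The generating functional -/

-- Grouping the points by the value of `f` gives a finite combination of counts in disjoint level
-- sets. The value 0 is dropped because its level set may have infinite area.
omit [MeasurableSpace Ω] in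
theorem tsum_simpleFunc (f : SimpleFunc Plane ℝ≥0∞) (ω : Ω) :
    ∑' i, f (X i ω) = ∑ c : {c // c ∈ f.range.filter (· ≠ 0)},
      (c : ℝ≥0∞) * count X (f ⁻¹' {(c : ℝ≥0∞)}) ω := by
  simp_rw [count_toENNReal, ← ENNReal.tsum_mul_left]
  rw [← tsum_fintype (L := .unconditional _), ENNReal.tsum_comm]
  refine tsum_congr fun i => ?_
  rw [tsum_fintype, Finset.sum_coe_sort (f.range.filter (· ≠ 0))
    fun c => c * (f ⁻¹' {c}).indicator 1 (X i ω)]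
  by_cases h : f (X i ω) = 0
  · rw [h]
    refine (Finset.sum_eq_zero fun c hc => ?_).symm
    rw [Set.indicator_of_notMem, mul_zero]
    simp only [Set.mem_preimage, h, Set.mem_singleton_iff]
    exact (Finset.mem_filter.1 hc).2.symm
  · rw [Finset.sum_eq_single (f (X i ω))]
    · simp
    · intro c _ hc
      rw [Set.indicator_of_notMem, mul_zero]
      simpa using hc.symm
    · intro hn
      exact absurd (Finset.mem_filter.2 ⟨f.mem_range_self _, h⟩) hn

theorem lintegral_one_sub_expNeg_simpleFunc (f : SimpleFunc Plane ℝ≥0∞) :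
    ∫⁻ x, (1 - expNeg (f x)) = ∑ c : {c // c ∈ f.range.filter (· ≠ 0)},
      (1 - expNeg c) * volume (f ⁻¹' {(c : ℝ≥0∞)}) := by
  have h := (f.map fun c => 1 - expNeg c).lintegral_eq_lintegral volume
  simp only [SimpleFunc.coe_map, Function.comp_apply] at h
  rw [h, SimpleFunc.map_lintegral, Finset.sum_coe_sort (f.range.filter (· ≠ 0))
    fun c => (1 - expNeg c) * volume (f ⁻¹' {c}), Finset.sum_filter_of_ne]
  intro c _ hc h0
  rw [h0, expNeg_zero] at hc
  simp at hc

/-- The numbers of points in disjoint subsets of `V` are jointly independent of the event `E`,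
as far as their joint Laplace transform is concerned. -/
def IndepOfCounts (X : ℕ → Ω → Plane) (P : Measure Ω) (E : Set Ω) (V : Set Plane) : Prop :=
  ∀ (ι : Type) [Fintype ι] (C : ι → Set Plane), (∀ l, MeasurableSet (C l)) →
    Pairwise (Function.onFun Disjoint C) → (∀ l, C l ⊆ V) → ∀ c : ι → ℝ≥0∞,
    ∫⁻ ω in E, ∏ l, expNeg (c l * count X (C l) ω) ∂P =
      P E * ∏ l, ∫⁻ ω, expNeg (c l * count X (C l) ω) ∂P

/-- For a simple function with level sets of finite area, this is a product of Poisson transforms;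
general `g` follows by approximation from below. Taking `E` to be everything gives the usual
generating functional; taking `E` determined by the points outside `V` gives independence of the
points in `V` from `E`. -/
theorem IsHomogeneousPPP.setLIntegral_expNeg_tsum [IsProbabilityMeasure P]
    (hX : IsHomogeneousPPP X lam P) {E : Set Ω} {V : Set Plane} (hE : IndepOfCounts X P E V)
    {g : Plane → ℝ≥0∞} (hg : Measurable g) (hgV : ∀ x, x ∉ V → g x = 0) :
    ∫⁻ ω in E, expNeg (∑' i, g (X i ω)) ∂P =
      P E * expNeg (ENNReal.ofReal lam * ∫⁻ x, (1 - expNeg (g x))) := by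
  have hsimple : ∀ f : SimpleFunc Plane ℝ≥0∞, (∀ c ≠ 0, volume (f ⁻¹' {c}) ≠ ∞) →
      (∀ x, x ∉ V → f x = 0) → ∫⁻ ω in E, expNeg (∑' i, f (X i ω)) ∂P =
        P E * expNeg (ENNReal.ofReal lam * ∫⁻ x, (1 - expNeg (f x))) := by
    intro f hf hfV
    simp_rw [tsum_simpleFunc, expNeg_sum]
    rw [hE _ _ (fun c => f.measurableSet_preimage _), lintegral_one_sub_expNeg_simpleFunc,
      Finset.mul_sum, expNeg_sum]
    · congr 1
      refine Finset.prod_congr rfl fun c _ => ?_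
      exact hX.lintegral_expNeg_count (f.measurableSet_preimage _)
        (hf _ (Finset.mem_filter.1 c.2).2) _
    · intro a b hab
      exact Disjoint.preimage _ (Set.disjoint_singleton.2 (Subtype.coe_injective.ne hab))
    · intro c x hx
      by_contra hxV
      rw [Set.mem_preimage, hfV x hxV, Set.mem_singleton_iff] at hx
      exact (Finset.mem_filter.1 c.2).2 hx.symm
  let f : ℕ → SimpleFunc Plane ℝ≥0∞ := fun n =>
    -- The cut-off to a ball gives the nonzero level sets finite area.
    (SimpleFunc.eapprox g n).restrict (Metric.closedBall 0 n)
  have hfx : ∀ n x, f n x = (Metric.closedBall (0 : Plane) n).indicator (SimpleFunc.eapprox g n) x :=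
    fun n x => SimpleFunc.restrict_apply _ measurableSet_closedBall _
  have hle : ∀ n x, f n x ≤ g x := fun n x => by
    rw [hfx]
    refine (Set.indicator_le_self _ _ _).trans ?_
    rw [← SimpleFunc.iSup_eapprox_apply hg]
    exact le_iSup (fun n => SimpleFunc.eapprox g n x) n
  have hlim : ∀ x, Tendsto (fun n => f n x) atTop (𝓝 (g x)) := fun x => by
    refine (SimpleFunc.tendsto_eapprox hg x).congr' ?_
    obtain ⟨m, hm⟩ := exists_nat_ge ‖x‖
    filter_upwards [eventually_ge_atTop m] with n hn
    rw [hfx, Set.indicator_of_mem]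
    rw [mem_closedBall_zero_iff]
    exact hm.trans (by exact_mod_cast hn)
  have h1 : Tendsto (fun n => ∫⁻ ω in E, expNeg (∑' i, f n (X i ω)) ∂P) atTop
      (𝓝 (∫⁻ ω in E, expNeg (∑' i, g (X i ω)) ∂P)) := by
    refine tendsto_lintegral_of_le_one (fun n => measurable_expNeg.comp
      (Measurable.tsum fun i => (f n).measurable.comp (hX.measurable i)))
      (fun _ _ => expNeg_le_one _) (Eventually.of_forall fun ω => ?_)
    exact (continuous_expNeg.tendsto _).comp
      (tendsto_tsum_of_le (fun n i => hle n _) fun i => hlim _)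
  have h2 : Tendsto (fun n => P E * expNeg (ENNReal.ofReal lam * ∫⁻ x, (1 - expNeg (f n x)))) atTop
      (𝓝 (P E * expNeg (ENNReal.ofReal lam * ∫⁻ x, (1 - expNeg (g x))))) := by
    refine ENNReal.Tendsto.const_mul ((continuous_expNeg.tendsto _).comp
      (ENNReal.Tendsto.const_mul ?_ (Or.inr ENNReal.ofReal_ne_top))) (Or.inr (measure_ne_top _ _))
    refine tendsto_lintegral_of_le
      (fun n => measurable_const.sub (measurable_expNeg.comp (f n).measurable))
      (fun n x => tsub_le_tsub_left (expNeg_antitone (hle n x)) _) (fun x => ?_)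
    exact ENNReal.Tendsto.sub tendsto_const_nhds ((continuous_expNeg.tendsto _).comp (hlim x))
      (Or.inl ENNReal.one_ne_top)
  refine tendsto_nhds_unique h1 (h2.congr fun n => (hsimple (f n) ?_ ?_).symm)
  · intro c hc
    refine ((measure_mono fun x hx => ?_).trans_lt
      (measure_closedBall_lt_top (x := (0 : Plane)) (r := n))).ne
    rw [Set.mem_preimage, hfx, Set.mem_singleton_iff] at hx
    by_contra hx2
    rw [Set.indicator_of_notMem hx2] at hx
    exact hc hx.symm
  · intro x hx
    exact le_antisymm ((hle n x).trans_eq (hgV x hx)) zero_le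

theorem IsHomogeneousPPP.indepOfCounts_univ [IsProbabilityMeasure P]
    (hX : IsHomogeneousPPP X lam P) : IndepOfCounts X P Set.univ Set.univ := by
  intro ι _ C hC hd _ c
  rw [Measure.restrict_univ, measure_univ, one_mul]
  have hm : ∀ l : ι, Measurable fun n : ℕ∞ => expNeg (c l * n) := fun l => measurable_of_countable _
  exact lintegral_prod_eq_prod_lintegral_of_indepFun Finset.univ
    (fun l ω => expNeg (c l * count X (C l) ω))
    ((hX.indep_finite hC hd).comp (fun l n => expNeg (c l * n)) hm)
    fun l => (hm l).comp (measurable_count hX.measurable (hC l))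

/-- The generating functional of a homogeneous Poisson point process. -/
theorem IsHomogeneousPPP.lintegral_expNeg_tsum [IsProbabilityMeasure P]
    (hX : IsHomogeneousPPP X lam P) {g : Plane → ℝ≥0∞} (hg : Measurable g) :
    ∫⁻ ω, expNeg (∑' i, g (X i ω)) ∂P =
      expNeg (ENNReal.ofReal lam * ∫⁻ x, (1 - expNeg (g x))) := by
  have h := hX.setLIntegral_expNeg_tsum hX.indepOfCounts_univ hg (fun x hx => absurd trivial hx)
  rwa [Measure.restrict_univ, measure_univ, one_mul] at h

/-- Joint lower bounds on the numbers of points in subsets of `Vᶜ` are independent of the numbers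
of points in disjoint subsets of `V`. -/
theorem IsHomogeneousPPP.indepOfCounts_compl [IsProbabilityMeasure P]
    (hX : IsHomogeneousPPP X lam P) {V : Set Plane} {κ : Type} [Fintype κ]
    {B : κ → Set Plane} (hB : ∀ k, MeasurableSet (B k)) (hBV : ∀ k, B k ⊆ Vᶜ) (m : κ → ℕ∞) :
    IndepOfCounts X P {ω | ∀ k, m k ≤ count X (B k) ω} V := by
  classical
  intro ι _ C hC hd hCV c
  -- The `B k` may overlap. `A s` is the atom of points lying in exactly those `B k` with `k ∈ s`;
  -- atoms are disjoint, and the count of `B k` is the sum of the counts of the atoms with `k ∈ s`.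
  -- The atom of the empty set is left out, since it can meet `V`.
  let A : Finset κ → Set Plane := fun s => {x | ∀ k, k ∈ s ↔ x ∈ B k}
  have hA : ∀ s, MeasurableSet (A s) := fun s => by
    have : A s = ⋂ k, {x | k ∈ s ↔ x ∈ B k} := by ext x; simp [A]
    rw [this]
    refine MeasurableSet.iInter fun k => ?_
    by_cases hk : k ∈ s
    · exact (hB k).congr (by ext; simp [hk])
    · exact (hB k).compl.congr (by ext; simp [hk])
  have hAd : ∀ s t, s ≠ t → Disjoint (A s) (A t) := fun s t hst => by
    refine Set.disjoint_left.2 fun x hs ht => hst ?_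
    ext k
    exact (hs k).trans (ht k).symm
  have hcount : ∀ k ω, (count X (B k) ω : ℝ≥0∞) =
      ∑ s : {s : Finset κ // s.Nonempty}, if k ∈ s.1 then (count X (A s) ω : ℝ≥0∞) else 0 := by
    intro k ω
    simp_rw [count_toENNReal]
    have : ∀ s : {s : Finset κ // s.Nonempty},
        (if k ∈ s.1 then ∑' i, (A s).indicator (1 : Plane → ℝ≥0∞) (X i ω) else 0) =
        ∑' i, if k ∈ s.1 then (A s).indicator (1 : Plane → ℝ≥0∞) (X i ω) else 0 := by
      intro s; split_ifs <;> simp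
    simp_rw [this]
    rw [← tsum_fintype (L := .unconditional _), ENNReal.tsum_comm]
    refine tsum_congr fun i => ?_
    rw [tsum_fintype]
    by_cases hk : X i ω ∈ B k
    · let s0 : Finset κ := Finset.univ.filter fun k => X i ω ∈ B k
      have hs0 : k ∈ s0 := by simp [s0, hk]
      have hmem : X i ω ∈ A s0 := fun k => by simp [s0]
      rw [Finset.sum_eq_single ⟨s0, k, hs0⟩]
      · simp [hs0, hmem, hk]
      · intro s _ hs
        have : X i ω ∉ A s := fun h =>
          Set.disjoint_left.1 (hAd s s0 fun h' => hs (Subtype.ext h')) h hmem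
        simp [this]
      · simp
    · rw [Set.indicator_of_notMem hk]
      refine (Finset.sum_eq_zero fun s _ => ?_).symm
      split_ifs with hks
      · exact Set.indicator_of_notMem (fun h => hk ((h k).1 hks)) _
      · rfl
  let D : {s : Finset κ // s.Nonempty} ⊕ ι → Set Plane := Sum.elim (fun s => A s) C
  have hD : ∀ a, MeasurableSet (D a) := by
    rintro (s | l)
    · exact hA s
    · exact hC l
  have hAC : ∀ (s : {s : Finset κ // s.Nonempty}) l, Disjoint (A s) (C l) := fun s l => by
    obtain ⟨k, hk⟩ := s.2
    exact Set.disjoint_left.2 fun x hx hxC => hBV k ((hx k).1 hk) (hCV l hxC)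
  have hDd : Pairwise (Function.onFun Disjoint D) := by
    rintro (s | l) (t | l') hne
    · exact hAd s t fun h => hne (by rw [Subtype.ext h])
    · exact hAC s l'
    · exact (hAC t l).symm
    · exact hd fun h => hne (by rw [h])
  have hind := (hX.indep_finite hD hDd).indepFun_finset
    (Finset.univ.map Function.Embedding.inl) (Finset.univ.map Function.Embedding.inr)
    (by simp [Finset.disjoint_left]) fun a => measurable_count hX.measurable (hD a)
  have hmem_l : ∀ s, (Sum.inl s : {s : Finset κ // s.Nonempty} ⊕ ι) ∈
      (Finset.univ.map Function.Embedding.inl : Finset ({s : Finset κ // s.Nonempty} ⊕ ι)) := by simp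
  have hmem_r : ∀ l, (Sum.inr l : {s : Finset κ // s.Nonempty} ⊕ ι) ∈
      (Finset.univ.map Function.Embedding.inr : Finset ({s : Finset κ // s.Nonempty} ⊕ ι)) := by simp
  -- The event expressed through the atom counts alone, which are independent of the counts of the
  -- `C l`.
  let U : Set ((i : (Finset.univ.map Function.Embedding.inl :
      Finset ({s : Finset κ // s.Nonempty} ⊕ ι))) → ℕ∞) :=
    {f | ∀ k, (m k : ℝ≥0∞) ≤ ∑ s : {s : Finset κ // s.Nonempty},
      if k ∈ s.1 then (f ⟨Sum.inl s, hmem_l s⟩ : ℝ≥0∞) else 0}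
  have hU : MeasurableSet U := by
    have : U = ⋂ k, {f | (m k : ℝ≥0∞) ≤ ∑ s : {s : Finset κ // s.Nonempty},
      if k ∈ s.1 then (f ⟨Sum.inl s, hmem_l s⟩ : ℝ≥0∞) else 0} := by ext f; simp [U]
    rw [this]
    refine MeasurableSet.iInter fun k => measurableSet_le measurable_const ?_
    refine Finset.measurable_fun_sum _ fun s _ => ?_
    split_ifs
    · exact (measurable_of_countable (fun n : ℕ∞ => (n : ℝ≥0∞))).comp (measurable_pi_apply _)
    · exact measurable_const
  have hE : {ω | ∀ k, m k ≤ count X (B k) ω} = (fun ω (i : (Finset.univ.map Function.Embedding.inl :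
      Finset ({s : Finset κ // s.Nonempty} ⊕ ι))) => count X (D i) ω) ⁻¹' U := by
    ext ω
    simp only [Set.mem_ofPred_eq, Set.mem_preimage, U]
    refine forall_congr' fun k => ?_
    rw [← ENat.toENNReal_le, hcount]
    rfl
  have hφ : Measurable (U.indicator fun _ => (1 : ℝ≥0∞)) := measurable_const.indicator hU
  have hψ : Measurable fun f : (i : (Finset.univ.map Function.Embedding.inr :
      Finset ({s : Finset κ // s.Nonempty} ⊕ ι))) → ℕ∞ =>
      ∏ l : ι, expNeg (c l * (f ⟨Sum.inr l, hmem_r l⟩ : ℝ≥0∞)) :=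
    Finset.measurable_fun_prod _ fun l _ => (measurable_of_countable
      (fun n : ℕ∞ => expNeg (c l * (n : ℝ≥0∞)))).comp (measurable_pi_apply _)
  have hcm : ∀ a, Measurable (count X (D a)) := fun a => measurable_count hX.measurable (hD a)
  have hEm : MeasurableSet {ω | ∀ k, m k ≤ count X (B k) ω} := by
    rw [hE]
    exact measurableSet_preimage (measurable_pi_lambda _ fun i => hcm i) hU
  have hprod := lintegral_mul_eq_lintegral_mul_lintegral_of_indepFun
    (hφ.comp (measurable_pi_lambda _ fun i => hcm i))
    (hψ.comp (measurable_pi_lambda _ fun i => hcm i)) (hind.comp hφ hψ)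
  have huniv := hX.indepOfCounts_univ ι C hC hd (fun _ => Set.subset_univ _) c
  rw [Measure.restrict_univ, measure_univ, one_mul] at huniv
  rw [← huniv, ← lintegral_indicator_one hEm, ← lintegral_indicator hEm]
  convert hprod using 1
  · refine lintegral_congr fun ω => ?_
    rw [hE]
    simp only [Set.indicator_apply, Set.mem_preimage, Pi.mul_apply, Function.comp_apply]
    split_ifs <;> simp [D]
  · rw [hE]
    rfl

end CoopNetwork

namespace CoopNetwork

open Filter Topology

variable {Ω : Type*} [MeasurableSpace Ω] {P : Measure Ω} {X : ℕ → Ω → Plane} {lam : ℝ}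

/-! ### Absence of ties -/

theorem IsHomogeneousPPP.ae_notMem_of_null [IsProbabilityMeasure P]
    (hX : IsHomogeneousPPP X lam P) {B : Set Plane} (hB : MeasurableSet B) (hv : volume B = 0) :
    ∀ᵐ ω ∂P, ∀ i, X i ω ∉ B := by
  have h := hX.poisson B hB (by simp [hv]) 0
  have h0 : P {ω | count X B ω = (0 : ℕ)} = 1 := by
    rw [h, poissonMeasure_singleton, measureReal_def, hv]
    simp
  have hm : MeasurableSet {ω | count X B ω = (0 : ℕ)} :=
    measurable_count hX.measurable hB (measurableSet_singleton _)
  have := (mem_ae_iff_prob_eq_one hm).2 h0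
  filter_upwards [this] with ω hω i hi
  have h1 : count X B ω = 0 := by simpa using hω
  rw [count, Set.encard_eq_zero] at h1
  exact (Set.eq_empty_iff_forall_notMem.1 h1 i) hi

/-- The probability is 1 - (1 + m) exp(-m), at most 1 - (1 + m)(1 - m) = m². It is the quadratic
order in the area that makes the union bound over many small cells vanish. -/
theorem IsHomogeneousPPP.measure_two_le_count [IsProbabilityMeasure P]
    (hX : IsHomogeneousPPP X lam P) (hlam : 0 ≤ lam) {B : Set Plane} (hB : MeasurableSet B)
    (hv : volume B ≠ ∞) :
    P {ω | 2 ≤ count X B ω} ≤ ENNReal.ofReal ((lam * volume.real B) ^ 2) := by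
  have hm := measurable_count hX.measurable hB
  set m := lam * volume.real B with hmdef
  have hm0 : 0 ≤ m := by positivity
  have h0 := hX.poisson B hB hv 0
  have h1 := hX.poisson B hB hv 1
  rw [poissonMeasure_singleton, Real.coe_toNNReal _ hm0] at h0 h1
  have hc : {ω | 2 ≤ count X B ω}ᶜ = {ω | count X B ω = (0 : ℕ)} ∪ {ω | count X B ω = (1 : ℕ)} := by
    ext ω
    simp only [Set.mem_compl_iff, Set.mem_ofPred_eq, Set.mem_union, not_le]
    constructor
    · intro h
      obtain ⟨n, hn⟩ := ENat.ne_top_iff_exists.1 (h.trans_le le_top).ne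
      rw [← hn] at h ⊢
      norm_cast at h ⊢
      omega
    · rintro (h | h) <;> rw [h] <;> norm_num
  have hdisj : Disjoint {ω | count X B ω = (0 : ℕ)} {ω | count X B ω = (1 : ℕ)} := by
    refine Set.disjoint_left.2 fun ω h h' => ?_
    rw [Set.mem_ofPred_eq] at h h'
    rw [h] at h'
    norm_num at h'
  have hms : MeasurableSet {ω | 2 ≤ count X B ω} :=
    hm (MeasurableSet.of_discrete (s := Set.Ici 2))
  have hE := prob_compl_eq_one_sub hms (μ := P)
  rw [hc, measure_union hdisj (hm (measurableSet_singleton _)), h0, h1,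
    ← ENNReal.ofReal_add (by positivity) (by positivity)] at hE
  have hle := prob_le_one (μ := P) (s := {ω | 2 ≤ count X B ω})
  have : P {ω | 2 ≤ count X B ω} = 1 - (1 - P {ω | 2 ≤ count X B ω}) :=
    (ENNReal.sub_sub_cancel ENNReal.one_ne_top hle).symm
  rw [this, ← hE, ← ENNReal.ofReal_one, ← ENNReal.ofReal_sub _ (by positivity)]
  refine ENNReal.ofReal_le_ofReal ?_
  have hexp : 1 - m ≤ Real.exp (-m) := by linarith [Real.add_one_le_exp (-m)]
  simp only [pow_zero, pow_one, Nat.factorial_zero, Nat.factorial_one, Nat.cast_one, div_one,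
    mul_one]
  nlinarith

theorem volume_real_annulus {r s : ℝ} (hr : 0 ≤ r) (hrs : r ≤ s) :
    volume.real (Metric.ball (0 : Plane) s \ Metric.ball 0 r) = Real.pi * (s ^ 2 - r ^ 2) := by
  rw [measureReal_sdiff (Metric.ball_subset_ball hrs) measurableSet_ball]
  simp only [measureReal_def, EuclideanSpace.volume_ball_fin_two, ENNReal.toReal_mul,
    ENNReal.toReal_pow, ENNReal.toReal_ofReal hr, ENNReal.toReal_ofReal (hr.trans hrs), ENNReal.toReal_ofReal Real.pi_pos.le]
  ring

/-- Cut the disk of radius `R` into n + 1 annuli of equal area. A tie inside the disk puts two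
points in one annulus, which has probability at most (n + 1)(λπR²/(n + 1))², and this tends to 0. -/
theorem IsHomogeneousPPP.ae_norm_injective [IsProbabilityMeasure P]
    (hX : IsHomogeneousPPP X lam P) (hlam : 0 ≤ lam) :
    ∀ᵐ ω ∂P, Function.Injective fun i => ‖X i ω‖ := by
  have hR : ∀ R : ℕ, ∀ᵐ ω ∂P, ∀ i j, ‖X i ω‖ = ‖X j ω‖ → ‖X i ω‖ < R → i = j := by
    intro R
    have hbound : ∀ n : ℕ, P {ω | ¬ ∀ i j, ‖X i ω‖ = ‖X j ω‖ → ‖X i ω‖ < R → i = j} ≤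
        ENNReal.ofReal ((lam * (Real.pi * R ^ 2)) ^ 2 / (n + 1 : ℝ)) := by
      intro n
      -- Radii with equally spaced squares, so that the annuli have equal area.
      let ρ : ℕ → ℝ := fun k => Real.sqrt (k * R ^ 2 / (n + 1))
      have hρ : ∀ k, ρ k ^ 2 = k * R ^ 2 / (n + 1) := fun k => Real.sq_sqrt (by positivity)
      have hρ0 : ∀ k, 0 ≤ ρ k := fun k => Real.sqrt_nonneg _
      have hρm : ∀ k, ρ k ≤ ρ (k + 1) := fun k => Real.sqrt_le_sqrt (by push_cast; gcongr; simp)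
      let A : ℕ → Set Plane := fun k => Metric.ball 0 (ρ (k + 1)) \ Metric.ball 0 (ρ k)
      have hA : ∀ k, MeasurableSet (A k) := fun k => measurableSet_ball.diff measurableSet_ball
      have hAv : ∀ k, volume (A k) ≠ ∞ := fun k =>
        ((measure_mono Set.sdiff_subset).trans_lt measure_ball_lt_top).ne
      have hAr : ∀ k, volume.real (A k) = Real.pi * R ^ 2 / (n + 1) := fun k => by
        rw [volume_real_annulus (hρ0 k) (hρm k), hρ, hρ]
        push_cast; ring
      have hsub : {ω | ¬ ∀ i j, ‖X i ω‖ = ‖X j ω‖ → ‖X i ω‖ < R → i = j} ⊆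
          ⋃ k ∈ Finset.range (n + 1), {ω | 2 ≤ count X (A k) ω} := by
        intro ω hω
        simp only [Set.mem_ofPred_eq, not_forall] at hω
        obtain ⟨i, j, hij, hiR, hne⟩ := hω
        have hex : ∃ k, ‖X i ω‖ < ρ (k + 1) := ⟨n, by
          have : ρ (n + 1) = R := by
            simp only [ρ]; push_cast
            rw [mul_div_cancel_left₀ _ (by positivity), Real.sqrt_sq (by positivity)]
          rwa [this]⟩
        classical
        have hk1 := Nat.find_spec hex
        have hkn : Nat.find hex ≤ n := Nat.find_min' hex (by
          have : ρ (n + 1) = R := by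
            simp only [ρ]; push_cast
            rw [mul_div_cancel_left₀ _ (by positivity), Real.sqrt_sq (by positivity)]
          rwa [this])
        have hk2 : ρ (Nat.find hex) ≤ ‖X i ω‖ := by
          rcases Nat.eq_zero_or_pos (Nat.find hex) with h | h
          · rw [h]; simp [ρ]
          · have := Nat.find_min hex (Nat.sub_lt h one_pos)
            rwa [Nat.sub_add_cancel (show 1 ≤ _ from h), not_lt] at this
        simp only [Set.mem_iUnion, Finset.mem_range]
        refine ⟨Nat.find hex, by omega, ?_⟩
        have hsub2 : ({i, j} : Set ℕ) ⊆ {l | X l ω ∈ A (Nat.find hex)} := by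
          rintro l (rfl | rfl)
          · exact ⟨by simpa using hk1, by simpa using hk2⟩
          · exact ⟨by simpa [← hij] using hk1, by simpa [← hij] using hk2⟩
        have := Set.encard_le_encard hsub2
        rwa [Set.encard_pair hne] at this
      refine (measure_mono hsub).trans ((measure_biUnion_finset_le _ _).trans ?_)
      refine (Finset.sum_le_sum fun k _ =>
        (hX.measure_two_le_count hlam (hA k) (hAv k)).trans_eq (by rw [hAr])).trans_eq ?_
      rw [Finset.sum_const, Finset.card_range, ← ENNReal.ofReal_nsmul]
      congr 1
      rw [nsmul_eq_mul]; push_cast; field_simp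
    rw [ae_iff]
    have hlim : Tendsto (fun n : ℕ => ENNReal.ofReal
        ((lam * (Real.pi * R ^ 2)) ^ 2 / (n + 1 : ℝ))) atTop (𝓝 0) := by
      rw [← ENNReal.ofReal_zero]
      refine ENNReal.tendsto_ofReal ?_
      have := tendsto_one_div_add_atTop_nhds_zero_nat.const_mul ((lam * (Real.pi * R ^ 2)) ^ 2)
      simpa [div_eq_mul_inv] using this
    exact le_antisymm (ge_of_tendsto' hlim hbound) zero_le
  filter_upwards [ae_all_iff.2 hR] with ω hω i j hij
  obtain ⟨R, hR⟩ := exists_nat_gt ‖X i ω‖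
  exact hω R i j hij hR

end CoopNetwork

namespace CoopNetwork

open Filter Topology

variable {Ω : Type*} [MeasurableSpace Ω] {P : Measure Ω} {X : ℕ → Ω → Plane} {lam : ℝ} {K : ℕ}

/-! ### Points beyond the `K`-th nearest one -/

/-- Distances of the first `K` points. -/
noncomputable def firstDist (K : ℕ) (X : ℕ → Ω → Plane) (ω : Ω) (i : Fin K) : ℝ := ‖X i ω‖

theorem measurable_firstDist (hX : ∀ i, Measurable (X i)) : Measurable (firstDist K X) :=
  measurable_pi_lambda _ fun i => (hX i).norm

theorem measurableSpace_pi_eq_generateFrom_Iic :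
    (MeasurableSpace.pi : MeasurableSpace (Fin K → ℝ)) = MeasurableSpace.generateFrom
      (Set.univ.pi '' Set.univ.pi fun _ => Set.range Set.Iic) := by
  refine (generateFrom_eq_pi (C := fun _ : Fin K => Set.range (Set.Iic : ℝ → Set ℝ))
    (fun _ => ?_) (fun _ => ?_)).symm
  · rw [← borel_eq_generateFrom_Iic]
    exact (BorelSpace.measurable_eq).symm
  · refine ⟨fun n => Set.Iic (n : ℝ), fun n => ⟨_, rfl⟩, ?_⟩
    exact Set.eq_univ_of_forall fun x => Set.mem_iUnion.2 (exists_nat_ge x)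

-- Translates order statistics into counts. Indices start at 0, hence the `i + 1`.
omit [MeasurableSpace Ω] in
theorem norm_le_iff_le_count {ω : Ω} (hs : Monotone fun i => ‖X i ω‖) (i : ℕ) (u : ℝ) :
    ‖X i ω‖ ≤ u ↔ ((i + 1 : ℕ) : ℕ∞) ≤ count X (Metric.closedBall 0 u) ω := by
  constructor
  · intro h
    have hsub : (Finset.range (i + 1) : Set ℕ) ⊆ {j | X j ω ∈ Metric.closedBall (0 : Plane) u} := by
      intro j hj
      rw [Finset.coe_range, Set.mem_Iio] at hj
      exact mem_closedBall_zero_iff.2 ((hs (Nat.lt_succ_iff.1 hj)).trans h)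
    have := Set.encard_le_encard hsub
    rwa [Set.encard_coe_eq_coe_finsetCard, Finset.card_range] at this
  · intro h
    by_contra hu
    have hsub : {j | X j ω ∈ Metric.closedBall (0 : Plane) u} ⊆ (Finset.range i : Set ℕ) := by
      intro j hj
      rw [Finset.coe_range, Set.mem_Iio]
      by_contra hij
      exact hu ((hs (not_lt.1 hij)).trans (mem_closedBall_zero_iff.1 hj))
    have := h.trans (Set.encard_le_encard hsub)
    rw [Set.encard_coe_eq_coe_finsetCard, Finset.card_range] at this
    exact absurd (Nat.cast_le.1 this) (by omega)

/-- On the event that the K-th distance is at most `r`, the first K distances are determined by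
counts inside the closed disk of radius `r`, while `g` sees only points outside it. This gives the
claim for boxes of distances, and a π-system argument extends it to all `φ`. Here `r` is
deterministic; the following lemmas let it follow the K-th distance. -/
theorem IsHomogeneousPPP.setLIntegral_firstDist [IsProbabilityMeasure P]
    (hX : IsHomogeneousPPP X lam P) (hs : ∀ᵐ ω ∂P, Monotone fun i => ‖X i ω‖) (last : Fin K)
    (hlast : ∀ i, i ≤ last) (r : ℝ)
    {g : Plane → ℝ≥0∞} (hg : Measurable g) (hgr : ∀ x, ‖x‖ ≤ r → g x = 0)
    {φ : (Fin K → ℝ) → ℝ≥0∞} (hφ : Measurable φ) :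
    ∫⁻ ω in {ω | firstDist K X ω last ≤ r},
        φ (firstDist K X ω) * expNeg (∑' i, g (X i ω)) ∂P =
      ∫⁻ ω in {ω | firstDist K X ω last ≤ r},
        φ (firstDist K X ω) * expNeg (ENNReal.ofReal lam * ∫⁻ x, (1 - expNeg (g x))) ∂P := by
  have hd : Measurable (firstDist K X) := measurable_firstDist hX.measurable
  have hφd : Measurable fun ω => φ (firstDist K X ω) := hφ.comp hd
  have hYm : Measurable fun ω => expNeg (∑' i, g (X i ω)) :=
    measurable_expNeg.comp (Measurable.tsum fun i => hg.comp (hX.measurable i))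
  set Y := fun ω => expNeg (∑' i, g (X i ω)) with hY
  set ψ := expNeg (ENNReal.ofReal lam * ∫⁻ x, (1 - expNeg (g x))) with hψ
  have hr : MeasurableSet {ω | firstDist K X ω last ≤ r} :=
    measurableSet_le ((measurable_pi_apply last).comp hd) measurable_const
  have hbox : ∀ u : Fin K → ℝ, ∫⁻ ω in {ω | (∀ i, firstDist K X ω i ≤ u i) ∧
      firstDist K X ω last ≤ r}, Y ω ∂P =
      P {ω | (∀ i, firstDist K X ω i ≤ u i) ∧ firstDist K X ω last ≤ r} * ψ := by
    intro u
    -- By sortedness all K distances are at most `r` on this event. The box can therefore be shrunk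
    -- to `min (u i) r`, which keeps every ball inside the disk of radius `r`.
    have hae : {ω | (∀ i, firstDist K X ω i ≤ u i) ∧ firstDist K X ω last ≤ r} =ᵐ[P]
        {ω | ∀ i : Fin K, ((i + 1 : ℕ) : ℕ∞) ≤
          count X (Metric.closedBall 0 (min (u i) r)) ω} := by
      filter_upwards [hs] with ω hω
      refine propext ?_
      change ((∀ i, firstDist K X ω i ≤ u i) ∧ firstDist K X ω last ≤ r) ↔
        ∀ i : Fin K, ((i + 1 : ℕ) : ℕ∞) ≤ count X (Metric.closedBall 0 (min (u i) r)) ω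
      simp only [← norm_le_iff_le_count hω, le_min_iff]
      exact ⟨fun h i => ⟨h.1 i, (hω (hlast i)).trans h.2⟩, fun h => ⟨fun i => (h i).1, (h last).2⟩⟩
    rw [setLIntegral_congr hae, measure_congr hae]
    refine hX.setLIntegral_expNeg_tsum (V := (Metric.closedBall 0 r)ᶜ)
      (hX.indepOfCounts_compl (fun k => measurableSet_closedBall) (fun k => ?_)
        fun i : Fin K => ((i + 1 : ℕ) : ℕ∞)) hg fun x hx => ?_
    · rw [compl_compl]
      exact Metric.closedBall_subset_closedBall (min_le_right _ _)
    · exact hgr x (by simpa using hx)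
  -- The integral identity, read as an equality of two finite measures on the space of distances,
  -- may be tested on boxes.
  have hmeas : (((P.withDensity Y).restrict {ω | firstDist K X ω last ≤ r}).map
      (firstDist K X)) = ψ • ((P.restrict {ω | firstDist K X ω last ≤ r}).map (firstDist K X)) := by
    have hfin : IsFiniteMeasure (P.withDensity Y) := by
      refine isFiniteMeasure_withDensity (ne_of_lt ?_)
      calc ∫⁻ ω, Y ω ∂P ≤ ∫⁻ _, 1 ∂P := lintegral_mono fun ω => expNeg_le_one _
        _ < ∞ := by simp
    have key : ∀ S : Set (Fin K → ℝ), MeasurableSet S → ∀ u : Fin K → ℝ,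
        {ω | firstDist K X ω ∈ S ∧ firstDist K X ω last ≤ r} =
          {ω | (∀ i, firstDist K X ω i ≤ u i) ∧ firstDist K X ω last ≤ r} →
        (((P.withDensity Y).restrict {ω | firstDist K X ω last ≤ r}).map (firstDist K X)) S =
        (ψ • ((P.restrict {ω | firstDist K X ω last ≤ r}).map (firstDist K X))) S := by
      intro S hS u hSu
      have hset : firstDist K X ⁻¹' S ∩ {ω | firstDist K X ω last ≤ r} =
          {ω | (∀ i, firstDist K X ω i ≤ u i) ∧ firstDist K X ω last ≤ r} := by
        rw [← hSu]; rfl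
      rw [Measure.smul_apply, Measure.map_apply hd hS, Measure.map_apply hd hS,
        Measure.restrict_apply (hd hS), Measure.restrict_apply (hd hS),
        withDensity_apply _ ((hd hS).inter hr), hset, hbox u, smul_eq_mul, mul_comm]
    refine ext_of_generate_finite _ measurableSpace_pi_eq_generateFrom_Iic
      (IsPiSystem.pi fun _ => isPiSystem_Iic) ?_ ?_
    · rintro _ ⟨B, hB, rfl⟩
      choose u hu using fun i => hB i trivial
      refine key _ (MeasurableSet.univ_pi fun i => hu i ▸ measurableSet_Iic) u ?_
      ext ω
      simp [Set.mem_pi, ← hu]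
    -- The total mass is not among the boxes, but the box with all sides `r` carries almost all of
    -- both measures.
    · have hS : MeasurableSet {d : Fin K → ℝ | ∀ i, d i ≤ r} := by
        have : {d : Fin K → ℝ | ∀ i, d i ≤ r} = Set.univ.pi fun _ => Set.Iic r := by
          ext d; simp [Pi.le_def]
        rw [this]
        exact MeasurableSet.univ_pi fun _ => measurableSet_Iic
      have h1 := key _ hS (fun _ => r) rfl
      have hnull : ∀ μ : Measure Ω, μ ≪ P →
          ((μ.restrict {ω | firstDist K X ω last ≤ r}).map (firstDist K X)) Set.univ =
          ((μ.restrict {ω | firstDist K X ω last ≤ r}).map (firstDist K X))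
            {d : Fin K → ℝ | ∀ i, d i ≤ r} := by
        intro μ hμ
        rw [Measure.map_apply hd MeasurableSet.univ, Measure.map_apply hd hS,
          Measure.restrict_apply (hd MeasurableSet.univ), Measure.restrict_apply (hd hS)]
        refine measure_congr (hμ.ae_eq ?_)
        filter_upwards [hs] with ω hω
        refine propext ⟨fun h => ⟨fun i => (hω (hlast i)).trans h.2, h.2⟩, fun h => ⟨trivial, h.2⟩⟩
      rw [hnull _ (withDensity_absolutelyContinuous _ _), h1, Measure.smul_apply,
        Measure.smul_apply, hnull P Measure.AbsolutelyContinuous.rfl]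
  have h1 : ∫⁻ ω in {ω | firstDist K X ω last ≤ r}, φ (firstDist K X ω) * Y ω ∂P =
      ∫⁻ d, φ d ∂(((P.withDensity Y).restrict {ω | firstDist K X ω last ≤ r}).map
        (firstDist K X)) := by
    rw [lintegral_map hφ hd, restrict_withDensity hr,
      lintegral_withDensity_eq_lintegral_mul _ hYm hφd]
    refine lintegral_congr fun ω => mul_comm _ _
  rw [h1, hmeas, lintegral_smul_measure, lintegral_map hφ hd, smul_eq_mul,
    lintegral_mul_const _ hφd, mul_comm]

/-- Splitting over the values of `τ` fixes both the radius and the function on each piece. The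
restriction to the K-th distance being at most `r k` is automatic on the piece where `τ = k`. -/
theorem IsHomogeneousPPP.lintegral_firstDist_countable [IsProbabilityMeasure P]
    (hX : IsHomogeneousPPP X lam P) (hs : ∀ᵐ ω ∂P, Monotone fun i => ‖X i ω‖) (last : Fin K)
    (hlast : ∀ i, i ≤ last) {ι : Type*} [Countable ι] [MeasurableSpace ι]
    [MeasurableSingletonClass ι] {τ : (Fin K → ℝ) → ι} (hτ : Measurable τ) (r : ι → ℝ)
    (hr : ∀ d, d last ≤ r (τ d)) {g : ι → Plane → ℝ≥0∞} (hg : ∀ k, Measurable (g k))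
    (hgr : ∀ k x, ‖x‖ ≤ r k → g k x = 0) {φ : (Fin K → ℝ) → ℝ≥0∞} (hφ : Measurable φ) :
    ∫⁻ ω, φ (firstDist K X ω) * expNeg (∑' i, g (τ (firstDist K X ω)) (X i ω)) ∂P =
      ∫⁻ ω, φ (firstDist K X ω) * expNeg (ENNReal.ofReal lam *
        ∫⁻ x, (1 - expNeg (g (τ (firstDist K X ω)) x))) ∂P := by
  have hd : Measurable (firstDist K X) := measurable_firstDist hX.measurable
  have hsplit : ∀ F : ι → Ω → ℝ≥0∞, (∀ k, Measurable (F k)) →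
      ∫⁻ ω, φ (firstDist K X ω) * F (τ (firstDist K X ω)) ω ∂P =
        ∑' k, ∫⁻ ω in {ω | firstDist K X ω last ≤ r k},
          (τ ⁻¹' {k}).indicator φ (firstDist K X ω) * F k ω ∂P := by
    intro F hF
    have hm : ∀ k, Measurable fun ω => (τ ⁻¹' {k}).indicator φ (firstDist K X ω) * F k ω :=
      fun k => ((hφ.indicator (hτ (measurableSet_singleton k))).comp hd).mul (hF k)
    have h1 : ∀ k, ∫⁻ ω in {ω | firstDist K X ω last ≤ r k},
          (τ ⁻¹' {k}).indicator φ (firstDist K X ω) * F k ω ∂P =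
        ∫⁻ ω, (τ ⁻¹' {k}).indicator φ (firstDist K X ω) * F k ω ∂P := by
      intro k
      refine setLIntegral_eq_of_support_subset ?_
      intro ω hω
      by_contra hlt
      refine hω ?_
      have : firstDist K X ω ∉ τ ⁻¹' {k} := fun h => hlt ((hr _).trans_eq (by
        rw [Set.mem_preimage, Set.mem_singleton_iff] at h; rw [h]))
      change (τ ⁻¹' {k}).indicator φ (firstDist K X ω) * F k ω = 0
      rw [Set.indicator_of_notMem this, zero_mul]
    simp_rw [h1]
    rw [← lintegral_tsum fun k => (hm k).aemeasurable]
    refine lintegral_congr fun ω => ?_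
    rw [tsum_eq_single (τ (firstDist K X ω))]
    · simp
    · intro k hk
      rw [Set.indicator_of_notMem (fun h => hk h.symm), zero_mul]
  rw [hsplit (fun k ω => expNeg (∑' i, g k (X i ω))) fun k =>
      measurable_expNeg.comp (Measurable.tsum fun i => (hg k).comp (hX.measurable i)),
    hsplit (fun k _ => expNeg (ENNReal.ofReal lam * ∫⁻ x, (1 - expNeg (g k x))))
      fun k => measurable_const]
  refine tsum_congr fun k => ?_
  exact hX.setLIntegral_firstDist hs last hlast (r k) (hg k) (hgr k)
    (hφ.indicator (hτ (measurableSet_singleton k)))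

/-- Removes the discretisation. The approximants stay below `G`, so both the sum over the points and
the integral over the plane converge by `tendsto_tsum_of_le` and `tendsto_lintegral_of_le`. -/
theorem IsHomogeneousPPP.lintegral_firstDist_of_tendsto [IsProbabilityMeasure P]
    (hX : IsHomogeneousPPP X lam P) (hs : ∀ᵐ ω ∂P, Monotone fun i => ‖X i ω‖) (last : Fin K)
    (hlast : ∀ i, i ≤ last) {τ : ℕ → (Fin K → ℝ) → ℕ × ℕ} (hτ : ∀ n, Measurable (τ n))
    (ρ : ℕ → ℕ × ℕ → ℝ) (hρ : ∀ n d, d last ≤ ρ n (τ n d)) {h : ℕ → ℕ × ℕ → Plane → ℝ≥0∞}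
    (hh : ∀ n k, Measurable (h n k)) (hhr : ∀ n k x, ‖x‖ ≤ ρ n k → h n k x = 0)
    {G : (Fin K → ℝ) → Plane → ℝ≥0∞} (hle : ∀ n d x, h n (τ n d) x ≤ G d x)
    (hlim : ∀ d x, 0 ≤ d last → Tendsto (fun n => h n (τ n d) x) atTop (𝓝 (G d x)))
    {φ : (Fin K → ℝ) → ℝ≥0∞} (hφ : Measurable φ) (hφ1 : ∀ d, φ d ≤ 1) :
    ∫⁻ ω, φ (firstDist K X ω) * expNeg (∑' i, G (firstDist K X ω) (X i ω)) ∂P =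
      ∫⁻ ω, φ (firstDist K X ω) * expNeg (ENNReal.ofReal lam *
        ∫⁻ x, (1 - expNeg (G (firstDist K X ω) x))) ∂P := by
  have hd : Measurable (firstDist K X) := measurable_firstDist hX.measurable
  have hd0 : ∀ ω, 0 ≤ firstDist K X ω last := fun ω => norm_nonneg _
  have hmul : ∀ {a b : ℝ≥0∞}, a ≤ 1 → b ≤ 1 → a * b ≤ 1 := fun ha hb => mul_le_one' ha hb
  have hφne : ∀ d, φ d ≠ ∞ := fun d => ((hφ1 d).trans_lt ENNReal.one_lt_top).ne
  have hτd : ∀ n, Measurable fun ω => τ n (firstDist K X ω) := fun n => (hτ n).comp hd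
  refine tendsto_nhds_unique (f := fun n => ∫⁻ ω, φ (firstDist K X ω) *
      expNeg (∑' i, h n (τ n (firstDist K X ω)) (X i ω)) ∂P) ?_ ?_ (l := atTop)
  · refine tendsto_lintegral_of_le_one (fun n => ?_)
      (fun n ω => hmul (hφ1 _) (expNeg_le_one _)) (Eventually.of_forall fun ω => ?_)
    · refine (hφ.comp hd).mul (measurable_expNeg.comp (Measurable.tsum fun i => ?_))
      exact (measurable_from_prod_countable_right (f := fun p : (ℕ × ℕ) × Plane => h n p.1 p.2)
        fun k => hh n k).comp ((hτd n).prodMk (hX.measurable i))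
    · exact ENNReal.Tendsto.const_mul ((continuous_expNeg.tendsto _).comp (tendsto_tsum_of_le
        (fun n i => hle n _ _) fun i => hlim _ _ (hd0 ω))) (Or.inr (hφne _))
  · simp_rw [fun n => hX.lintegral_firstDist_countable hs last
      hlast (hτ n) (ρ n) (hρ n) (hh n) (hhr n) hφ]
    refine tendsto_lintegral_of_le_one (fun n => ?_)
      (fun n ω => hmul (hφ1 _) (expNeg_le_one _)) (Eventually.of_forall fun ω => ?_)
    · refine (hφ.comp hd).mul ?_
      exact (measurable_of_countable fun k : ℕ × ℕ => expNeg (ENNReal.ofReal lam *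
        ∫⁻ x, (1 - expNeg (h n k x)))).comp (hτd n)
    · refine ENNReal.Tendsto.const_mul ((continuous_expNeg.tendsto _).comp
        (ENNReal.Tendsto.const_mul (tendsto_lintegral_of_le (fun n => ?_) (fun n x => ?_)
          fun x => ?_) (Or.inr ENNReal.ofReal_ne_top))) (Or.inr (hφne _))
      · exact measurable_const.sub (measurable_expNeg.comp (hh n _))
      · exact tsub_le_tsub_left (expNeg_antitone (hle n _ x)) _
      · exact ENNReal.Tendsto.sub tendsto_const_nhds
          ((continuous_expNeg.tendsto _).comp (hlim _ _ (hd0 ω))) (Or.inl ENNReal.one_ne_top)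

/-- Given the distances of the `K` nearest points, the remaining points form a Poisson point
process on the complement of the closed disk that contains those `K` points. -/
theorem IsHomogeneousPPP.lintegral_expNeg_tsum_beyond [IsProbabilityMeasure P]
    (hX : IsHomogeneousPPP X lam P) (hlam : 0 ≤ lam) (hs : ∀ᵐ ω ∂P, Monotone fun i => ‖X i ω‖)
    (last : Fin K) (hlast : (last : ℕ) + 1 = K) {s : (Fin K → ℝ) → NNReal} (hsm : Measurable s)
    {g : NNReal → Plane → ℝ≥0∞} (hg : ∀ k, Measurable (g k)) (hmono : Monotone g)
    (hcont : ∀ x, Continuous fun a => g a x) {φ : (Fin K → ℝ) → ℝ≥0∞} (hφ : Measurable φ)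
    (hφ1 : ∀ d, φ d ≤ 1) :
    ∫⁻ ω, φ (firstDist K X ω) * expNeg (∑' i, g (s (firstDist K X ω)) (X (K + i) ω)) ∂P =
      ∫⁻ ω, φ (firstDist K X ω) * expNeg (ENNReal.ofReal lam *
        ∫⁻ x in (Metric.closedBall 0 (firstDist K X ω last))ᶜ,
          (1 - expNeg (g (s (firstDist K X ω)) x))) ∂P := by
  have hd : Measurable (firstDist K X) := measurable_firstDist hX.measurable
  let G : (Fin K → ℝ) → Plane → ℝ≥0∞ := fun d =>
    (Metric.closedBall 0 (d last))ᶜ.indicator (g (s d))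
  -- Rounding on a grid of mesh 1/(n + 1): `s` downwards and the radius upwards. Since `g` is
  -- monotone, the approximant lies below `G`, and it vanishes on a disk containing the first K
  -- points.
  let τ : ℕ → (Fin K → ℝ) → ℕ × ℕ := fun n d =>
    (⌊(s d : ℝ) * (n + 1 : ℕ)⌋₊, ⌈max (d last) 0 * (n + 1 : ℕ)⌉₊)
  let ρ : ℕ → ℕ × ℕ → ℝ := fun n k => k.2 / ((n + 1 : ℕ) : ℝ)
  let h : ℕ → ℕ × ℕ → Plane → ℝ≥0∞ := fun n k =>
    (Metric.closedBall 0 (ρ n k))ᶜ.indicator (g (k.1 / ((n + 1 : ℕ) : NNReal)))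
  have hτ : ∀ n, Measurable (τ n) := fun n =>
    (Nat.measurable_floor.comp (hsm.coe_nnreal_real.mul_const _)).prodMk
      (Nat.measurable_ceil.comp (((measurable_pi_apply last).max measurable_const).mul_const _))
  have hρ : ∀ n d, d last ≤ ρ n (τ n d) := fun n d => by
    simp only [ρ, τ]
    rw [le_div_iff₀ (by positivity)]
    exact (mul_le_mul_of_nonneg_right (le_max_left _ _) (by positivity)).trans (Nat.le_ceil _)
  have hh : ∀ n k, Measurable (h n k) := fun n k =>
    (hg _).indicator measurableSet_closedBall.compl
  have hhr : ∀ n k x, ‖x‖ ≤ ρ n k → h n k x = 0 := fun n k x hx =>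
    Set.indicator_of_notMem (by simpa using hx) _
  have hle : ∀ n d x, h n (τ n d) x ≤ G d x := by
    intro n d x
    by_cases hx : ‖x‖ ≤ ρ n (τ n d)
    · rw [hhr n _ x hx]
      exact zero_le
    · have h1 : h n (τ n d) x = g ((τ n d).1 / ((n + 1 : ℕ) : NNReal)) x :=
        Set.indicator_of_mem (by simpa using hx) _
      have h2 : G d x = g (s d) x :=
        Set.indicator_of_mem (by simpa using (hρ n d).trans_lt (not_le.1 hx)) _
      rw [h1, h2]
      refine hmono ?_ x
      rw [← NNReal.coe_le_coe]
      push_cast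
      rw [div_le_iff₀ (by positivity)]
      exact_mod_cast Nat.floor_le (by positivity : 0 ≤ (s d : ℝ) * (n + 1 : ℕ))
  have hlim : ∀ d x, 0 ≤ d last → Tendsto (fun n => h n (τ n d) x) atTop (𝓝 (G d x)) := by
    intro d x hd0
    have hS : Tendsto (fun n : ℕ => ((τ n d).1 / ((n + 1 : ℕ) : NNReal))) atTop (𝓝 (s d)) := by
      rw [← NNReal.tendsto_coe]
      have := (tendsto_nat_floor_mul_div_atTop (R := ℝ) (a := s d) (s d).coe_nonneg).comp
        (tendsto_natCast_atTop_atTop.comp (tendsto_add_atTop_nat 1))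
      refine this.congr fun n => ?_
      simp [τ]
    have hR : Tendsto (fun n : ℕ => ρ n (τ n d)) atTop (𝓝 (d last)) := by
      have := (tendsto_nat_ceil_mul_div_atTop (R := ℝ) (a := d last) hd0).comp
        (tendsto_natCast_atTop_atTop.comp (tendsto_add_atTop_nat 1))
      refine this.congr fun n => ?_
      simp [ρ, τ, max_eq_left hd0]
    by_cases hx : ‖x‖ ≤ d last
    · have h0 : G d x = 0 := Set.indicator_of_notMem (by simpa using hx) _
      rw [h0]
      refine tendsto_const_nhds.congr fun n => ?_
      exact (le_antisymm ((hle n d x).trans_eq h0) zero_le).symm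
    · rw [not_le] at hx
      have h0 : G d x = g (s d) x := Set.indicator_of_mem (by simpa using hx) _
      rw [h0]
      refine (((hcont x).tendsto _).comp hS).congr' ?_
      filter_upwards [hR.eventually_lt_const hx] with n hn
      have hxn : x ∈ (Metric.closedBall (0 : Plane) (ρ n (τ n d)))ᶜ :=
        fun hm => not_le.2 hn (mem_closedBall_zero_iff.1 hm)
      exact (Set.indicator_of_mem hxn _).symm
  have h1 : ∫⁻ ω, φ (firstDist K X ω) * expNeg (∑' i, G (firstDist K X ω) (X i ω)) ∂P =
      ∫⁻ ω, φ (firstDist K X ω) * expNeg (ENNReal.ofReal lam *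
        ∫⁻ x, (1 - expNeg (G (firstDist K X ω) x))) ∂P := by
    exact hX.lintegral_firstDist_of_tendsto hs last (fun i => Fin.le_def.2 (by omega)) hτ ρ hρ hh hhr
      hle hlim hφ hφ1
  -- Almost surely there are no ties, so the points with index at least `K` are exactly those
  -- strictly outside the closed disk.
  have h2 : ∫⁻ ω, φ (firstDist K X ω) *
        expNeg (∑' i, g (s (firstDist K X ω)) (X (K + i) ω)) ∂P =
      ∫⁻ ω, φ (firstDist K X ω) * expNeg (∑' i, G (firstDist K X ω) (X i ω)) ∂P := by
    refine lintegral_congr_ae ?_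
    filter_upwards [hs, hX.ae_norm_injective hlam] with ω hω hinj
    have hsum : ∑' i, G (firstDist K X ω) (X i ω) =
        ∑' i, g (s (firstDist K X ω)) (X (K + i) ω) := by
      rw [← Summable.sum_add_tsum_nat_add' (k := K) ENNReal.summable, Finset.sum_eq_zero, zero_add]
      · refine tsum_congr fun i => ?_
        rw [add_comm i K]
        refine Set.indicator_of_mem ?_ _
        have : ‖X last ω‖ < ‖X (K + i) ω‖ := lt_of_le_of_ne (hω (by omega))
          fun h => by have := hinj h; omega
        simpa [firstDist] using this
      · intro i hi
        refine Set.indicator_of_notMem ?_ _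
        have : ‖X i ω‖ ≤ ‖X last ω‖ := hω (by have := Finset.mem_range.1 hi; omega)
        simpa [firstDist] using this
    rw [hsum]
  rw [h2, h1]
  refine lintegral_congr fun ω => ?_
  rw [← lintegral_indicator measurableSet_closedBall.compl]
  congr 3
  refine lintegral_congr fun x => ?_
  by_cases hx : x ∈ (Metric.closedBall (0 : Plane) (firstDist K X ω last))ᶜ
  · simp only [G, Set.indicator_of_mem hx]
  · simp only [G, Set.indicator_of_notMem hx, expNeg_zero, tsub_self]

end CoopNetwork

namespace CoopNetwork

open Filter Topology

/-! ### Sums of independent thinned exponential random variables -/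

/-- The coefficients of the tail of a sum of independent thinned exponential variables with
rates `a`. -/
noncomputable def tailCoeff {ι : Type*} [DecidableEq ι] (q : ℝ) (a : ι → ℝ) (s : Finset ι)
    (j : ι) : ℝ :=
  (1 - q) * ∏ l ∈ s.erase j, (a l - q * a j) / (a l - a j)

theorem tailCoeff_insert_of_mem {ι : Type*} [DecidableEq ι] (q : ℝ) (a : ι → ℝ) {s : Finset ι}
    {j k : ι} (hj : j ∈ s) (hk : k ∉ s) :
    tailCoeff q a (insert k s) j = tailCoeff q a s j * ((a k - q * a j) / (a k - a j)) := by
  have hne : k ≠ j := fun h => hk (h ▸ hj)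
  rw [tailCoeff, tailCoeff, Finset.erase_insert_of_ne hne,
    Finset.prod_insert (fun h => hk (Finset.mem_of_mem_erase h))]
  ring

theorem tailCoeff_insert_self {ι : Type*} [DecidableEq ι] (q : ℝ) (a : ι → ℝ) {s : Finset ι}
    {k : ι} (hk : k ∉ s) :
    tailCoeff q a (insert k s) k = (1 - q) * ∏ l ∈ s, (a l - q * a k) / (a l - a k) := by
  rw [tailCoeff, Finset.erase_insert hk]

/-- Partial fractions of the Laplace transform at -z of a sum of thinned exponentials: its value at
z = 0 is 1, and its simple poles are the rates. At z equal to a further rate it supplies the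
coefficient of that rate in the induction on the number of summands. -/
theorem prod_eq_one_sub_sum_tailCoeff {ι : Type*} [DecidableEq ι] (q : ℝ) (a : ι → ℝ)
    (s : Finset ι) (ha : Set.InjOn a s) (z : ℝ) (hz : ∀ j ∈ s, a j ≠ z) :
    ∏ j ∈ s, (a j - q * z) / (a j - z) = 1 - ∑ j ∈ s, tailCoeff q a s j * (z / (z - a j)) := by
  induction s using Finset.induction_on generalizing z with
  | empty => simp
  | insert k s hk ih =>
    have ha' : Set.InjOn a s := ha.mono (by simp)
    have hne : ∀ j ∈ s, a j ≠ a k := fun j hj h => hk (by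
      have := ha (Finset.mem_insert_of_mem hj) (Finset.mem_insert_self k s) h
      exact this ▸ hj)
    have hkz : a k - z ≠ 0 := sub_ne_zero.2 (hz k (Finset.mem_insert_self k s))
    have hkz' : z - a k ≠ 0 := sub_ne_zero.2 (hz k (Finset.mem_insert_self k s)).symm
    rw [Finset.prod_insert hk, Finset.sum_insert hk, tailCoeff_insert_self q a hk,
      ih ha' z fun j hj => hz j (Finset.mem_insert_of_mem hj), ih ha' (a k) hne]
    have h0 : ∑ j ∈ s, tailCoeff q a (insert k s) j * (z / (z - a j)) =
        ∑ j ∈ s, tailCoeff q a s j * ((a k - q * a j) / (a k - a j)) * (z / (z - a j)) :=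
      Finset.sum_congr rfl fun j hj => by rw [tailCoeff_insert_of_mem q a hj hk]
    have h1 : (a k - q * z) / (a k - z) = 1 - (1 - q) * (z / (z - a k)) := by
      field_simp; ring
    -- Termwise identity in z: both sides have the same residue at a_j, and on the right the poles
    -- at a_k cancel.
    have h2 : ∑ j ∈ s, tailCoeff q a s j * ((a k - q * a j) / (a k - a j)) * (z / (z - a j)) =
        (a k - q * z) / (a k - z) * ∑ j ∈ s, tailCoeff q a s j * (z / (z - a j)) +
          (1 - q) * (z / (z - a k)) * ∑ j ∈ s, tailCoeff q a s j * (a k / (a k - a j)) := by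
      rw [Finset.mul_sum, Finset.mul_sum, ← Finset.sum_add_distrib]
      refine Finset.sum_congr rfl fun j hj => ?_
      have hjk : a k - a j ≠ 0 := sub_ne_zero.2 (hne j hj).symm
      have hjz : z - a j ≠ 0 := sub_ne_zero.2 (hz j (Finset.mem_insert_of_mem hj)).symm
      field_simp
      ring
    rw [h0, h2, h1]
    ring

variable {Ω : Type*} [MeasurableSpace Ω] {P : Measure Ω}

/-- Fubini for independent random variables. -/
theorem lintegral_indepFun [IsFiniteMeasure P] {α β : Type*} [MeasurableSpace α]
    [MeasurableSpace β] {X : Ω → α} {Y : Ω → β} (hX : Measurable X) (hY : Measurable Y)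
    (h : IndepFun X Y P) {F : α → β → ℝ≥0∞} (hF : Measurable (Function.uncurry F)) :
    ∫⁻ ω, F (X ω) (Y ω) ∂P = ∫⁻ ω, ∫⁻ ω', F (X ω) (Y ω') ∂P ∂P := by
  have h1 : ∫⁻ ω, F (X ω) (Y ω) ∂P = ∫⁻ z, Function.uncurry F z ∂(P.map fun ω => (X ω, Y ω)) :=
    (lintegral_map hF (hX.prodMk hY)).symm
  rw [h1, (indepFun_iff_map_prod_eq_prod_map_map hX.aemeasurable hY.aemeasurable).1 h,
    lintegral_prod _ hF.aemeasurable, lintegral_map _ hX]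
  · refine lintegral_congr fun ω => ?_
    exact lintegral_map (hF.comp measurable_prodMk_left) hY
  · exact hF.lintegral_prod_right

/-- `R` vanishes with probability `q` and is `b` times a standard exponential variable
otherwise. -/
def IsThinnedExp (q b : ℝ) (R : Ω → ℝ≥0∞) (P : Measure Ω) : Prop :=
  ∀ f : ℝ≥0∞ → ℝ≥0∞, Measurable f → ∫⁻ ω, f (R ω) ∂P = ENNReal.ofReal q * f 0 +
    ENNReal.ofReal (1 - q) *
      ∫⁻ h in Set.Ioi 0, ENNReal.ofReal (Real.exp (-h)) * f (ENNReal.ofReal (b * h))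

/-- The convolution of an exponential variable of rate `a` with a tail of rate `a'`, over the range
where the variable has not yet reached the level `x`. -/
theorem integral_exp_mul_tail {a a' x : ℝ} (ha : 0 < a) (hne : a' ≠ a) :
    ∫ h in (0 : ℝ)..a * x, Real.exp (-h) * Real.exp (-(a' * (x - a⁻¹ * h))) =
      a / (a - a') * (Real.exp (-(a' * x)) - Real.exp (-(a * x))) := by
  have hc : a' / a - 1 ≠ 0 := by
    rw [sub_ne_zero, Ne, div_eq_one_iff_eq ha.ne']; exact hne
  have hs : a - a' ≠ 0 := sub_ne_zero.2 hne.symm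
  have hs' : a' - a ≠ 0 := sub_ne_zero.2 hne
  have h1 : ∀ h : ℝ, Real.exp (-h) * Real.exp (-(a' * (x - a⁻¹ * h))) =
      Real.exp (-(a' * x)) * Real.exp ((a' / a - 1) * h) := fun h => by
    rw [← Real.exp_add, ← Real.exp_add]; congr 1; ring
  simp_rw [h1]
  rw [intervalIntegral.integral_const_mul, intervalIntegral.integral_comp_mul_left _ hc,
    integral_exp, smul_eq_mul, mul_zero, Real.exp_zero]
  have h2 : Real.exp (-(a * x)) = Real.exp (-(a' * x)) * Real.exp ((a' / a - 1) * (a * x)) := by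
    rw [← Real.exp_add]; congr 1; field_simp; ring
  rw [h2]
  field_simp
  ring

/-- The tail of a sum of independent thinned exponential variables with distinct rates. -/
theorem measureReal_lt_sum_thinnedExp [IsProbabilityMeasure P] {ι : Type*} [DecidableEq ι] {q : ℝ}
    (hq : q ∈ Set.Ico (0 : ℝ) 1) {a : ι → ℝ} {R : ι → Ω → ℝ≥0∞} (hR : ∀ i, Measurable (R i))
    (hind : iIndepFun R P) (s : Finset ι) (ha : ∀ i ∈ s, 0 < a i) (hinj : Set.InjOn a s)
    (hlaw : ∀ i ∈ s, IsThinnedExp q (a i)⁻¹ (R i) P) {x : ℝ} (hx : 0 ≤ x) :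
    P.real {ω | ENNReal.ofReal x < ∑ i ∈ s, R i ω} =
      ∑ j ∈ s, tailCoeff q a s j * Real.exp (-(a j * x)) := by
  induction s using Finset.induction_on generalizing x with
  | empty => simp
  | insert k s hk ih =>
    have hinj' : Set.InjOn a s := hinj.mono (by simp)
    have hne : ∀ j ∈ s, a j ≠ a k := fun j hj h => hk (by
      have := hinj (Finset.mem_insert_of_mem hj) (Finset.mem_insert_self k s) h
      exact this ▸ hj)
    have hak := ha k (Finset.mem_insert_self k s)
    have ih' : ∀ {y : ℝ}, 0 ≤ y → P.real {ω | ENNReal.ofReal y < ∑ i ∈ s, R i ω} =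
        ∑ j ∈ s, tailCoeff q a s j * Real.exp (-(a j * y)) := fun hy =>
      ih (fun i hi => ha i (Finset.mem_insert_of_mem hi)) hinj'
        (fun i hi => hlaw i (Finset.mem_insert_of_mem hi)) hy
    set T : ℝ → ℝ := fun y => ∑ j ∈ s, tailCoeff q a s j * Real.exp (-(a j * y)) with hT
    have hT0 : ∀ {y}, 0 ≤ y → 0 ≤ T y := fun hy => measureReal_nonneg.trans_eq (ih' hy)
    have hTc : Continuous T := by fun_prop
    have hSm : Measurable fun ω => ∑ i ∈ s, R i ω := Finset.measurable_fun_sum s fun i _ => hR i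
    have hindep : IndepFun (R k) (fun ω => ∑ i ∈ s, R i ω) P := by
      have := (hind.indepFun_finsetSum_of_notMem hR hk).symm
      convert this using 1
      ext ω; simp
    -- The conditional tail when the new summand equals `r`.
    let f : ℝ≥0∞ → ℝ≥0∞ := fun r => P {ω | ENNReal.ofReal x < r + ∑ i ∈ s, R i ω}
    let F : ℝ≥0∞ → ℝ≥0∞ → ℝ≥0∞ := fun r t => if ENNReal.ofReal x < r + t then 1 else 0
    have hF : Measurable (Function.uncurry F) :=
      Measurable.ite (measurableSet_lt measurable_const (measurable_fst.add measurable_snd))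
        measurable_const measurable_const
    have hFf : ∀ r, ∫⁻ ω, F r (∑ i ∈ s, R i ω) ∂P = f r := fun r => by
      have hms : MeasurableSet {ω | ENNReal.ofReal x < r + ∑ i ∈ s, R i ω} :=
        measurableSet_lt measurable_const (measurable_const.add hSm)
      change _ = P {ω | ENNReal.ofReal x < r + ∑ i ∈ s, R i ω}
      rw [← lintegral_indicator_one hms]
      refine lintegral_congr fun ω => ?_
      simp only [Set.indicator_apply, Set.mem_ofPred_eq, F, Pi.one_apply]
    have hfm : Measurable f := by
      have : f = fun r => ∫⁻ ω, F r (∑ i ∈ s, R i ω) ∂P := funext fun r => (hFf r).symm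
      rw [this]
      have hFS : Measurable fun p : ℝ≥0∞ × Ω => F p.1 (∑ i ∈ s, R i p.2) :=
        hF.comp (measurable_fst.prodMk (hSm.comp measurable_snd))
      exact hFS.lintegral_prod_right'
    have h0 : P {ω | ENNReal.ofReal x < ∑ i ∈ insert k s, R i ω} = ∫⁻ ω, f (R k ω) ∂P := by
      have := lintegral_indepFun (hR k) hSm hindep hF
      simp_rw [hFf] at this
      rw [← this, ← lintegral_indicator_one (measurableSet_lt measurable_const
        (Finset.measurable_fun_sum _ fun i _ => hR i))]
      refine lintegral_congr fun ω => ?_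
      simp only [Set.indicator_apply, Set.mem_ofPred_eq, Finset.sum_insert hk, F, Pi.one_apply]
    have hf0 : f 0 = ENNReal.ofReal (T x) := by
      rw [← show _ = T x from ih' hx, ofReal_measureReal]
      simp [f]
    -- Split at h = a_k x. Below it the remaining level x - h/a_k is nonnegative and the induction
    -- hypothesis applies; above it the new summand alone exceeds `x`.
    have hf1 : ∀ h ∈ Set.Ioc 0 (a k * x),
        ENNReal.ofReal (Real.exp (-h)) * f (ENNReal.ofReal ((a k)⁻¹ * h)) =
          ENNReal.ofReal (Real.exp (-h) * T (x - (a k)⁻¹ * h)) := by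
      intro h hh
      have hle : (a k)⁻¹ * h ≤ x := by
        rw [inv_mul_le_iff₀ hak]; exact hh.2
      have hpos : 0 ≤ (a k)⁻¹ * h := mul_nonneg (inv_nonneg.2 hak.le) hh.1.le
      rw [ENNReal.ofReal_mul (Real.exp_nonneg _), ← show _ = T (x - (a k)⁻¹ * h) from
        ih' (sub_nonneg.2 hle), ofReal_measureReal]
      congr 1
      refine congrArg P (Set.ext fun ω => ?_)
      simp only [Set.mem_ofPred_eq]
      rw [ENNReal.ofReal_sub _ hpos, ENNReal.sub_lt_iff_lt_left ENNReal.ofReal_ne_top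
        (ENNReal.ofReal_le_ofReal hle)]
    have hf2 : ∀ h ∈ Set.Ioi (a k * x),
        ENNReal.ofReal (Real.exp (-h)) * f (ENNReal.ofReal ((a k)⁻¹ * h)) =
          ENNReal.ofReal (Real.exp (-h)) := by
      intro h hh
      have hlt : x < (a k)⁻¹ * h := by
        rw [lt_inv_mul_iff₀ hak]; exact hh
      have : f (ENNReal.ofReal ((a k)⁻¹ * h)) = 1 := by
        simp only [f]
        convert measure_univ (μ := P)
        refine Set.eq_univ_of_forall fun ω => ?_
        exact ((ENNReal.ofReal_lt_ofReal_iff (hx.trans_lt hlt)).2 hlt).trans_le le_self_add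
      rw [this, mul_one]
    have hxa : 0 ≤ a k * x := mul_nonneg hak.le hx
    have hT1 : ∀ h ∈ Set.Icc 0 (a k * x), 0 ≤ Real.exp (-h) * T (x - (a k)⁻¹ * h) := by
      intro h hh
      refine mul_nonneg (Real.exp_nonneg _) (hT0 (sub_nonneg.2 ?_))
      rw [inv_mul_le_iff₀ hak]; exact hh.2
    have hI0 : ∫ h in (0 : ℝ)..a k * x, Real.exp (-h) * T (x - (a k)⁻¹ * h) =
        ∑ j ∈ s, tailCoeff q a s j * (a k / (a k - a j) *
          (Real.exp (-(a j * x)) - Real.exp (-(a k * x)))) := by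
      have : ∀ h, Real.exp (-h) * T (x - (a k)⁻¹ * h) = ∑ j ∈ s, tailCoeff q a s j *
          (Real.exp (-h) * Real.exp (-(a j * (x - (a k)⁻¹ * h)))) := fun h => by
        rw [hT, Finset.mul_sum]
        exact Finset.sum_congr rfl fun j _ => by ring
      simp_rw [this]
      rw [intervalIntegral.integral_finsetSum]
      · refine Finset.sum_congr rfl fun j hj => ?_
        rw [intervalIntegral.integral_const_mul, integral_exp_mul_tail hak (hne j hj)]
      · intro j _
        exact Continuous.intervalIntegrable (by fun_prop) _ _
    have hnn : 0 ≤ ∑ j ∈ s, tailCoeff q a s j * (a k / (a k - a j) *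
        (Real.exp (-(a j * x)) - Real.exp (-(a k * x)))) :=
      hI0 ▸ intervalIntegral.integral_nonneg hxa hT1
    have hI1 : ∫⁻ h in Set.Ioc 0 (a k * x),
        ENNReal.ofReal (Real.exp (-h)) * f (ENNReal.ofReal ((a k)⁻¹ * h)) =
        ENNReal.ofReal (∑ j ∈ s, tailCoeff q a s j * (a k / (a k - a j) *
          (Real.exp (-(a j * x)) - Real.exp (-(a k * x))))) := by
      rw [setLIntegral_congr_fun measurableSet_Ioc hf1, ← ofReal_integral_eq_lintegral_ofReal,
        ← intervalIntegral.integral_of_le hxa, hI0]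
      · exact (Continuous.integrableOn_Icc (by fun_prop)).mono_set Set.Ioc_subset_Icc_self
      · exact (ae_restrict_iff' measurableSet_Ioc).2
          (Eventually.of_forall fun h hh => hT1 h (Set.Ioc_subset_Icc_self hh))
    have hI2 : ∫⁻ h in Set.Ioi (a k * x),
        ENNReal.ofReal (Real.exp (-h)) * f (ENNReal.ofReal ((a k)⁻¹ * h)) =
        ENNReal.ofReal (Real.exp (-(a k * x))) := by
      rw [setLIntegral_congr_fun measurableSet_Ioi hf2, ← ofReal_integral_eq_lintegral_ofReal,
        integral_exp_neg_Ioi]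
      · exact integrableOn_exp_neg_Ioi _
      · exact Eventually.of_forall fun h => Real.exp_nonneg _
    have hq1 : 0 ≤ 1 - q := sub_nonneg.2 hq.2.le
    rw [measureReal_def, h0, hlaw k (Finset.mem_insert_self k s) f hfm,
      ← Set.Ioc_union_Ioi_eq_Ioi hxa, lintegral_union measurableSet_Ioi
        (Set.disjoint_left.2 fun h h1 h2 => not_lt.2 h1.2 h2), hI1, hI2, hf0,
      ← ENNReal.ofReal_mul hq.1, ← ENNReal.ofReal_add hnn (Real.exp_nonneg _),
      ← ENNReal.ofReal_mul hq1, ← ENNReal.ofReal_add (mul_nonneg hq.1 (hT0 hx))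
        (mul_nonneg hq1 (add_nonneg hnn (Real.exp_nonneg _))),
      ENNReal.toReal_ofReal (add_nonneg (mul_nonneg hq.1 (hT0 hx))
        (mul_nonneg hq1 (add_nonneg hnn (Real.exp_nonneg _)))),
      Finset.sum_insert hk, tailCoeff_insert_self q a hk,
      prod_eq_one_sub_sum_tailCoeff q a s hinj' (a k) hne]
    have hcoeff : ∑ j ∈ s, tailCoeff q a (insert k s) j * Real.exp (-(a j * x)) =
        ∑ j ∈ s, tailCoeff q a s j * ((a k - q * a j) / (a k - a j)) * Real.exp (-(a j * x)) :=
      Finset.sum_congr rfl fun j hj => by rw [tailCoeff_insert_of_mem q a hj hk]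
    -- The old rates acquire the factor q + (1 - q) a_k/(a_k - a_j) = (a_k - q a_j)/(a_k - a_j).
    -- What remains multiplies exp(-a_k x) and matches the new coefficient, already expanded by
    -- partial fractions at z = a_k.
    have hsplit : ∑ j ∈ s, tailCoeff q a s j * ((a k - q * a j) / (a k - a j)) *
        Real.exp (-(a j * x)) = q * T x + (1 - q) * (∑ j ∈ s, tailCoeff q a s j *
          (a k / (a k - a j) * (Real.exp (-(a j * x)) - Real.exp (-(a k * x)))) +
          (∑ j ∈ s, tailCoeff q a s j * (a k / (a k - a j))) * Real.exp (-(a k * x))) := by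
      rw [hT, Finset.sum_mul, ← Finset.sum_add_distrib, Finset.mul_sum, Finset.mul_sum,
        ← Finset.sum_add_distrib]
      refine Finset.sum_congr rfl fun j hj => ?_
      have hjk : a k - a j ≠ 0 := sub_ne_zero.2 (hne j hj).symm
      field_simp
      ring
    rw [hcoeff, hsplit]
    ring

end CoopNetwork

namespace CoopNetwork

open Filter Topology

/-! ### The Euler integral of the hypergeometric function -/

/-- The beta distribution with density `b * x ^ (b - 1)` on `(0, 1)`. -/
noncomputable def eulerMeasure (b : ℝ) : Measure ℝ :=
  (volume.restrict (Set.Ioo 0 1)).withDensity fun x => ENNReal.ofReal (b * x ^ (b - 1))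

theorem measurable_eulerDensity (b : ℝ) :
    Measurable fun x : ℝ => ENNReal.ofReal (b * x ^ (b - 1)) :=
  ((measurable_id.pow_const _).const_mul _).ennreal_ofReal

theorem integral_pow_eulerMeasure {b : ℝ} (hb : 0 < b) (n : ℕ) :
    ∫ x, x ^ n ∂eulerMeasure b = b / (b + n) := by
  rw [eulerMeasure, integral_withDensity_eq_integral_toReal_smul (measurable_eulerDensity b)
    (Eventually.of_forall fun x => ENNReal.ofReal_lt_top)]
  have h : ∀ x ∈ Set.Ioo (0 : ℝ) 1, (ENNReal.ofReal (b * x ^ (b - 1))).toReal • x ^ n =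
      b * x ^ (b + n - 1) := fun x hx => by
    rw [ENNReal.toReal_ofReal (mul_nonneg hb.le (Real.rpow_nonneg hx.1.le _)), smul_eq_mul,
      ← Real.rpow_natCast, mul_assoc, ← Real.rpow_add hx.1]
    ring_nf
  rw [setIntegral_congr_fun measurableSet_Ioo h, ← integral_Ioc_eq_integral_Ioo,
    ← intervalIntegral.integral_of_le zero_le_one, intervalIntegral.integral_const_mul,
    integral_rpow (Or.inl (by have : (0 : ℝ) ≤ n := by positivity
                              linarith))]
  have h1 : b + n ≠ 0 := by positivity
  simp only [sub_add_cancel, Real.one_rpow, Real.zero_rpow h1, sub_zero]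
  ring

theorem isFiniteMeasure_eulerMeasure {b : ℝ} (hb : 0 < b) : IsFiniteMeasure (eulerMeasure b) := by
  have h : Integrable (fun _ => (1 : ℝ)) (eulerMeasure b) := by
    refine Integrable.of_integral_ne_zero ?_
    have := integral_pow_eulerMeasure hb 0
    simp only [pow_zero, Nat.cast_zero, add_zero] at this
    rw [this, div_self hb.ne']
    exact one_ne_zero
  rcases integrable_const_iff.1 h with h | h
  · exact absurd h one_ne_zero
  · exact h

theorem ae_eulerMeasure_mem (b : ℝ) : ∀ᵐ x ∂eulerMeasure b, x ∈ Set.Ioo (0 : ℝ) 1 :=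
  (withDensity_absolutelyContinuous _ _).ae_le (ae_restrict_mem measurableSet_Ioo)

/-- Geometric series under the integral. The moments b/(b + n) equal (b)_n/(b + 1)_n, so these are
the terms of ₂F₁(1, b; b + 1; z). -/
theorem hasSum_integral_eulerMeasure {b : ℝ} (hb : 0 < b) {z : ℝ} (hz : |z| < 1) :
    HasSum (fun n : ℕ => z ^ n * (b / (b + n))) (∫ x, (1 - z * x)⁻¹ ∂eulerMeasure b) := by
  have := isFiniteMeasure_eulerMeasure hb
  simp_rw [← integral_pow_eulerMeasure hb, ← integral_const_mul]
  refine hasSum_integral_of_dominated_convergence (fun n _ => |z| ^ n)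
    (fun n => (by fun_prop : Continuous fun x : ℝ => z ^ n * x ^ n).aestronglyMeasurable)
    (fun n => ?_) (Eventually.of_forall fun _ => summable_geometric_of_lt_one (abs_nonneg z) hz)
    (integrable_const _) ?_
  · filter_upwards [ae_eulerMeasure_mem b] with x hx
    rw [norm_mul, norm_pow, norm_pow, Real.norm_eq_abs, Real.norm_of_nonneg hx.1.le]
    exact mul_le_of_le_one_right (by positivity) (pow_le_one₀ hx.1.le hx.2.le)
  · filter_upwards [ae_eulerMeasure_mem b] with x hx
    simp_rw [← mul_pow]
    refine hasSum_geometric_of_abs_lt_one ?_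
    rw [abs_mul, abs_of_pos hx.1]
    exact (mul_le_of_le_one_right (abs_nonneg z) hx.2.le).trans_lt hz

theorem ascPochhammer_eval_mul_add (b : ℝ) (n : ℕ) :
    (ascPochhammer ℝ n).eval b * (b + n) = b * (ascPochhammer ℝ n).eval (b + 1) := by
  rw [← ascPochhammer_succ_eval, ascPochhammer_succ_left]
  simp

theorem integral_eulerMeasure_eq {b : ℝ} (hb : 0 < b) {z : ℝ} (hz : |z| < 1) :
    ∫ x, (1 - z * x)⁻¹ ∂eulerMeasure b = ₂F₁ (1 : ℝ) b (b + 1) z := by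
  rw [← (hasSum_integral_eulerMeasure hb hz).tsum_eq, ordinaryHypergeometric_eq_tsum]
  refine tsum_congr fun n => ?_
  have h1 : (ascPochhammer ℝ n).eval (b + 1) ≠ 0 :=
    (ascPochhammer_pos n (b + 1) (by linarith)).ne'
  have h2 : (b + n : ℝ) ≠ 0 := by positivity
  have h3 : (n.factorial : ℝ) ≠ 0 := by positivity
  have h4 := ascPochhammer_eval_mul_add b n
  rw [ascPochhammer_eval_one, smul_eq_mul]
  field_simp
  linear_combination (-z ^ n) * h4

/-- Differentiation under the integral sign, possible because 1 - w x stays away from 0 for x in (0,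
1) and w near a point of the half-plane Re < 1. -/
theorem hasDerivAt_integral_eulerMeasure {b : ℝ} (hb : 0 < b) {z : ℂ} (hz : z.re < 1) :
    ∃ F', HasDerivAt (fun w : ℂ => ∫ x, (1 - w * (x : ℂ))⁻¹ ∂eulerMeasure b) F' z := by
  have := isFiniteMeasure_eulerMeasure hb
  -- Re(1 - w x) = 1 - x Re w is at least 1 if Re w ≤ 0 and at least 1 - Re w otherwise; on the ball
  -- of radius (1 - Re z)/2 the latter is at least (1 - Re z)/2.
  set c := min 1 ((1 - z.re) / 2) with hc
  have hc0 : 0 < c := lt_min one_pos (by linarith)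
  have hlow : ∀ x ∈ Set.Ioo (0 : ℝ) 1, ∀ w ∈ Metric.ball z ((1 - z.re) / 2),
      c ≤ ‖1 - w * (x : ℂ)‖ := by
    intro x hx w hw
    have h1 : w.re ≤ z.re + (1 - z.re) / 2 := by
      have := (Complex.re_le_norm (w - z)).trans (mem_ball_iff_norm.1 hw).le
      rw [Complex.sub_re] at this
      linarith
    have h2 : (1 - w * (x : ℂ)).re = 1 - w.re * x := by simp
    refine le_trans ?_ ((h2.symm.le.trans (Complex.re_le_norm _)))
    rcases le_total w.re 0 with h | h
    · exact (min_le_left _ _).trans (by nlinarith [hx.1])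
    · exact (min_le_right _ _).trans (by nlinarith [hx.1, hx.2])
  have hne : ∀ x ∈ Set.Ioo (0 : ℝ) 1, ∀ w ∈ Metric.ball z ((1 - z.re) / 2),
      1 - w * (x : ℂ) ≠ 0 := fun x hx w hw => norm_pos_iff.1 (hc0.trans_le (hlow x hx w hw))
  have hmeas : ∀ w : ℂ, Measurable fun x : ℝ => (1 - w * (x : ℂ))⁻¹ := fun w =>
    (measurable_const.sub (Complex.measurable_ofReal.const_mul w)).inv
  have hpos : 0 < (1 - z.re) / 2 := by linarith
  refine ⟨_, (hasDerivAt_integral_of_dominated_loc_of_deriv_le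
    (F' := fun w (x : ℝ) => (x : ℂ) / (1 - w * (x : ℂ)) ^ 2) (bound := fun _ => 1 / c ^ 2)
    (Metric.ball_mem_nhds z hpos)
    (Eventually.of_forall fun w => (hmeas w).aestronglyMeasurable) ?_ ?_ ?_
    (integrable_const _) ?_).2⟩
  · refine Integrable.of_bound (hmeas z).aestronglyMeasurable (1 / c) ?_
    filter_upwards [ae_eulerMeasure_mem b] with x hx
    rw [norm_inv, ← one_div]
    exact one_div_le_one_div_of_le hc0 (hlow x hx z (Metric.mem_ball_self hpos))
  · exact (Complex.measurable_ofReal.div ((measurable_const.sub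
      (Complex.measurable_ofReal.const_mul z)).pow_const 2)).aestronglyMeasurable
  · filter_upwards [ae_eulerMeasure_mem b] with x hx w hw
    rw [norm_div, norm_pow]
    have : ‖(x : ℂ)‖ ≤ 1 := by
      rw [Complex.norm_real, Real.norm_of_nonneg hx.1.le]; exact hx.2.le
    exact div_le_div₀ zero_le_one this (by positivity)
      (pow_le_pow_left₀ hc0.le (hlow x hx w hw) 2)
  · filter_upwards [ae_eulerMeasure_mem b] with x hx w hw
    have h := ((hasDerivAt_id w).mul_const (x : ℂ)).const_sub 1
    exact (h.inv (hne x hx w hw)).congr_deriv (by simp)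

/-- Holomorphy on Re < 1 restricts to real analyticity on (-∞, 1). A continuation thus exists, and
`gaussHypergeometric` does not take its default value 0 at these parameters. -/
theorem isGaussContinuation_eulerMeasure {b : ℝ} (hb : 0 < b) :
    IsGaussContinuation 1 b (b + 1) fun z => ∫ x, (1 - z * x)⁻¹ ∂eulerMeasure b := by
  refine ⟨fun z hz => ?_, fun x hx => integral_eulerMeasure_eq hb hx⟩
  let F : ℂ → ℂ := fun w => ∫ x, (1 - w * (x : ℂ))⁻¹ ∂eulerMeasure b
  have hopen : IsOpen {w : ℂ | w.re < 1} := isOpen_lt Complex.continuous_re continuous_const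
  have hF : DifferentiableOn ℂ F {w : ℂ | w.re < 1} := fun w hw => by
    obtain ⟨F', h⟩ := hasDerivAt_integral_eulerMeasure hb hw
    exact h.differentiableAt.differentiableWithinAt
  have hz' : (z : ℂ) ∈ {w : ℂ | w.re < 1} := by simpa using hz
  have hA : AnalyticAt ℝ F (z : ℂ) := (hF.analyticAt (hopen.mem_nhds hz')).restrictScalars
  have hA2 : AnalyticAt ℝ (fun x : ℝ => (F (x : ℂ)).re) z :=
    (Complex.reCLM.analyticAt _).comp (hA.comp (Complex.ofRealCLM.analyticAt z))
  refine hA2.congr (Eventually.of_forall fun x => ?_)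
  have : F (x : ℂ) = ((∫ y, (1 - x * y)⁻¹ ∂eulerMeasure b : ℝ) : ℂ) := by
    rw [← integral_complex_ofReal]
    refine integral_congr_ae (Eventually.of_forall fun y => ?_)
    simp
  change (F (x : ℂ)).re = _
  rw [this, Complex.ofReal_re]

theorem interfF_eq {t η : ℝ} (hη : 2 < η) (ht : 0 ≤ t) :
    interfF t η = 2 * t / (η - 2) * ∫ x, (1 + t * x)⁻¹ ∂eulerMeasure (1 - 2 / η) := by
  have hb : 0 < 1 - 2 / η := by
    rw [sub_pos, div_lt_one (by linarith)]; exact hη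
  rw [interfF, show (2 : ℝ) - 2 / η = (1 - 2 / η) + 1 by ring,
    gaussHypergeometric_eq (isGaussContinuation_eulerMeasure hb) (by linarith)]
  simp

theorem lintegral_eulerMeasure {b : ℝ} (hb : 0 < b) {t : ℝ} (ht : 0 ≤ t) :
    ENNReal.ofReal (∫ x, (1 + t * x)⁻¹ ∂eulerMeasure b) =
      ∫⁻ x in Set.Ioo (0 : ℝ) 1, ENNReal.ofReal (b * x ^ (b - 1) * (1 + t * x)⁻¹) := by
  have := isFiniteMeasure_eulerMeasure hb
  have hm : Measurable fun x : ℝ => (1 + t * x)⁻¹ := by fun_prop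
  have hpos : ∀ x ∈ Set.Ioo (0 : ℝ) 1, 1 ≤ 1 + t * x := fun x hx => by nlinarith [hx.1]
  rw [ofReal_integral_eq_lintegral_ofReal, eulerMeasure,
    lintegral_withDensity_eq_lintegral_mul _ (measurable_eulerDensity b) hm.ennreal_ofReal]
  · refine setLIntegral_congr_fun measurableSet_Ioo fun x hx => ?_
    exact (ENNReal.ofReal_mul (mul_nonneg hb.le (Real.rpow_nonneg hx.1.le _))).symm
  · refine Integrable.of_bound hm.aestronglyMeasurable 1 ?_
    filter_upwards [ae_eulerMeasure_mem b] with x hx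
    rw [norm_inv, Real.norm_of_nonneg (zero_le_one.trans (hpos x hx))]
    exact inv_le_one_of_one_le₀ (hpos x hx)
  · filter_upwards [ae_eulerMeasure_mem b] with x hx
    exact inv_nonneg.2 (zero_le_one.trans (hpos x hx))

theorem interfF_nonneg {t η : ℝ} (hη : 2 < η) (ht : 0 ≤ t) : 0 ≤ interfF t η := by
  rw [interfF_eq hη ht]
  refine mul_nonneg (div_nonneg (by linarith) (by linarith)) (integral_nonneg_of_ae ?_)
  filter_upwards [ae_eulerMeasure_mem _] with x hx
  have := mul_nonneg ht hx.1.le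
  exact inv_nonneg.2 (by linarith)

theorem interfF_zero (η : ℝ) : interfF 0 η = 0 := by simp [interfF]

theorem continuousAt_interfF {t η : ℝ} (hη : 2 < η) (ht : -1 < t) :
    ContinuousAt (fun t => interfF t η) t := by
  have hb : 0 < 1 - 2 / η := by
    rw [sub_pos, div_lt_one (by linarith)]; exact hη
  have hG := isGaussContinuation_eulerMeasure hb
  have hc : ContinuousAt (fun z => ∫ x, (1 - z * x)⁻¹ ∂eulerMeasure (1 - 2 / η)) (-t) :=
    (hG.1 (-t) (show -t < 1 by linarith)).continuousAt
  have h1 : ContinuousAt (fun t : ℝ => 2 * t / (η - 2) *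
      ∫ x, (1 - (-t) * x)⁻¹ ∂eulerMeasure (1 - 2 / η)) t :=
    ContinuousAt.mul (by fun_prop)
      (ContinuousAt.comp (f := fun t : ℝ => -t) hc continuous_neg.continuousAt)
  refine h1.congr ?_
  filter_upwards [eventually_gt_nhds ht] with t ht
  rw [interfF, show (2 : ℝ) - 2 / η = (1 - 2 / η) + 1 by ring,
    gaussHypergeometric_eq hG (by linarith)]

end CoopNetwork

namespace CoopNetwork

open Filter Topology

/-! ### Radial integrals over the plane -/

/-- Polar coordinates; 2π is the dimension times the area of the unit disk. -/
theorem lintegral_fun_norm_plane {h : ℝ → ℝ≥0∞} (hh : Measurable h) :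
    ∫⁻ x : Plane, h ‖x‖ = ∫⁻ r in Set.Ioi (0 : ℝ), ENNReal.ofReal (2 * Real.pi * r) * h r := by
  have hdim : Module.finrank ℝ Plane = 2 := by simp
  have h1 : ∫⁻ x : Plane, h ‖x‖ = ∫⁻ x : ({(0 : Plane)}ᶜ : Set Plane), h ‖x.1‖
      ∂((volume : Measure Plane).comap (↑)) := by
    rw [lintegral_subtype_comap (measurableSet_singleton _).compl fun x : Plane => h ‖x‖,
      restrict_compl_singleton]
  have h2 : ∫⁻ x : ({(0 : Plane)}ᶜ : Set Plane), h ‖x.1‖ ∂((volume : Measure Plane).comap (↑)) =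
      ∫⁻ p, h p.2 ∂((volume : Measure Plane).toSphere.prod (.volumeIoiPow 1)) := by
    have := ((volume : Measure Plane).measurePreserving_homeomorphUnitSphereProd).lintegral_comp
      (f := fun p => h p.2) (hh.comp (measurable_subtype_coe.comp measurable_snd))
    rw [hdim] at this
    simpa using this
  have h3 : ∫⁻ p, h p.2 ∂((volume : Measure Plane).toSphere.prod (.volumeIoiPow 1)) =
      (volume : Measure Plane).toSphere Set.univ *
        ∫⁻ r : Set.Ioi (0 : ℝ), h r ∂(Measure.volumeIoiPow 1) := by
    have hm : Measurable fun p : (Metric.sphere (0 : Plane) 1) × Set.Ioi (0 : ℝ) => h p.2 :=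
      hh.comp (measurable_subtype_coe.comp measurable_snd)
    rw [lintegral_prod _ hm.aemeasurable]
    exact (lintegral_const (∫⁻ r : Set.Ioi (0 : ℝ), h r ∂(Measure.volumeIoiPow 1))).trans
      (mul_comm _ _)
  have h4 : ∫⁻ r : Set.Ioi (0 : ℝ), h r ∂(Measure.volumeIoiPow 1) =
      ∫⁻ r in Set.Ioi (0 : ℝ), ENNReal.ofReal r * h r := by
    have hm : Measurable fun r : Set.Ioi (0 : ℝ) => h r := hh.comp measurable_subtype_coe
    rw [Measure.volumeIoiPow, lintegral_withDensity_eq_lintegral_mul _ (by fun_prop) hm,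
      ← lintegral_subtype_comap measurableSet_Ioi fun r : ℝ => ENNReal.ofReal r * h r]
    simp only [Pi.mul_apply, pow_one]
  rw [h1, h2, h3, h4, Measure.toSphere_apply_univ, hdim, EuclideanSpace.volume_ball_fin_two,
    ← lintegral_const_mul _ (by fun_prop)]
  refine setLIntegral_congr_fun measurableSet_Ioi fun r _ => ?_
  rw [ENNReal.ofReal_mul (by positivity), ENNReal.ofReal_mul (by norm_num)]
  simp [mul_assoc]

/-- Substitution y = c r^(-η): from r² = (c/y)^(2/η), up to orientation, r dr = η⁻¹ c^(2/η) y^(-2/η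
- 1) dy. -/
theorem lintegral_comp_rpow_neg {η c : ℝ} (hη : 0 < η) (hc : 0 < c) {s : Set ℝ}
    (hs : MeasurableSet s) (hs0 : s ⊆ Set.Ioi 0) (h : ℝ → ℝ≥0∞) :
    ∫⁻ r in s, ENNReal.ofReal (2 * Real.pi * r) * h (c * r ^ (-η)) =
      ∫⁻ y in (fun r => c * r ^ (-η)) '' s,
        ENNReal.ofReal (2 * Real.pi / η * c ^ (2 / η) * y ^ (-(2 / η) - 1)) * h y := by
  have hinj : Set.InjOn (fun r : ℝ => c * r ^ (-η)) s := by
    intro x hx y hy hxy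
    have h1 := mul_left_cancel₀ hc.ne' hxy
    exact (Real.rpow_left_inj (hs0 hx).le (hs0 hy).le (neg_ne_zero.2 hη.ne')).1 h1
  have hderiv : ∀ r ∈ s, HasDerivWithinAt (fun r : ℝ => c * r ^ (-η))
      (c * (-η * r ^ (-η - 1))) s r := fun r hr =>
    ((Real.hasDerivAt_rpow_const (Or.inl (hs0 hr).ne')).const_mul c).hasDerivWithinAt
  rw [lintegral_image_eq_lintegral_abs_deriv_mul hs hderiv hinj]
  refine setLIntegral_congr_fun hs fun r hr => ?_
  have hr0 : 0 < r := hs0 hr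
  rw [← mul_assoc, ← ENNReal.ofReal_mul (abs_nonneg _)]
  congr 2
  rw [abs_mul, abs_mul, abs_neg, abs_of_pos hc, abs_of_pos hη, abs_of_pos (by positivity),
    Real.mul_rpow hc.le (by positivity), ← Real.rpow_mul hr0.le]
  have e1 : -η * (-(2 / η) - 1) = 2 + η := by field_simp; ring
  have e2 : c ^ (-(2 / η) - 1) = (c ^ (2 / η))⁻¹ * c⁻¹ := by
    rw [Real.rpow_sub hc, Real.rpow_neg hc.le, Real.rpow_one]; rfl
  have e3 : r ^ (-η - 1) * r ^ (2 + η) = r := by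
    rw [← Real.rpow_add hr0]; ring_nf; exact Real.rpow_one r
  rw [e1, e2]
  have hc2 : c ^ (2 / η) ≠ 0 := by positivity
  calc 2 * Real.pi * r = 2 * Real.pi * (r ^ (-η - 1) * r ^ (2 + η)) := by rw [e3]
    _ = _ := by field_simp

/-- The substitution y = (D/r)^η sends (D, ∞) to (0, 1). It produces the density y^(-2/η)/(1 + t y)
up to a constant, which is the Euler integral with b = 1 - 2/η. -/
theorem lintegral_compl_closedBall_interf {η S D : ℝ} (hη : 2 < η) (hS : 0 ≤ S) (hD : 0 < D) :
    ∫⁻ x in (Metric.closedBall (0 : Plane) D)ᶜ,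
        ENNReal.ofReal (S * ‖x‖ ^ (-η) / (1 + S * ‖x‖ ^ (-η))) =
      ENNReal.ofReal (Real.pi * D ^ 2 * interfF (S * D ^ (-η)) η) := by
  have hη0 : 0 < η := by linarith
  have hb : 0 < 1 - 2 / η := by
    rw [sub_pos, div_lt_one hη0]; exact hη
  set t := S * D ^ (-η) with ht
  have ht0 : 0 ≤ t := by positivity
  have hg : Measurable fun y : ℝ => ENNReal.ofReal (t * y / (1 + t * y)) := by fun_prop
  have hDη : D ^ (-η) * D ^ η = 1 := by rw [← Real.rpow_add hD]; simp
  have h1 : ∫⁻ x in (Metric.closedBall (0 : Plane) D)ᶜ,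
        ENNReal.ofReal (S * ‖x‖ ^ (-η) / (1 + S * ‖x‖ ^ (-η))) =
      ∫⁻ x : Plane, (Set.Ioi D).indicator
        (fun r => ENNReal.ofReal (t * (D ^ η * r ^ (-η)) / (1 + t * (D ^ η * r ^ (-η))))) ‖x‖ := by
    rw [← lintegral_indicator measurableSet_closedBall.compl]
    refine lintegral_congr fun x => ?_
    have e : t * (D ^ η * ‖x‖ ^ (-η)) = S * ‖x‖ ^ (-η) := by
      rw [ht]; linear_combination (S * ‖x‖ ^ (-η)) * hDη
    by_cases hx : D < ‖x‖
    · rw [Set.indicator_of_mem (show ‖x‖ ∈ Set.Ioi D from hx), Set.indicator_of_mem, e]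
      exact fun hm => not_le.2 hx (mem_closedBall_zero_iff.1 hm)
    · rw [Set.indicator_of_notMem (show ‖x‖ ∉ Set.Ioi D from hx), Set.indicator_of_notMem]
      exact fun hm => hm (mem_closedBall_zero_iff.2 (not_lt.1 hx))
  have himg : (fun r => D ^ η * r ^ (-η)) '' Set.Ioi D = Set.Ioo 0 1 := by
    ext y
    constructor
    · rintro ⟨r, hr, rfl⟩
      have hr0 : 0 < r := hD.trans hr
      refine ⟨by positivity, ?_⟩
      change D ^ η * r ^ (-η) < 1
      rw [Real.rpow_neg hr0.le, ← div_eq_mul_inv, div_lt_one (by positivity)]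
      exact Real.rpow_lt_rpow hD.le hr hη0
    · rintro ⟨hy0, hy1⟩
      refine ⟨D * y ^ (-(1 / η)), ?_, ?_⟩
      · change D < D * y ^ (-(1 / η))
        refine lt_mul_of_one_lt_right hD ?_
        exact Real.one_lt_rpow_of_pos_of_lt_one_of_neg hy0 hy1 (by simp [hη0])
      · change D ^ η * (D * y ^ (-(1 / η))) ^ (-η) = y
        rw [Real.mul_rpow hD.le (by positivity), ← Real.rpow_mul hy0.le, ← mul_assoc,
          ← Real.rpow_add hD]
        have : -(1 / η) * -η = 1 := by field_simp
        rw [this]; simp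
  rw [h1, lintegral_fun_norm_plane (Measurable.indicator (by fun_prop) measurableSet_Ioi)]
  have h2 : ∫⁻ r in Set.Ioi (0 : ℝ), ENNReal.ofReal (2 * Real.pi * r) * (Set.Ioi D).indicator
        (fun r => ENNReal.ofReal (t * (D ^ η * r ^ (-η)) / (1 + t * (D ^ η * r ^ (-η))))) r =
      ∫⁻ r in Set.Ioi D, ENNReal.ofReal (2 * Real.pi * r) *
        ENNReal.ofReal (t * (D ^ η * r ^ (-η)) / (1 + t * (D ^ η * r ^ (-η)))) := by
    rw [← lintegral_indicator measurableSet_Ioi, ← lintegral_indicator measurableSet_Ioi]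
    refine lintegral_congr fun r => ?_
    by_cases hr : r ∈ Set.Ioi D
    · rw [Set.indicator_of_mem hr, Set.indicator_of_mem (show r ∈ Set.Ioi 0 from hD.trans hr),
        Set.indicator_of_mem hr]
    · rw [Set.indicator_of_notMem hr]
      by_cases hr0 : r ∈ Set.Ioi 0
      · rw [Set.indicator_of_mem hr0, Set.indicator_of_notMem hr, mul_zero]
      · rw [Set.indicator_of_notMem hr0]
  rw [h2, lintegral_comp_rpow_neg hη0 (Real.rpow_pos_of_pos hD η) measurableSet_Ioi
    (Set.Ioi_subset_Ioi hD.le) fun y => ENNReal.ofReal (t * y / (1 + t * y)), himg,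
    interfF_eq hη ht0]
  have h3 : Real.pi * D ^ 2 * (2 * t / (η - 2) *
      ∫ x, (1 + t * x)⁻¹ ∂eulerMeasure (1 - 2 / η)) = Real.pi * D ^ 2 * (2 * t / (η - 2)) *
      ∫ x, (1 + t * x)⁻¹ ∂eulerMeasure (1 - 2 / η) := by ring
  have hη2 : 0 < η - 2 := by linarith
  rw [h3, ENNReal.ofReal_mul (by positivity), lintegral_eulerMeasure hb ht0,
    ← lintegral_const_mul' _ _ ENNReal.ofReal_ne_top]
  refine setLIntegral_congr_fun measurableSet_Ioo fun y hy => ?_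
  have hy0 : 0 < y := hy.1
  have hp : 0 ≤ y ^ (-(2 / η) - 1) := Real.rpow_nonneg hy0.le _
  rw [← ENNReal.ofReal_mul (by positivity), ← ENNReal.ofReal_mul (by positivity)]
  congr 1
  have e1 : (D ^ η) ^ (2 / η) = D ^ 2 := by
    rw [← Real.rpow_mul hD.le, mul_div_cancel₀ _ hη0.ne']; norm_cast
  have e2 : y ^ (1 - 2 / η - 1) = y ^ (-(2 / η) - 1) * y := by
    rw [← Real.rpow_add_one hy0.ne']; ring_nf
  have hpos : 1 + t * y ≠ 0 := by positivity
  rw [e1, e2]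
  field_simp
  

theorem lintegral_rpow_mul_exp {a r : ℝ} (ha : 0 < a) (hr : 0 < r) :
    ∫⁻ y in Set.Ioi (0 : ℝ), ENNReal.ofReal (y ^ (a - 1) * Real.exp (-(r * y))) =
      ENNReal.ofReal ((1 / r) ^ a * Real.Gamma a) := by
  have key := Real.integral_rpow_mul_exp_neg_mul_Ioi ha hr
  rw [← key, ofReal_integral_eq_lintegral_ofReal]
  · exact .of_integral_ne_zero (by rw [key]; positivity)
  · exact (ae_restrict_iff' measurableSet_Ioi).2 (Eventually.of_forall fun y hy =>
      mul_nonneg (Real.rpow_nonneg (le_of_lt hy) _) (Real.exp_nonneg _))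

/-- With y = r^(-η) and δ = 2/η, write 1/(1 + S y) as the integral of exp(-(1 + S y)u) over u > 0
and exchange the integrals. The y-integral gives Γ(1 - δ), the u-integral gives Γ(δ), and δ Γ(δ) =
Γ(1 + δ). -/
theorem lintegral_interf {η S : ℝ} (hη : 2 < η) (hS : 0 ≤ S) :
    ∫⁻ x : Plane, ENNReal.ofReal (S * ‖x‖ ^ (-η) / (1 + S * ‖x‖ ^ (-η))) =
      ENNReal.ofReal (Real.pi * S ^ (2 / η) * Real.Gamma (1 + 2 / η) *
        Real.Gamma (1 - 2 / η)) := by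
  have hη0 : 0 < η := by linarith
  rcases hS.eq_or_lt with rfl | hS
  · have : (0 : ℝ) ^ (2 / η) = 0 := Real.zero_rpow (by positivity)
    simp [this]
  set δ := 2 / η with hδ
  have hδ0 : 0 < δ := by positivity
  have hδ1 : 0 < 1 - δ := by
    rw [sub_pos, hδ, div_lt_one hη0]; exact hη
  have himg : (fun r : ℝ => 1 * r ^ (-η)) '' Set.Ioi 0 = Set.Ioi 0 := by
    ext y
    constructor
    · rintro ⟨r, hr, rfl⟩
      have hr0 : 0 < r := hr
      change 0 < 1 * r ^ (-η)
      positivity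
    · intro hy
      have hy0 : 0 < y := hy
      refine ⟨y ^ (-(1 / η)), Real.rpow_pos_of_pos hy0 _, ?_⟩
      change 1 * (y ^ (-(1 / η))) ^ (-η) = y
      rw [← Real.rpow_mul hy0.le]
      have : -(1 / η) * -η = 1 := by field_simp
      rw [this]; simp
  have h1 := lintegral_comp_rpow_neg hη0 one_pos measurableSet_Ioi (subset_refl (Set.Ioi 0))
    fun y => ENNReal.ofReal (S * y / (1 + S * y))
  rw [himg] at h1
  simp only [one_mul] at h1
  rw [lintegral_fun_norm_plane (h := fun r => ENNReal.ofReal (S * r ^ (-η) / (1 + S * r ^ (-η))))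
    (by fun_prop), h1]
  have h2 : ∀ y ∈ Set.Ioi (0 : ℝ), ENNReal.ofReal (2 * Real.pi / η * 1 ^ (2 / η) *
      y ^ (-(2 / η) - 1)) * ENNReal.ofReal (S * y / (1 + S * y)) =
      ∫⁻ u in Set.Ioi (0 : ℝ), ENNReal.ofReal (Real.pi * δ * S) *
        (ENNReal.ofReal (y ^ ((1 - δ) - 1) * Real.exp (-(S * u * y))) *
          ENNReal.ofReal (Real.exp (-u))) := by
    intro y hy
    have hy0 : 0 < y := hy
    have h3 := lintegral_rpow_mul_exp one_pos (show 0 < 1 + S * y by positivity)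
    simp only [sub_self, Real.rpow_zero, one_mul, Real.rpow_one, Real.Gamma_one, mul_one] at h3
    have h4 : ∀ u : ℝ, ENNReal.ofReal (Real.pi * δ * S) *
        (ENNReal.ofReal (y ^ ((1 - δ) - 1) * Real.exp (-(S * u * y))) *
          ENNReal.ofReal (Real.exp (-u))) = ENNReal.ofReal (Real.pi * δ * S * y ^ ((1 - δ) - 1)) *
          ENNReal.ofReal (Real.exp (-((1 + S * y) * u))) := fun u => by
      rw [← ENNReal.ofReal_mul (by positivity), ← ENNReal.ofReal_mul (by positivity),
        ← ENNReal.ofReal_mul (by positivity),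
        show -((1 + S * y) * u) = -(S * u * y) + -u by ring, Real.exp_add]
      congr 1; ring
    simp_rw [h4]
    rw [lintegral_const_mul' _ _ ENNReal.ofReal_ne_top, h3, ← ENNReal.ofReal_mul (by positivity),
      ← ENNReal.ofReal_mul (by positivity)]
    congr 1
    have e2 : y ^ ((1 - δ) - 1) = y ^ (-δ - 1) * y := by
      rw [← Real.rpow_add_one hy0.ne']; ring_nf
    rw [e2, Real.one_rpow, ← hδ, hδ]
    field_simp
  rw [setLIntegral_congr_fun measurableSet_Ioi h2, lintegral_lintegral_swap (by fun_prop)]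
  have h5 : ∀ u ∈ Set.Ioi (0 : ℝ), ∫⁻ y in Set.Ioi (0 : ℝ), ENNReal.ofReal (Real.pi * δ * S) *
        (ENNReal.ofReal (y ^ ((1 - δ) - 1) * Real.exp (-(S * u * y))) *
          ENNReal.ofReal (Real.exp (-u))) =
      ENNReal.ofReal (Real.pi * δ * S ^ δ * Real.Gamma (1 - δ)) *
        ENNReal.ofReal (u ^ (δ - 1) * Real.exp (-(1 * u))) := by
    intro u hu
    have hu0 : 0 < u := hu
    have hG := Real.Gamma_pos_of_pos hδ1
    rw [lintegral_const_mul' _ _ ENNReal.ofReal_ne_top,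
      lintegral_mul_const' _ _ ENNReal.ofReal_ne_top,
      lintegral_rpow_mul_exp hδ1 (by positivity), ← ENNReal.ofReal_mul (by positivity),
      ← ENNReal.ofReal_mul (by positivity), ← ENNReal.ofReal_mul (by positivity)]
    congr 1
    rw [one_div, Real.inv_rpow (by positivity), ← Real.rpow_neg (by positivity),
      Real.mul_rpow hS.le hu0.le, show -(1 - δ) = δ - 1 by ring, Real.rpow_sub_one hS.ne', one_mul]
    field_simp
  have hG := Real.Gamma_pos_of_pos hδ1
  have hG2 := Real.Gamma_pos_of_pos hδ0
  rw [setLIntegral_congr_fun measurableSet_Ioi h5, lintegral_const_mul' _ _ ENNReal.ofReal_ne_top,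
    lintegral_rpow_mul_exp hδ0 one_pos, ← ENNReal.ofReal_mul (by positivity)]
  congr 1
  rw [add_comm 1 δ, Real.Gamma_add_one hδ0.ne']
  simp
  ring

end CoopNetwork

namespace CoopNetwork

open Filter Topology

variable {Ω : Type*} [MeasurableSpace Ω] {P : Measure Ω}

/-! ### Independent marks -/

/-- Independent pairs of independent families are independent. -/
theorem iIndepFun_prodMk [IsProbabilityMeasure P] {κ α β : Type*} [MeasurableSpace α]
    [MeasurableSpace β] {A : κ → Ω → α} {B : κ → Ω → β} (hA : ∀ k, Measurable (A k))
    (hB : ∀ k, Measurable (B k)) (hiA : iIndepFun A P) (hiB : iIndepFun B P)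
    (hAB : IndepFun (fun ω k => A k ω) (fun ω k => B k ω) P) :
    iIndepFun (fun k ω => (A k ω, B k ω)) P := by
  -- Rectangles: a generating π-system on which the two independences multiply.
  let π : κ → Set (Set Ω) := fun k =>
    {E | ∃ S T, MeasurableSet S ∧ MeasurableSet T ∧ A k ⁻¹' S ∩ B k ⁻¹' T = E}
  have hπ : iIndepSets π P := by
    rw [iIndepSets_iff]
    intro s f hf
    have hf' : ∀ k, ∃ S T, k ∈ s → MeasurableSet S ∧ MeasurableSet T ∧
        A k ⁻¹' S ∩ B k ⁻¹' T = f k := fun k => by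
      by_cases hk : k ∈ s
      · obtain ⟨S, T, h⟩ := hf k hk
        exact ⟨S, T, fun _ => h⟩
      · exact ⟨∅, ∅, fun h => absurd h hk⟩
    choose S T hST using hf'
    have h1 : (⋂ k ∈ s, f k) = (⋂ k ∈ s, A k ⁻¹' S k) ∩ ⋂ k ∈ s, B k ⁻¹' T k := by
      ext ω
      simp only [Set.mem_iInter, Set.mem_inter_iff]
      constructor
      · intro h
        have h' : ∀ k ∈ s, ω ∈ A k ⁻¹' S k ∩ B k ⁻¹' T k := fun k hk => by
          rw [(hST k hk).2.2]; exact h k hk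
        exact ⟨fun k hk => (h' k hk).1, fun k hk => (h' k hk).2⟩
      · rintro ⟨h, h'⟩ k hk
        rw [← (hST k hk).2.2]
        exact ⟨h k hk, h' k hk⟩
    have hU : MeasurableSet {x : κ → α | ∀ k ∈ s, x k ∈ S k} := by
      have : {x : κ → α | ∀ k ∈ s, x k ∈ S k} = ⋂ k ∈ s, (fun x => x k) ⁻¹' S k := by
        ext; simp
      rw [this]
      exact s.measurableSet_biInter fun k hk => measurable_pi_apply k (hST k hk).1
    have hV : MeasurableSet {x : κ → β | ∀ k ∈ s, x k ∈ T k} := by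
      have : {x : κ → β | ∀ k ∈ s, x k ∈ T k} = ⋂ k ∈ s, (fun x => x k) ⁻¹' T k := by
        ext; simp
      rw [this]
      exact s.measurableSet_biInter fun k hk => measurable_pi_apply k (hST k hk).2.1
    have h2 := hAB.measure_inter_preimage_eq_mul _ _ hU hV
    have h3 : (fun ω k => A k ω) ⁻¹' {x : κ → α | ∀ k ∈ s, x k ∈ S k} =
        ⋂ k ∈ s, A k ⁻¹' S k := by ext; simp
    have h4 : (fun ω k => B k ω) ⁻¹' {x : κ → β | ∀ k ∈ s, x k ∈ T k} =
        ⋂ k ∈ s, B k ⁻¹' T k := by ext; simp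
    rw [h3, h4] at h2
    rw [h1, h2, hiA.measure_inter_preimage_eq_mul s fun k hk => (hST k hk).1,
      hiB.measure_inter_preimage_eq_mul s fun k hk => (hST k hk).2.1, ← Finset.prod_mul_distrib]
    refine Finset.prod_congr rfl fun k hk => ?_
    have h5 : IndepFun (A k) (B k) P :=
      hAB.comp (measurable_pi_apply k) (measurable_pi_apply k)
    rw [← (hST k hk).2.2, h5.measure_inter_preimage_eq_mul _ _ (hST k hk).1 (hST k hk).2.1]
  refine iIndepSets.iIndep (m := fun k => MeasurableSpace.comap (fun ω => (A k ω, B k ω))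
    inferInstance) (fun k => ((hA k).prodMk (hB k)).comap_le) π ?_ ?_ hπ
  · intro k
    rintro _ ⟨S, T, hS, hT, rfl⟩ _ ⟨S', T', hS', hT', rfl⟩ _
    exact ⟨S ∩ S', T ∩ T', hS.inter hS', hT.inter hT', by
      rw [Set.preimage_inter, Set.preimage_inter, Set.inter_inter_inter_comm]⟩
  · intro k
    rw [← generateFrom_prod, MeasurableSpace.comap_generateFrom]
    congr 1
    ext E
    constructor
    · rintro ⟨_, ⟨S, hS, T, hT, rfl⟩, rfl⟩
      exact ⟨S, T, hS, hT, rfl⟩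
    · rintro ⟨S, T, hS, hT, rfl⟩
      exact ⟨_, ⟨S, hS, T, hT, rfl⟩, rfl⟩

/-- Functions of disjoint subfamilies of an independent family are independent. -/
theorem indepFun_of_disjoint {κ α β γ : Type*} [MeasurableSpace α]
    [MeasurableSpace β] [MeasurableSpace γ] {Z : κ → Ω → α} (hZ : ∀ k, Measurable (Z k))
    (hind : iIndepFun Z P) {S T : Set κ} (hST : Disjoint S T) {f : Ω → β} {g : Ω → γ}
    (hf : Measurable[⨆ k ∈ S, MeasurableSpace.comap (Z k) inferInstance] f)
    (hg : Measurable[⨆ k ∈ T, MeasurableSpace.comap (Z k) inferInstance] g) : IndepFun f g P := by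
  have h := indep_iSup_of_disjoint (fun k => (hZ k).comap_le) hind hST
  exact indep_of_indep_of_le_left (indep_of_indep_of_le_right h hg.comap_le) hf.comap_le

/-! ### Laplace transforms of thinned exponential variables. -/

theorem lintegral_expMeasure_one {f : ℝ → ℝ≥0∞} (hf : Measurable f) :
    ∫⁻ h, f h ∂expMeasure 1 = ∫⁻ h in Set.Ioi 0, ENNReal.ofReal (Real.exp (-h)) * f h := by
  have hm : Measurable (exponentialPDF 1) := (measurable_exponentialPDFReal 1).ennreal_ofReal
  have hmeq : expMeasure 1 = volume.withDensity (exponentialPDF 1) := rfl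
  rw [hmeq, lintegral_withDensity_eq_lintegral_mul _ hm hf, ← lintegral_indicator measurableSet_Ioi]
  refine lintegral_congr_ae ?_
  filter_upwards [Measure.ae_ne volume (0 : ℝ)] with h h0
  rw [Pi.mul_apply, exponentialPDF_eq]
  by_cases hpos : 0 < h
  · rw [Set.indicator_of_mem (show h ∈ Set.Ioi 0 from hpos), if_pos hpos.le]
    simp
  · have : ¬ 0 ≤ h := fun h' => hpos (lt_of_le_of_ne h' (Ne.symm h0))
    rw [Set.indicator_of_notMem (show h ∉ Set.Ioi 0 from hpos), if_neg this]
    simp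

theorem isThinnedExp_mark [IsProbabilityMeasure P] {A : Ω → Bool} {H : Ω → ℝ} (hA : Measurable A)
    (hH : Measurable H) (hAH : IndepFun A H P) {q : ℝ}
    (hAq : P.real {ω | A ω = true} = 1 - q) (hlaw : HasLaw H (expMeasure 1) P) (b : ℝ) :
    IsThinnedExp q b (fun ω => if A ω = true then ENNReal.ofReal (b * H ω) else 0) P := by
  intro f hf
  let F : Bool → ℝ → ℝ≥0∞ := fun a h => f (if a = true then ENNReal.ofReal (b * h) else 0)
  have hF : Measurable (Function.uncurry F) := by
    refine measurable_from_prod_countable_right fun a => ?_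
    cases a
    · change Measurable fun _ : ℝ => f 0
      exact measurable_const
    · exact hf.comp (measurable_id.const_mul b).ennreal_ofReal
  have h1 := lintegral_indepFun hA hH hAH hF
  have h2 : ∀ a, ∫⁻ ω', F a (H ω') ∂P = if a = true then
      ∫⁻ h in Set.Ioi 0, ENNReal.ofReal (Real.exp (-h)) * f (ENNReal.ofReal (b * h)) else f 0 := by
    intro a
    cases a
    · simp [F]
    · have hm : Measurable fun h : ℝ => f (ENNReal.ofReal (b * h)) :=
        hf.comp (measurable_id.const_mul b).ennreal_ofReal
      simp only [if_true, F]
      rw [← lintegral_expMeasure_one hm, ← hlaw.map_eq, lintegral_map hm hH]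
  have hms : MeasurableSet {ω | A ω = true} := hA (measurableSet_singleton true)
  have hP : P {ω | A ω = true} = ENNReal.ofReal (1 - q) := by
    rw [← hAq, ofReal_measureReal]
  have hPc : P {ω | A ω = true}ᶜ = ENNReal.ofReal q := by
    have : P.real {ω | A ω = true}ᶜ = q := by
      rw [probReal_compl_eq_one_sub hms, hAq]; ring
    rw [← this, ofReal_measureReal]
  change ∫⁻ ω, F (A ω) (H ω) ∂P = _
  rw [h1]
  simp_rw [h2]
  have h3 : ∀ c₁ c₂ : ℝ≥0∞, ∫⁻ ω, (if A ω = true then c₁ else c₂) ∂P =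
      c₁ * P {ω | A ω = true} + c₂ * P {ω | A ω = true}ᶜ := fun c₁ c₂ => by
    have e₁ : ∫⁻ ω in {ω | A ω = true}, (if A ω = true then c₁ else c₂) ∂P =
        ∫⁻ _ in {ω | A ω = true}, c₁ ∂P :=
      setLIntegral_congr_fun hms fun ω (hω : A ω = true) => if_pos hω
    have e₂ : ∫⁻ ω in {ω | A ω = true}ᶜ, (if A ω = true then c₁ else c₂) ∂P =
        ∫⁻ _ in {ω | A ω = true}ᶜ, c₂ ∂P :=
      setLIntegral_congr_fun hms.compl fun ω (hω : ¬ A ω = true) => if_neg hω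
    rw [← lintegral_add_compl _ hms, e₁, e₂, setLIntegral_const, setLIntegral_const]
  rw [h3, hP, hPc, add_comm, mul_comm (f 0), mul_comm _ (ENNReal.ofReal (1 - q))]

/-- The mixture q + (1 - q)/(1 + s b), written as one minus a small term to suit the generating
functional. -/
theorem IsThinnedExp.laplace {q b s : ℝ} {R : Ω → ℝ≥0∞} (h : IsThinnedExp q b R P)
    (hq : q ∈ Set.Ico (0 : ℝ) 1) (hb : 0 ≤ b) (hs : 0 ≤ s) :
    ∫⁻ ω, expNeg (ENNReal.ofReal s * R ω) ∂P =
      ENNReal.ofReal (1 - (1 - q) * (s * b / (1 + s * b))) := by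
  have hm : Measurable fun r => expNeg (ENNReal.ofReal s * r) :=
    measurable_expNeg.comp (measurable_id.const_mul _)
  have hsb : 0 < 1 + s * b := by positivity
  have hq1 : 0 ≤ 1 - q := sub_nonneg.2 hq.2.le
  have h3 := lintegral_rpow_mul_exp one_pos hsb
  simp only [sub_self, Real.rpow_zero, one_mul, Real.rpow_one, Real.Gamma_one, mul_one] at h3
  have h4 : ∀ u ∈ Set.Ioi (0 : ℝ), ENNReal.ofReal (Real.exp (-u)) *
      expNeg (ENNReal.ofReal s * ENNReal.ofReal (b * u)) =
      ENNReal.ofReal (Real.exp (-((1 + s * b) * u))) := fun u hu => by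
    have hu0 : 0 < u := hu
    rw [← ENNReal.ofReal_mul hs, expNeg_ofReal (by positivity),
      ← ENNReal.ofReal_mul (Real.exp_nonneg _), ← Real.exp_add]
    ring_nf
  rw [h _ hm, mul_zero, expNeg_zero, mul_one, setLIntegral_congr_fun measurableSet_Ioi h4, h3,
    ← ENNReal.ofReal_mul hq1, ← ENNReal.ofReal_add hq.1 (by positivity)]
  congr 1
  field_simp
  ring

/-- Exponent of the Laplace transform of a thinned exponential variable, as a function of the
scaled distance. -/
noncomputable def laplaceExponent (q x : ℝ) : ℝ≥0∞ :=
  negLog (ENNReal.ofReal (1 - (1 - q) * (x / (1 + x))))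

theorem expNeg_laplaceExponent {q x : ℝ} (hq : q ∈ Set.Ico (0 : ℝ) 1) (hx : 0 ≤ x) :
    expNeg (laplaceExponent q x) = ENNReal.ofReal (1 - (1 - q) * (x / (1 + x))) := by
  refine expNeg_negLog ?_
  have hq1 : 0 ≤ 1 - q := sub_nonneg.2 hq.2.le
  rw [← ENNReal.ofReal_one]
  exact ENNReal.ofReal_le_ofReal (by have : 0 ≤ (1 - q) * (x / (1 + x)) := by positivity
                                     linarith)

/-- This is the integrand of the generating functional; random activity enters only as the factor 1
- q, that is, as a thinning of the intensity. -/
theorem one_sub_expNeg_laplaceExponent {q x : ℝ} (hq : q ∈ Set.Ico (0 : ℝ) 1) (hx : 0 ≤ x) :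
    1 - expNeg (laplaceExponent q x) = ENNReal.ofReal (1 - q) * ENNReal.ofReal (x / (1 + x)) := by
  have hq1 : 0 ≤ 1 - q := sub_nonneg.2 hq.2.le
  have h1 : x / (1 + x) ≤ 1 := by rw [div_le_one (by positivity)]; linarith
  have h2 : 0 ≤ x / (1 + x) := by positivity
  rw [expNeg_laplaceExponent hq hx, ← ENNReal.ofReal_one, ← ENNReal.ofReal_sub _ ?_,
    ← ENNReal.ofReal_mul hq1]
  · congr 1; ring
  · nlinarith [hq.1]

theorem measurable_laplaceExponent (q : ℝ) : Measurable (laplaceExponent q) :=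
  continuous_negLog.measurable.comp (by fun_prop)

/-- Together with continuity in the scale, this is what `lintegral_expNeg_tsum_beyond` asks of its
function. -/
theorem laplaceExponent_mono {q : ℝ} (hq : q ∈ Set.Ico (0 : ℝ) 1) {x y : ℝ} (hx : 0 ≤ x)
    (hxy : x ≤ y) : laplaceExponent q x ≤ laplaceExponent q y := by
  refine negLog_antitone (ENNReal.ofReal_le_ofReal ?_)
  have hq1 : 0 ≤ 1 - q := sub_nonneg.2 hq.2.le
  have : x / (1 + x) ≤ y / (1 + y) := by
    rw [div_le_div_iff₀ (by linarith) (by linarith)]; nlinarith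
  nlinarith

theorem continuous_laplaceExponent_mul (q : ℝ) {c : ℝ} (hc : 0 ≤ c) :
    Continuous fun s : NNReal => laplaceExponent q (s * c) := by
  refine continuous_negLog.comp (ENNReal.continuous_ofReal.comp ?_)
  refine continuous_const.sub (continuous_const.mul (Continuous.div (by fun_prop) (by fun_prop) ?_))
  intro s
  have : (0 : ℝ) ≤ s * c := by positivity
  linarith

/-- The probability that a sum of independent thinned exponential variables exceeds a multiple of
an independent random variable. -/
theorem measure_lt_div_sum_thinnedExp [IsProbabilityMeasure P] {ι : Type*} [DecidableEq ι] {q : ℝ}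
    (hq : q ∈ Set.Ico (0 : ℝ) 1) {a : ι → ℝ} {R : ι → Ω → ℝ≥0∞} (hR : ∀ i, Measurable (R i))
    (hind : iIndepFun R P) (s : Finset ι) (ha : ∀ i ∈ s, 0 < a i) (hinj : Set.InjOn a s)
    (hlaw : ∀ i ∈ s, IsThinnedExp q (a i)⁻¹ (R i) P) {Y : Ω → ℝ≥0∞} (hY : Measurable Y)
    (hRY : IndepFun (fun ω => ∑ i ∈ s, R i ω) Y P) (hYfin : ∀ᵐ ω ∂P, Y ω ≠ ∞)
    {θ c : ℝ} (hθ : 0 ≤ θ) (hc : 0 ≤ c) :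
    P {ω | ENNReal.ofReal θ < (∑ i ∈ s, R i ω) / (Y ω + ENNReal.ofReal c)} =
      ∫⁻ ω, ENNReal.ofReal (∑ j ∈ s, tailCoeff q a s j * Real.exp (-(a j * θ * c)) *
        (expNeg (ENNReal.ofReal (a j * θ) * Y ω)).toReal) ∂P := by
  have hSm : Measurable fun ω => ∑ i ∈ s, R i ω := Finset.measurable_fun_sum s fun i _ => hR i
  let F : ℝ≥0∞ → ℝ≥0∞ → ℝ≥0∞ := fun y t =>
    if ENNReal.ofReal θ < t / (y + ENNReal.ofReal c) then 1 else 0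
  have hF : Measurable (Function.uncurry F) :=
    Measurable.ite (measurableSet_lt measurable_const
      (measurable_snd.div (measurable_fst.add measurable_const))) measurable_const measurable_const
  have hms : ∀ y, MeasurableSet {ω | ENNReal.ofReal θ <
      (∑ i ∈ s, R i ω) / (y + ENNReal.ofReal c)} := fun y =>
    measurableSet_lt measurable_const (hSm.div measurable_const)
  have h0 : P {ω | ENNReal.ofReal θ < (∑ i ∈ s, R i ω) / (Y ω + ENNReal.ofReal c)} =
      ∫⁻ ω, F (Y ω) (∑ i ∈ s, R i ω) ∂P := by
    have hms' : MeasurableSet {ω | ENNReal.ofReal θ <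
        (∑ i ∈ s, R i ω) / (Y ω + ENNReal.ofReal c)} :=
      measurableSet_lt measurable_const (hSm.div (hY.add measurable_const))
    rw [← lintegral_indicator_one hms']
    refine lintegral_congr fun ω => ?_
    simp only [Set.indicator_apply, Set.mem_ofPred_eq, F, Pi.one_apply]
  rw [h0, lintegral_indepFun hY hSm hRY.symm hF]
  refine lintegral_congr_ae ?_
  filter_upwards [hYfin] with ω hω
  have h1 : ∫⁻ ω', F (Y ω) (∑ i ∈ s, R i ω') ∂P = P {ω' | ENNReal.ofReal θ <
      (∑ i ∈ s, R i ω') / (Y ω + ENNReal.ofReal c)} := by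
    rw [← lintegral_indicator_one (hms _)]
    refine lintegral_congr fun ω' => ?_
    simp only [Set.indicator_apply, Set.mem_ofPred_eq, F, Pi.one_apply]
  have hx : 0 ≤ θ * ((Y ω).toReal + c) := by positivity
  -- The equivalence survives a zero denominator: t/0 is ∞ for t > 0 and 0/0 = 0, so both sides say
  -- t > 0. Finiteness of `Y` keeps `toReal` from returning its default value.
  have h2 : {ω' | ENNReal.ofReal θ < (∑ i ∈ s, R i ω') / (Y ω + ENNReal.ofReal c)} =
      {ω' | ENNReal.ofReal (θ * ((Y ω).toReal + c)) < ∑ i ∈ s, R i ω'} := by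
    ext ω'
    simp only [Set.mem_ofPred_eq]
    rw [ENNReal.lt_div_iff_mul_lt (Or.inr ENNReal.ofReal_ne_top) (Or.inl (by simp [hω])),
      ENNReal.ofReal_mul hθ, ENNReal.ofReal_add ENNReal.toReal_nonneg hc, ENNReal.ofReal_toReal hω]
  rw [h1, h2, ← ofReal_measureReal, measureReal_lt_sum_thinnedExp hq hR hind s ha hinj hlaw hx]
  congr 1
  refine Finset.sum_congr rfl fun j hj => ?_
  have haj := ha j hj
  rw [mul_assoc]
  congr 1
  conv_rhs => rw [← ENNReal.ofReal_toReal hω, ← ENNReal.ofReal_mul (by positivity),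
    expNeg_ofReal (by positivity), ENNReal.toReal_ofReal (Real.exp_nonneg _), ← Real.exp_add]
  congr 1
  ring

end CoopNetwork

namespace CoopNetwork

open Filter Topology

/-! ### Interference -/

namespace Params

variable (N : Params)

/-- One minus the transmission probability of the interferers of each tier. -/
def interfQ : Fin (N.M + 1) → ℝ := Fin.cons N.qOut N.qTier

/-- Normalized transmit powers of all tiers. -/
def txPower : Fin (N.M + 1) → ℝ := Fin.cons 1 N.power

/-- The index of the first interferer of each tier. -/
def offset : Fin (N.M + 1) → ℕ := Fin.cons N.K fun _ => 0

theorem interfQ_mem (t : Fin (N.M + 1)) : N.interfQ t ∈ Set.Ico (0 : ℝ) 1 := by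
  refine Fin.cases ?_ (fun m => ?_) t
  · exact N.qOut_mem
  · exact N.qTier_mem m

theorem txPower_pos (t : Fin (N.M + 1)) : 0 < N.txPower t := by
  refine Fin.cases ?_ (fun m => ?_) t
  · exact one_pos
  · exact N.power_pos m

/-- The index of the `i`-th interferer of tier `t`. -/
def interferer (k : Fin (N.M + 1) × ℕ) : Fin (N.M + 1) × ℕ := (k.1, N.offset k.1 + k.2)

theorem interferer_injective : Function.Injective N.interferer := by
  rintro ⟨t, i⟩ ⟨t', i'⟩ h
  simp only [interferer, Prod.mk.injEq] at h
  obtain ⟨rfl, h⟩ := h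
  simpa using h

/-- The product of transmit power and path gain for given node locations. -/
noncomputable def pathPower
    (x : Fin (N.M + 1) → ℕ → Plane) (k : Fin (N.M + 1) × ℕ) : ℝ :=
  N.txPower k.1 * ‖x k.1 k.2‖ ^ (-N.eta)

theorem pathPower_nonneg (x : Fin (N.M + 1) → ℕ → Plane)
    (k : Fin (N.M + 1) × ℕ) : 0 ≤ N.pathPower x k :=
  mul_nonneg (N.txPower_pos _).le (Real.rpow_nonneg (norm_nonneg _) _)

/-- The Laplace transform at `s` of the interference of tier `m + 1`. -/
noncomputable def extrinsic (m : Fin N.M) (s : ℝ) : ℝ :=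
  Real.exp (-Real.pi * (1 - N.qTier m) * N.lam m.succ *
    (s * N.power m) ^ (2 / N.eta) * Real.Gamma (1 + 2 / N.eta) * Real.Gamma (1 - 2 / N.eta))

theorem extrinsic_pos (m : Fin N.M) (s : ℝ) : 0 < N.extrinsic m s :=
  Real.exp_pos _

/-- The Laplace transform at `s` of the interference when the `K`-th transmitter is at
distance `r`. -/
noncomputable def interfLaplace (r s : ℝ) : ℝ :=
  Real.exp (-Real.pi * (1 - N.qOut) * N.lam 0 * r ^ 2 * interfF (s * r ^ (-N.eta)) N.eta) *
    ∏ m, N.extrinsic m s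

theorem extrinsic_le_one (m : Fin N.M) {s : ℝ} (hs : 0 ≤ s) : N.extrinsic m s ≤ 1 := by
  refine Real.exp_le_one_iff.2 ?_
  have hη := N.two_lt_eta
  have hS : 0 ≤ s * N.power m := mul_nonneg hs (N.power_pos m).le
  have hq : 0 ≤ 1 - N.qTier m := sub_nonneg.2 (N.qTier_mem m).2.le
  have hl := (N.lam_pos m.succ).le
  have hG1 : 0 < Real.Gamma (1 + 2 / N.eta) := Real.Gamma_pos_of_pos (by positivity)
  have hG2 : 0 < Real.Gamma (1 - 2 / N.eta) := Real.Gamma_pos_of_pos (by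
    rw [sub_pos, div_lt_one (by linarith)]; exact hη)
  have : 0 ≤ Real.pi * (1 - N.qTier m) * N.lam m.succ * (s * N.power m) ^ (2 / N.eta) *
    Real.Gamma (1 + 2 / N.eta) * Real.Gamma (1 - 2 / N.eta) := by positivity
  linarith

theorem interfLaplace_nonneg (r s : ℝ) : 0 ≤ N.interfLaplace r s :=
  mul_nonneg (Real.exp_nonneg _) (Finset.prod_nonneg fun m _ => (N.extrinsic_pos m s).le)

theorem interfLaplace_le_one {r s : ℝ} (hr : 0 ≤ r) (hs : 0 ≤ s) : N.interfLaplace r s ≤ 1 := by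
  have hI := interfF_nonneg N.two_lt_eta (mul_nonneg hs (Real.rpow_nonneg hr (-N.eta)))
  have hq : 0 ≤ 1 - N.qOut := sub_nonneg.2 N.qOut_mem.2.le
  have hl := (N.lam_pos 0).le
  have : 0 ≤ Real.pi * (1 - N.qOut) * N.lam 0 * r ^ 2 * interfF (s * r ^ (-N.eta)) N.eta := by
    positivity
  exact mul_le_one₀ (Real.exp_le_one_iff.2 (by linarith))
    (Finset.prod_nonneg fun m _ => (N.extrinsic_pos m s).le)
    (Finset.prod_le_one (fun m _ => (N.extrinsic_pos m s).le) fun m _ => N.extrinsic_le_one m hs)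

theorem measurable_interfLaplace {α : Type*} [MeasurableSpace α] {r s : α → ℝ} (hr : Measurable r)
    (hs : Measurable s) (hr0 : ∀ a, 0 ≤ r a) (hs0 : ∀ a, 0 ≤ s a) :
    Measurable fun a => N.interfLaplace (r a) (s a) := by
  -- Continuity of `interfF` is available only for arguments above -1. Clamping at 0 gives a
  -- globally continuous function with the same values here.
  have hc : Continuous fun t => interfF (max t 0) N.eta :=
    continuous_iff_continuousAt.2 fun t =>
      ContinuousAt.comp (g := fun t => interfF t N.eta) (f := fun t => max t 0)
        (continuousAt_interfF N.two_lt_eta (neg_one_lt_zero.trans_le (le_max_right _ _)))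
        (by fun_prop)
  have h1 : Measurable fun a => interfF (s a * r a ^ (-N.eta)) N.eta := by
    have : ∀ a, s a * r a ^ (-N.eta) = max (s a * r a ^ (-N.eta)) 0 := fun a =>
      (max_eq_left (mul_nonneg (hs0 a) (Real.rpow_nonneg (hr0 a) _))).symm
    simp_rw [fun a => congrArg (fun t => interfF t N.eta) (this a)]
    exact hc.measurable.comp (hs.mul (hr.pow_const _))
  unfold interfLaplace extrinsic
  fun_prop

/-- Used to show that the interference is almost surely finite. -/
theorem tendsto_interfLaplace (r : ℝ) : Tendsto (N.interfLaplace r) (𝓝 0) (𝓝 1) := by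
  have hη := N.two_lt_eta
  have h1 : Tendsto (fun s => interfF (s * r ^ (-N.eta)) N.eta) (𝓝 0) (𝓝 0) := by
    have h := (continuousAt_interfF hη (neg_one_lt_zero)).tendsto
    rw [interfF_zero] at h
    refine h.comp ?_
    have : Continuous fun s : ℝ => s * r ^ (-N.eta) := by fun_prop
    simpa using this.tendsto 0
  have h2 : ∀ m, Tendsto (N.extrinsic m) (𝓝 0) (𝓝 1) := by
    intro m
    have : Continuous (N.extrinsic m) := by
      have h3 : Continuous fun s : ℝ => (s * N.power m) ^ (2 / N.eta) :=
        Continuous.rpow_const (by fun_prop) fun s => Or.inr (by positivity)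
      unfold extrinsic
      fun_prop
    have h0 : N.extrinsic m 0 = 1 := by
      rw [extrinsic, zero_mul, Real.zero_rpow (by positivity)]
      simp
    exact h0 ▸ this.tendsto 0
  have h3 := ((Real.continuous_exp.tendsto _).comp (h1.const_mul
    (-Real.pi * (1 - N.qOut) * N.lam 0 * r ^ 2))).mul
      (tendsto_finsetProd Finset.univ fun m _ => h2 m)
  simp only [mul_zero, Real.exp_zero, Finset.prod_const_one, mul_one] at h3
  exact h3

end Params

/-! ### The Laplace transform of the interference given the cluster geometry. -/

namespace Network

variable {Ω : Type*} [MeasurableSpace Ω] {P : Measure Ω} {N : Params} (W : Network N P)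

/-- The power received from a node for a given value of the product of its transmit power and
path gain. -/
noncomputable def markPower (b : Fin (N.M + 1) × ℕ → ℝ) (k : Fin (N.M + 1) × ℕ) (ω : Ω) : ℝ≥0∞ :=
  if W.active k.1 k.2 ω = true then ENNReal.ofReal (b k * W.gain k.1 k.2 ω) else 0

theorem received_eq_markPower (t : Fin (N.M + 1)) (i : ℕ) (ω : Ω) :
    W.received (N.txPower t) t i ω = W.markPower (N.pathPower fun t i => W.loc t i ω) (t, i) ω :=
  rfl

theorem signal_eq (ω : Ω) :
    W.signal ω = ∑ i : Fin N.K, W.markPower (N.pathPower fun t i => W.loc t i ω) (0, i) ω := by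
  rw [signal, Finset.sum_range]
  rfl

theorem interference_eq (ω : Ω) : W.interference ω =
    ∑' k, W.markPower (N.pathPower fun t i => W.loc t i ω) (N.interferer k) ω := by
  rw [ENNReal.tsum_prod (f := fun t i => W.markPower (N.pathPower fun t i => W.loc t i ω)
    (N.interferer (t, i)) ω), tsum_fintype, Fin.sum_univ_succ, interference]
  congr 1
  refine Finset.sum_congr rfl fun m _ => tsum_congr fun i => ?_
  simp only [Params.interferer, ← received_eq_markPower]
  simp [Params.offset, Params.txPower]

theorem measurable_markPower (b : Fin (N.M + 1) × ℕ → ℝ) (k : Fin (N.M + 1) × ℕ) :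
    Measurable (W.markPower b k) :=
  Measurable.ite (W.active_measurable _ _ (measurableSet_singleton true))
    ((W.gain_measurable _ _).const_mul _).ennreal_ofReal measurable_const

theorem iIndepFun_marks [IsProbabilityMeasure P] :
    iIndepFun (fun (k : Fin (N.M + 1) × ℕ) ω => (W.active k.1 k.2 ω, W.gain k.1 k.2 ω)) P := by
  refine iIndepFun_prodMk (fun k => W.active_measurable _ _) (fun k => W.gain_measurable _ _)
    W.indep_active W.indep_gain ?_
  have h1 : Measurable fun (a : Fin (N.M + 1) → ℕ → Bool) (k : Fin (N.M + 1) × ℕ) => a k.1 k.2 := by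
    fun_prop
  have h2 : Measurable fun (a : Fin (N.M + 1) → ℕ → ℝ) (k : Fin (N.M + 1) × ℕ) => a k.1 k.2 := by
    fun_prop
  exact W.indep_marks.comp h1 h2

theorem iIndepFun_markPower [IsProbabilityMeasure P] (b : Fin (N.M + 1) × ℕ → ℝ) :
    iIndepFun (W.markPower b) P := by
  have h : ∀ k, Measurable fun p : Bool × ℝ =>
      if p.1 = true then ENNReal.ofReal (b k * p.2) else 0 := fun k =>
    Measurable.ite (measurable_fst (measurableSet_singleton true))
      (measurable_snd.const_mul _).ennreal_ofReal measurable_const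
  exact W.iIndepFun_marks.comp _ h

theorem indepFun_active_gain (t : Fin (N.M + 1)) (i : ℕ) :
    IndepFun (W.active t i) (W.gain t i) P := by
  have h1 : Measurable fun a : Fin (N.M + 1) → ℕ → Bool => a t i := by fun_prop
  have h2 : Measurable fun a : Fin (N.M + 1) → ℕ → ℝ => a t i := by fun_prop
  exact W.indep_marks.comp h1 h2

theorem isThinnedExp_markPower_in [IsProbabilityMeasure P] (b : Fin (N.M + 1) × ℕ → ℝ)
    (i : Fin N.K) : IsThinnedExp (N.qIn i) (b (0, i)) (W.markPower b (0, i)) P :=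
  isThinnedExp_mark (W.active_measurable _ _) (W.gain_measurable _ _) (W.indepFun_active_gain _ _)
    (W.active_in i) (W.gain_law _ _) _

theorem isThinnedExp_markPower_interferer [IsProbabilityMeasure P] (b : Fin (N.M + 1) × ℕ → ℝ)
    (k : Fin (N.M + 1) × ℕ) : IsThinnedExp (N.interfQ k.1) (b (N.interferer k))
      (W.markPower b (N.interferer k)) P := by
  refine isThinnedExp_mark (W.active_measurable _ _) (W.gain_measurable _ _)
    (W.indepFun_active_gain _ _) ?_ (W.gain_law _ _) _
  obtain ⟨t, i⟩ := k
  refine Fin.cases ?_ (fun m => ?_) t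
  · exact W.active_out _ (Nat.le_add_right _ _)
  · exact W.active_tier m _

/-- For frozen locations the interference is one countable sum of independent thinned exponentials.
`laplaceExponent` keeps the infinite product of their transforms in the form of a sum over points.
-/
theorem lintegral_expNeg_markPower [IsProbabilityMeasure P] {b : Fin (N.M + 1) × ℕ → ℝ}
    (hb : ∀ k, 0 ≤ b k) (s : NNReal) :
    ∫⁻ ω, expNeg (s * ∑' k, W.markPower b (N.interferer k) ω) ∂P =
      expNeg (∑' k : Fin (N.M + 1) × ℕ,
        laplaceExponent (N.interfQ k.1) (s * b (N.interferer k))) := by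
  simp_rw [← ENNReal.tsum_mul_left]
  refine lintegral_expNeg_tsum (fun k => (W.measurable_markPower b _).const_mul _) ?_ fun k => ?_
  · exact ((W.iIndepFun_markPower b).precomp N.interferer_injective).comp
      (fun _ r => (s : ℝ≥0∞) * r) fun _ => measurable_id.const_mul _
  · have h := (W.isThinnedExp_markPower_interferer b k).laplace (N.interfQ_mem _) (hb _)
      s.coe_nonneg
    rw [ENNReal.ofReal_coe_nnreal] at h
    rw [h, expNeg_laplaceExponent (N.interfQ_mem _) (mul_nonneg s.coe_nonneg (hb _))]

theorem measurable_loc : Measurable fun ω t i => W.loc t i ω :=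
  measurable_pi_lambda _ fun t => measurable_pi_lambda _ fun i => (W.ppp t).measurable i

theorem measurable_dist : Measurable W.dist :=
  measurable_pi_lambda _ fun i => ((W.ppp 0).measurable i).norm

/-- Averaging over the activity indicators and channel gains. -/
theorem lintegral_expNeg_interference_marks [IsProbabilityMeasure P] {s : (Fin N.K → ℝ) → NNReal}
    (hs : Measurable s) {φ : (Fin N.K → ℝ) → ℝ≥0∞} (hφ : Measurable φ) :
    ∫⁻ ω, φ (W.dist ω) * expNeg (s (W.dist ω) * W.interference ω) ∂P =
      ∫⁻ ω, φ (W.dist ω) * expNeg (∑' k : Fin (N.M + 1) × ℕ, laplaceExponent (N.interfQ k.1)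
        (s (W.dist ω) * N.pathPower (fun t i => W.loc t i ω) (N.interferer k))) ∂P := by
  let δ : (Fin (N.M + 1) → ℕ → Plane) → Fin N.K → ℝ := fun x i => ‖x 0 i‖
  have hδ : Measurable δ := measurable_pi_lambda _ fun i => Measurable.norm (by fun_prop)
  let F : (Fin (N.M + 1) → ℕ → Plane) → (Fin (N.M + 1) → ℕ → Bool) × (Fin (N.M + 1) → ℕ → ℝ) →
      ℝ≥0∞ := fun x m => φ (δ x) * expNeg (s (δ x) * ∑' k : Fin (N.M + 1) × ℕ,
    if m.1 (N.interferer k).1 (N.interferer k).2 = true then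
      ENNReal.ofReal (N.pathPower x (N.interferer k) *
        m.2 (N.interferer k).1 (N.interferer k).2) else 0)
  have hF : Measurable (Function.uncurry F) := by
    refine ((hφ.comp hδ).comp measurable_fst).mul (measurable_expNeg.comp
      ((((hs.comp hδ).comp measurable_fst).coe_nnreal_ennreal).mul (Measurable.tsum fun k =>
        Measurable.ite ?_ (Measurable.ennreal_ofReal ?_) measurable_const)))
    · have : Measurable fun p : (Fin (N.M + 1) → ℕ → Plane) × (Fin (N.M + 1) → ℕ → Bool) ×
          (Fin (N.M + 1) → ℕ → ℝ) => p.2.1 (N.interferer k).1 (N.interferer k).2 := by fun_prop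
      exact this (measurableSet_singleton true)
    · unfold Params.pathPower
      fun_prop
  have hM : Measurable fun ω => (fun t i => W.active t i ω, fun t i => W.gain t i ω) :=
    (measurable_pi_lambda _ fun t => measurable_pi_lambda _ fun i => W.active_measurable t i).prodMk
      (measurable_pi_lambda _ fun t => measurable_pi_lambda _ fun i => W.gain_measurable t i)
  have h := lintegral_indepFun W.measurable_loc hM W.indep_loc_marks hF
  have h1 : ∀ ω, φ (W.dist ω) * expNeg (s (W.dist ω) * W.interference ω) =
      F (fun t i => W.loc t i ω) (fun t i => W.active t i ω, fun t i => W.gain t i ω) := fun ω => by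
    rw [interference_eq]
    rfl
  simp_rw [h1]
  rw [h]
  refine lintegral_congr fun ω => ?_
  rw [← W.lintegral_expNeg_markPower (N.pathPower_nonneg _), ← lintegral_const_mul]
  · rfl
  · exact measurable_expNeg.comp ((Measurable.tsum fun k => W.measurable_markPower _ _).const_mul _)

theorem measurable_laplaceExponent_pathLoss (q c : ℝ) :
    Measurable fun x : Plane => laplaceExponent q (c * ‖x‖ ^ (-N.eta)) :=
  (measurable_laplaceExponent q).comp (by fun_prop)

theorem lintegral_expNeg_extrinsic [IsProbabilityMeasure P] (m : Fin N.M) {s : ℝ} (hs : 0 ≤ s) :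
    ∫⁻ ω, expNeg (∑' i, laplaceExponent (N.qTier m)
      (s * N.power m * ‖W.loc m.succ i ω‖ ^ (-N.eta))) ∂P = ENNReal.ofReal (N.extrinsic m s) := by
  have hη := N.two_lt_eta
  have hS : 0 ≤ s * N.power m := mul_nonneg hs (N.power_pos m).le
  have hq : 0 ≤ 1 - N.qTier m := sub_nonneg.2 (N.qTier_mem m).2.le
  have hl := (N.lam_pos m.succ).le
  have hG1 : 0 < Real.Gamma (1 + 2 / N.eta) := Real.Gamma_pos_of_pos (by positivity)
  have hG2 : 0 < Real.Gamma (1 - 2 / N.eta) := Real.Gamma_pos_of_pos (by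
    rw [sub_pos, div_lt_one (by linarith)]; exact hη)
  rw [(W.ppp m.succ).lintegral_expNeg_tsum
    (measurable_laplaceExponent_pathLoss (N := N) (N.qTier m) (s * N.power m))]
  simp_rw [fun x : Plane => one_sub_expNeg_laplaceExponent (N.qTier_mem m)
    (mul_nonneg hS (Real.rpow_nonneg (norm_nonneg x) (-N.eta)))]
  rw [lintegral_const_mul _ (by fun_prop), lintegral_interf hη hS, ← ENNReal.ofReal_mul hq,
    ← ENNReal.ofReal_mul hl, expNeg_ofReal (by positivity), Params.extrinsic]
  congr 2
  ring

theorem lintegral_expNeg_extrinsic_prod [IsProbabilityMeasure P] {s : ℝ} (hs : 0 ≤ s) :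
    ∫⁻ ω, ∏ m : Fin N.M, expNeg (∑' i, laplaceExponent (N.qTier m)
      (s * N.power m * ‖W.loc m.succ i ω‖ ^ (-N.eta))) ∂P =
        ∏ m, ENNReal.ofReal (N.extrinsic m s) := by
  have hm : ∀ m : Fin N.M, Measurable fun x : ℕ → Plane => expNeg (∑' i, laplaceExponent (N.qTier m)
      (s * N.power m * ‖x i‖ ^ (-N.eta))) := fun m =>
    measurable_expNeg.comp (Measurable.tsum fun i =>
      (measurable_laplaceExponent_pathLoss (N := N) (N.qTier m) (s * N.power m)).comp
        (measurable_pi_apply i))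
  have hind : iIndepFun (fun (m : Fin N.M) ω => expNeg (∑' i, laplaceExponent (N.qTier m)
      (s * N.power m * ‖W.loc m.succ i ω‖ ^ (-N.eta)))) P :=
    (W.indep_loc.precomp (Fin.succ_injective _)).comp _ hm
  rw [lintegral_prod_eq_prod_lintegral_of_indepFun _ _ hind]
  · exact Finset.prod_congr rfl fun m _ => W.lintegral_expNeg_extrinsic m hs
  · exact fun m => (hm m).comp (measurable_pi_lambda _ fun i => (W.ppp m.succ).measurable i)

theorem ae_dist_pos [IsProbabilityMeasure P] : ∀ᵐ ω ∂P, ∀ i, 0 < W.dist ω i := by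
  have h0 : volume ({0} : Set Plane) = 0 := measure_singleton 0
  filter_upwards [(W.ppp 0).ae_notMem_of_null (measurableSet_singleton 0) h0] with ω hω i
  exact norm_pos_iff.2 fun h => hω _ h

/-- The conditional Laplace transform of the interference given the cluster geometry. -/
theorem lintegral_expNeg_interference [IsProbabilityMeasure P] {s : (Fin N.K → ℝ) → NNReal}
    (hs : Measurable s) {φ : (Fin N.K → ℝ) → ℝ≥0∞} (hφ : Measurable φ) (hφ1 : ∀ d, φ d ≤ 1) :
    ∫⁻ ω, φ (W.dist ω) * expNeg (s (W.dist ω) * W.interference ω) ∂P =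
      ∫⁻ ω, φ (W.dist ω) *
        ENNReal.ofReal (N.interfLaplace (W.dist ω N.last) (s (W.dist ω))) ∂P := by
  have hη := N.two_lt_eta
  let δ : (ℕ → Plane) → Fin N.K → ℝ := fun x i => ‖x i‖
  have hδ : Measurable δ := measurable_pi_lambda _ fun i => Measurable.norm (by fun_prop)
  have hsδ : Measurable fun x => (s (δ x) : ℝ) := (hs.comp hδ).coe_nnreal_real
  have hd : Measurable W.dist := W.measurable_dist
  let F : (ℕ → Plane) → (Fin N.M → ℕ → Plane) → ℝ≥0∞ := fun x y =>
    φ (δ x) * expNeg (∑' i, laplaceExponent N.qOut (s (δ x) * ‖x (N.K + i)‖ ^ (-N.eta))) *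
      ∏ m, expNeg (∑' i, laplaceExponent (N.qTier m)
        (s (δ x) * N.power m * ‖y m i‖ ^ (-N.eta)))
  have hF0 : Measurable fun x => φ (δ x) *
      expNeg (∑' i, laplaceExponent N.qOut (s (δ x) * ‖x (N.K + i)‖ ^ (-N.eta))) := by
    refine (hφ.comp hδ).mul (measurable_expNeg.comp (Measurable.tsum fun i => ?_))
    exact (measurable_laplaceExponent _).comp (hsδ.mul (by fun_prop))
  have hF : Measurable (Function.uncurry F) := by
    refine (hF0.comp measurable_fst).mul (Finset.measurable_fun_prod _ fun m _ =>
      measurable_expNeg.comp (Measurable.tsum fun i => (measurable_laplaceExponent _).comp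
        (((hsδ.comp measurable_fst).mul_const _).mul ?_)))
    fun_prop
  have hX : Measurable fun ω i => W.loc 0 i ω :=
    measurable_pi_lambda _ fun i => (W.ppp 0).measurable i
  have hY : Measurable fun ω (m : Fin N.M) i => W.loc m.succ i ω :=
    measurable_pi_lambda _ fun m => measurable_pi_lambda _ fun i => (W.ppp m.succ).measurable i
  have hXY : IndepFun (fun ω i => W.loc 0 i ω) (fun ω (m : Fin N.M) i => W.loc m.succ i ω) P := by
    refine indepFun_of_disjoint (Z := fun t ω i => W.loc t i ω)
      (fun t => measurable_pi_lambda _ fun i => (W.ppp t).measurable i) W.indep_loc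
      (S := {0}) (T := Set.range Fin.succ) ?_ ?_ ?_
    · rw [Set.disjoint_singleton_left]
      rintro ⟨m, hm⟩
      exact Fin.succ_ne_zero m hm
    · refine Measurable.mono (comap_measurable _) ?_ le_rfl
      exact le_iSup₂_of_le (f := fun t (_ : t ∈ ({0} : Set (Fin (N.M + 1)))) =>
        MeasurableSpace.comap (fun ω i => W.loc t i ω) inferInstance) 0 rfl le_rfl
    · refine @measurable_pi_lambda _ _ _ (_) _ _ fun m => ?_
      refine Measurable.mono (comap_measurable _) ?_ le_rfl
      exact le_iSup₂_of_le (f := fun t (_ : t ∈ Set.range (Fin.succ : Fin N.M → Fin (N.M + 1))) =>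
        MeasurableSpace.comap (fun ω i => W.loc t i ω) inferInstance) m.succ ⟨m, rfl⟩ le_rfl
  rw [W.lintegral_expNeg_interference_marks hs hφ]
  have h1 : ∀ ω, φ (W.dist ω) * expNeg (∑' k : Fin (N.M + 1) × ℕ,
      laplaceExponent (N.interfQ k.1)
        (s (W.dist ω) * N.pathPower (fun t i => W.loc t i ω) (N.interferer k))) =
      F (fun i => W.loc 0 i ω) (fun m i => W.loc m.succ i ω) := by
    intro ω
    rw [ENNReal.tsum_prod (f := fun t i => laplaceExponent (N.interfQ t)
        (s (W.dist ω) * N.pathPower (fun t i => W.loc t i ω) (N.interferer (t, i)))),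
      tsum_fintype, Fin.sum_univ_succ, expNeg_add, expNeg_sum, ← mul_assoc]
    simp only [Params.interferer, Params.pathPower, Params.offset, Params.interfQ, Params.txPower,
      Fin.cons_zero, Fin.cons_succ, one_mul, zero_add, mul_assoc, F]
    rfl
  simp_rw [h1]
  rw [lintegral_indepFun hX hY hXY hF]
  -- The other tiers are integrated out with the transmitter tier frozen. Their transform depends on
  -- it only through the cluster distances, so it can be absorbed into the test function.
  have h2 : ∀ ω, ∫⁻ ω', F (fun i => W.loc 0 i ω) (fun m i => W.loc m.succ i ω') ∂P =
      (φ (W.dist ω) * ∏ m, ENNReal.ofReal (N.extrinsic m (s (W.dist ω)))) *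
        expNeg (∑' i, laplaceExponent N.qOut
          (s (W.dist ω) * ‖W.loc 0 (N.K + i) ω‖ ^ (-N.eta))) := by
    intro ω
    rw [← W.lintegral_expNeg_extrinsic_prod (s (W.dist ω)).coe_nonneg, mul_right_comm,
      ← lintegral_const_mul]
    · rfl
    · refine Finset.measurable_fun_prod _ fun m _ =>
        measurable_expNeg.comp (Measurable.tsum fun i => ?_)
      exact (measurable_laplaceExponent_pathLoss (N := N) (N.qTier m) _).comp
        ((W.ppp m.succ).measurable i)
  simp_rw [h2]
  have hE : Measurable fun d => ∏ m, ENNReal.ofReal (N.extrinsic m (s d)) := by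
    have := hs.coe_nnreal_real
    unfold Params.extrinsic
    fun_prop
  have hE1 : ∀ d, ∏ m, ENNReal.ofReal (N.extrinsic m (s d)) ≤ 1 := fun d =>
    Finset.prod_le_one' fun m _ =>
      ENNReal.ofReal_le_one.2 (N.extrinsic_le_one m (s d).coe_nonneg)
  have h3 := (W.ppp 0).lintegral_expNeg_tsum_beyond (N.lam_pos 0).le W.sorted N.last
    (Nat.sub_add_cancel N.K_pos) hs
    (g := fun a x => laplaceExponent N.qOut (a * ‖x‖ ^ (-N.eta)))
    (fun a => measurable_laplaceExponent_pathLoss N.qOut a)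
    (fun a a' haa x => laplaceExponent_mono N.qOut_mem (by positivity)
      (mul_le_mul_of_nonneg_right (NNReal.coe_le_coe.2 haa) (by positivity)))
    (fun x => continuous_laplaceExponent_mul N.qOut (by positivity))
    (hφ.mul hE) (fun d => mul_le_one' (hφ1 d) (hE1 d))
  refine h3.trans (lintegral_congr_ae ?_)
  filter_upwards [W.ae_dist_pos] with ω hpos
  have hω := hpos N.last
  change φ (W.dist ω) * (∏ m, ENNReal.ofReal (N.extrinsic m (s (W.dist ω)))) *
    expNeg (ENNReal.ofReal (N.lam 0) * ∫⁻ x in (Metric.closedBall 0 (W.dist ω N.last))ᶜ,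
      (1 - expNeg (laplaceExponent N.qOut (s (W.dist ω) * ‖x‖ ^ (-N.eta))))) = _
  have hS : 0 ≤ (s (W.dist ω) : ℝ) := (s (W.dist ω)).coe_nonneg
  have hq : 0 ≤ 1 - N.qOut := sub_nonneg.2 N.qOut_mem.2.le
  have hl := (N.lam_pos 0).le
  simp_rw [fun x : Plane => one_sub_expNeg_laplaceExponent N.qOut_mem
    (mul_nonneg hS (Real.rpow_nonneg (norm_nonneg x) (-N.eta)))]
  have hI : 0 ≤ interfF (s (W.dist ω) * W.dist ω N.last ^ (-N.eta)) N.eta :=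
    interfF_nonneg hη (mul_nonneg hS (by positivity))
  rw [lintegral_const_mul _ (by fun_prop), lintegral_compl_closedBall_interf hη hS hω,
    ← ENNReal.ofReal_mul hq, ← ENNReal.ofReal_mul hl, expNeg_ofReal (by positivity), mul_assoc,
    Params.interfLaplace, mul_comm (Real.exp _), ENNReal.ofReal_mul
      (Finset.prod_nonneg fun m _ => (N.extrinsic_pos m _).le),
    ENNReal.ofReal_prod_of_nonneg fun m _ => (N.extrinsic_pos m _).le]
  congr 4
  ring

end Network

end CoopNetwork

namespace CoopNetwork

open Filter Topology

/-! ### The conditional distribution of the signal-to-interference-plus-noise ratio -/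

/-- Node locations. -/
abbrev Params.Locations (N : Params) : Type := Fin (N.M + 1) → ℕ → Plane

/-- Activity indicators and channel power gains. -/
abbrev Params.Marks (N : Params) : Type :=
  (Fin (N.M + 1) → ℕ → Bool) × (Fin (N.M + 1) → ℕ → ℝ)

namespace Params

variable (N : Params)

/-- The power received from a node, as a function of the locations and marks of all nodes. -/
noncomputable def nodePower (x : N.Locations) (m : N.Marks) (k : Fin (N.M + 1) × ℕ) : ℝ≥0∞ :=
  if m.1 k.1 k.2 = true then ENNReal.ofReal (N.pathPower x k * m.2 k.1 k.2) else 0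

theorem measurable_nodePower (k : Fin (N.M + 1) × ℕ) :
    Measurable fun p : N.Locations × N.Marks => N.nodePower p.1 p.2 k := by
  refine Measurable.ite ?_ (Measurable.ennreal_ofReal ?_) measurable_const
  · have : Measurable fun p : N.Locations × N.Marks => p.2.1 k.1 k.2 := by fun_prop
    exact this (measurableSet_singleton true)
  · unfold pathPower
    fun_prop

/-- The interference as a function of the locations and marks of all nodes. -/
noncomputable def totalInterf (x : N.Locations) (m : N.Marks) : ℝ≥0∞ :=
  ∑' k, N.nodePower x m (N.interferer k)

theorem measurable_totalInterf :
    Measurable fun p : N.Locations × N.Marks => N.totalInterf p.1 p.2 :=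
  Measurable.tsum fun _ => N.measurable_nodePower _

end Params

namespace Network

variable {Ω : Type*} [MeasurableSpace Ω] {P : Measure Ω} {N : Params} (W : Network N P)

theorem measurable_received (p : ℝ) (t : Fin (N.M + 1)) (i : ℕ) : Measurable (W.received p t i) :=
  Measurable.ite (W.active_measurable t i (measurableSet_singleton true))
    (((((W.ppp t).measurable i).norm.pow_const _).const_mul p).mul
      (W.gain_measurable t i)).ennreal_ofReal measurable_const

theorem measurable_signal : Measurable W.signal :=
  Finset.measurable_fun_sum _ fun i _ => W.measurable_received 1 0 i

theorem measurable_interference : Measurable W.interference :=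
  (Measurable.tsum fun i => W.measurable_received 1 0 (N.K + i)).add
    (Finset.measurable_fun_sum _ fun m _ =>
      Measurable.tsum fun i => W.measurable_received (N.power m) m.succ i)

theorem measurable_sinr : Measurable W.sinr :=
  W.measurable_signal.div (W.measurable_interference.add measurable_const)

theorem measurable_marks : Measurable fun ω =>
    ((fun t i => W.active t i ω, fun t i => W.gain t i ω) : N.Marks) :=
  (measurable_pi_lambda _ fun t => measurable_pi_lambda _ fun i => W.active_measurable t i).prodMk
    (measurable_pi_lambda _ fun t => measurable_pi_lambda _ fun i => W.gain_measurable t i)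

theorem dist_nonneg (ω : Ω) (i : Fin N.K) : 0 ≤ W.dist ω i := norm_nonneg _

/-- For every s > 0 the variable exp(-s I) vanishes where I = ∞, so its mean is at most P(I < ∞).
Along s = 1/(n + 1) these means tend to 1. -/
theorem ae_interference_ne_top [IsProbabilityMeasure P] : ∀ᵐ ω ∂P, W.interference ω ≠ ∞ := by
  have hms : MeasurableSet {ω | W.interference ω ≠ ∞} :=
    (W.measurable_interference (measurableSet_singleton ∞)).compl
  have hr : Measurable fun ω => W.dist ω N.last := ((W.ppp 0).measurable _).norm
  let u : ℕ → NNReal := fun n => 1 / ((n : NNReal) + 1)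
  have hu : Tendsto (fun n => (u n : ℝ)) atTop (𝓝 0) := by
    simpa [u] using tendsto_one_div_add_atTop_nhds_zero_nat (𝕜 := ℝ)
  have h1 : ∀ n, ∫⁻ ω, ENNReal.ofReal (N.interfLaplace (W.dist ω N.last) (u n)) ∂P ≤
      P {ω | W.interference ω ≠ ∞} := by
    intro n
    have h := W.lintegral_expNeg_interference (s := fun _ => u n) (φ := fun _ => 1)
      measurable_const measurable_const fun _ => le_rfl
    simp only [one_mul] at h
    rw [← h, ← lintegral_indicator_one hms]
    refine lintegral_mono fun ω => ?_
    by_cases hω : W.interference ω = ∞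
    · have hu0 : (u n : ℝ≥0∞) ≠ 0 := by
        simp only [u, ne_eq, ENNReal.coe_eq_zero]
        positivity
      simp only [hω, ENNReal.mul_top hu0, expNeg_top]
      exact zero_le
    · rw [Set.indicator_of_mem (show ω ∈ {ω | W.interference ω ≠ ∞} from hω)]
      exact expNeg_le_one _
  have h2 : Tendsto (fun n => ∫⁻ ω, ENNReal.ofReal (N.interfLaplace (W.dist ω N.last) (u n)) ∂P)
      atTop (𝓝 (∫⁻ _, 1 ∂P)) := by
    refine tendsto_lintegral_of_le_one (fun n => ?_) (fun n ω => ?_)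
      (Eventually.of_forall fun ω => ?_)
    · exact (N.measurable_interfLaplace hr measurable_const (fun ω => W.dist_nonneg ω _)
        fun _ => (u n).coe_nonneg).ennreal_ofReal
    · exact ENNReal.ofReal_le_one.2 (N.interfLaplace_le_one (W.dist_nonneg ω _) (u n).coe_nonneg)
    · rw [← ENNReal.ofReal_one]
      exact (ENNReal.continuous_ofReal.tendsto 1).comp ((N.tendsto_interfLaplace _).comp hu)
  have h3 : 1 ≤ P {ω | W.interference ω ≠ ∞} := by
    have := le_of_tendsto' h2 h1
    simpa using this
  exact (prob_compl_eq_zero_iff hms).2 (le_antisymm prob_le_one h3)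

theorem ae_dist_strictMono [IsProbabilityMeasure P] : ∀ᵐ ω ∂P, StrictMono (W.dist ω) := by
  filter_upwards [W.sorted, (W.ppp 0).ae_norm_injective (N.lam_pos 0).le] with ω h1 h2
  exact (h1.strictMono_of_injective h2).comp Fin.val_strictMono

/-- The weight of the exponential function with rate `d_j ^ η` in the conditional CCDF. -/
noncomputable def _root_.CoopNetwork.Params.tailWeight (N : Params) (q theta : ℝ)
    (d : Fin N.K → ℝ) (j : Fin N.K) : ℝ :=
  tailCoeff q (fun i => d i ^ N.eta) Finset.univ j * Real.exp (-(d j ^ N.eta * theta * N.noise))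

/-- The conditional probability of `γ > θ` given the locations and the interference. -/
noncomputable def locCcdf (q theta : ℝ) (ω : Ω) : ℝ :=
  ∑ j, N.tailWeight q theta (W.dist ω) j *
    (expNeg (ENNReal.ofReal (W.dist ω j ^ N.eta * theta) * W.interference ω)).toReal

theorem indepFun_signal_interference [IsProbabilityMeasure P] (b : Fin (N.M + 1) × ℕ → ℝ) :
    IndepFun (fun ω => ∑ i : Fin N.K, W.markPower b (0, i) ω)
      (fun ω => ∑' k, W.markPower b (N.interferer k) ω) P := by
  refine indepFun_of_disjoint (W.measurable_markPower b) (W.iIndepFun_markPower b)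
    (S := Set.range fun i : Fin N.K => ((0 : Fin (N.M + 1)), (i : ℕ)))
    (T := Set.range N.interferer) ?_ ?_ ?_
  · rw [Set.disjoint_left]
    rintro _ ⟨i, rfl⟩ ⟨⟨t, j⟩, h⟩
    simp only [Params.interferer, Prod.mk.injEq] at h
    obtain ⟨rfl, h⟩ := h
    have := i.2
    simp only [Params.offset, Fin.cons_zero] at h
    omega
  · refine @Finset.measurable_fun_sum _ _ _ _ _ _ (_) _ _ fun i _ => ?_
    refine Measurable.mono (comap_measurable _) ?_ le_rfl
    exact le_iSup₂_of_le (f := fun k (_ : k ∈ Set.range fun i : Fin N.K =>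
      ((0 : Fin (N.M + 1)), (i : ℕ))) => MeasurableSpace.comap (W.markPower b k) inferInstance)
      (0, (i : ℕ)) ⟨i, rfl⟩ le_rfl
  · refine @Measurable.tsum _ _ _ (_) _ _ _ _ _ _ _ _ _ _ _ _ fun k => ?_
    refine Measurable.mono (comap_measurable _) ?_ le_rfl
    exact le_iSup₂_of_le (f := fun k (_ : k ∈ Set.range N.interferer) =>
      MeasurableSpace.comap (W.markPower b k) inferInstance) (N.interferer k) ⟨k, rfl⟩ le_rfl

theorem _root_.CoopNetwork.Params.measurable_tailWeight (q theta : ℝ) (j : Fin N.K) :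
    Measurable fun d => N.tailWeight q theta d j := by
  unfold Params.tailWeight tailCoeff
  fun_prop

theorem measurable_locCcdf (q theta : ℝ) : Measurable (W.locCcdf q theta) := by
  refine Finset.measurable_fun_sum _ fun j _ =>
    ((N.measurable_tailWeight q theta j).comp W.measurable_dist).mul
      (measurable_expNeg.comp (Measurable.mul ?_ W.measurable_interference)).ennreal_toReal
  exact (((((W.ppp 0).measurable j).norm).pow_const _).mul_const theta).ennreal_ofReal

theorem inv_dist_rpow (ω : Ω) (i : Fin N.K) :
    (W.dist ω i ^ N.eta)⁻¹ = N.pathPower (fun t i => W.loc t i ω) (0, i) := by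
  rw [← Real.rpow_neg (W.dist_nonneg ω i)]
  exact (one_mul _).symm

/-- A signed sum by its form, but for almost every outcome it is the tail probability of the signal
at the frozen level θ(I + σ²). This gives the integrability of the whole sum. -/
theorem ae_locCcdf_mem [IsProbabilityMeasure P] {q : ℝ} (hIn : ∀ i, N.qIn i = q) {theta : ℝ}
    (ht : 0 ≤ theta) : ∀ᵐ ω ∂P, W.locCcdf q theta ω ∈ Set.Icc (0 : ℝ) 1 := by
  filter_upwards [W.ae_dist_pos, W.ae_dist_strictMono, W.ae_interference_ne_top] with ω h1 h2 h3
  have hη : 0 < N.eta := by linarith [N.two_lt_eta]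
  let b := N.pathPower fun t i => W.loc t i ω
  have hq : q ∈ Set.Ico (0 : ℝ) 1 := hIn N.last ▸ N.qIn_mem N.last
  have hx : 0 ≤ theta * ((W.interference ω).toReal + N.noise) :=
    mul_nonneg ht (add_nonneg ENNReal.toReal_nonneg N.noise_nonneg)
  have hinj : Function.Injective fun i => W.dist ω i ^ N.eta := fun i j hij =>
    h2.injective ((Real.rpow_left_inj (h1 i).le (h1 j).le hη.ne').1 hij)
  have key := measureReal_lt_sum_thinnedExp (P := P) hq (a := fun i => W.dist ω i ^ N.eta)
    (R := fun i : Fin N.K => W.markPower b (0, i)) (fun i => W.measurable_markPower b _)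
    ((W.iIndepFun_markPower b).precomp fun i j h => Fin.ext (Prod.mk.inj h).2) Finset.univ
    (fun i _ => Real.rpow_pos_of_pos (h1 i) _) hinj.injOn
    (fun i _ => by
      have := W.isThinnedExp_markPower_in b i
      rwa [hIn, show b (0, i) = (W.dist ω i ^ N.eta)⁻¹ from (W.inv_dist_rpow ω i).symm] at this) hx
  have h4 : W.locCcdf q theta ω = P.real {ω' | ENNReal.ofReal
      (theta * ((W.interference ω).toReal + N.noise)) <
        ∑ i : Fin N.K, W.markPower b (0, i) ω'} := by
    rw [key]
    refine Finset.sum_congr rfl fun j _ => ?_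
    have haj : 0 < W.dist ω j ^ N.eta := Real.rpow_pos_of_pos (h1 j) _
    rw [Params.tailWeight, mul_assoc]
    congr 1
    conv_lhs => rw [← ENNReal.ofReal_toReal h3, ← ENNReal.ofReal_mul (by positivity),
      expNeg_ofReal (by positivity), ENNReal.toReal_ofReal (Real.exp_nonneg _), ← Real.exp_add]
    congr 1
    ring
  rw [h4]
  exact ⟨measureReal_nonneg, measureReal_le_one⟩

/-- Fubini: almost sure finiteness persists when the locations are frozen and only the marks are
redrawn. -/
theorem ae_marks_interference_ne_top [IsProbabilityMeasure P] : ∀ᵐ ω ∂P, ∀ᵐ ω' ∂P,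
    ∑' k, W.markPower (N.pathPower fun t i => W.loc t i ω) (N.interferer k) ω' ≠ ∞ := by
  classical
  let F : N.Locations → N.Marks → ℝ≥0∞ := fun x m => if N.totalInterf x m = ∞ then 1 else 0
  have hF : Measurable (Function.uncurry F) :=
    Measurable.ite (N.measurable_totalInterf (measurableSet_singleton ∞)) measurable_const
      measurable_const
  have h1 := lintegral_indepFun W.measurable_loc W.measurable_marks W.indep_loc_marks hF
  have h2 : ∫⁻ ω, F (fun t i => W.loc t i ω)
      (fun t i => W.active t i ω, fun t i => W.gain t i ω) ∂P = 0 := by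
    refine (lintegral_congr_ae ?_).trans lintegral_zero
    filter_upwards [W.ae_interference_ne_top] with ω hω
    rw [interference_eq] at hω
    exact if_neg hω
  rw [h1, lintegral_eq_zero_iff (by
    exact Measurable.lintegral_prod_right' (f := fun p : Ω × Ω => F (fun t i => W.loc t i p.1)
      (fun t i => W.active t i p.2, fun t i => W.gain t i p.2))
      (hF.comp ((W.measurable_loc.comp measurable_fst).prodMk
        (W.measurable_marks.comp measurable_snd))))] at h2
  filter_upwards [h2] with ω hω
  have hω0 := (lintegral_eq_zero_iff (f := fun ω' => F (fun t i => W.loc t i ω)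
    (fun t i => W.active t i ω', fun t i => W.gain t i ω'))
    (hF.comp (measurable_const.prodMk W.measurable_marks))).1 hω
  filter_upwards [hω0] with ω' hω' htop
  exact one_ne_zero ((if_pos htop).symm.trans hω')

/-- The tail formula is applied for frozen locations and integrated over them. -/
theorem measure_lt_sinr_inter [IsProbabilityMeasure P] {q : ℝ} (hIn : ∀ i, N.qIn i = q) {theta : ℝ}
    (ht : 0 ≤ theta) {A : Set (Fin N.K → ℝ)} (hA : MeasurableSet A) :
    P ({ω | ENNReal.ofReal theta < W.sinr ω} ∩ W.dist ⁻¹' A) =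
      ∫⁻ ω in W.dist ⁻¹' A, ENNReal.ofReal (W.locCcdf q theta ω) ∂P := by
  have hη : 0 < N.eta := by linarith [N.two_lt_eta]
  have hq : q ∈ Set.Ico (0 : ℝ) 1 := hIn N.last ▸ N.qIn_mem N.last
  let δ : N.Locations → Fin N.K → ℝ := fun x i => ‖x 0 i‖
  have hδ : Measurable δ := measurable_pi_lambda _ fun i => Measurable.norm (by fun_prop)
  let F₁ : N.Locations → N.Marks → ℝ≥0∞ := fun x m => A.indicator 1 (δ x) *
    if ENNReal.ofReal theta < (∑ i : Fin N.K, N.nodePower x m (0, i)) / (N.totalInterf x m + ENNReal.ofReal N.noise)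
      then 1 else 0
  -- `locCcdf` still contains the marks of the interferers. Hence the right-hand side is also turned
  -- into a double integral, and the two sides are compared location by location.
  let F₂ : N.Locations → N.Marks → ℝ≥0∞ := fun x m => A.indicator 1 (δ x) *
    ENNReal.ofReal (∑ j, N.tailWeight q theta (δ x) j *
      (expNeg (ENNReal.ofReal (δ x j ^ N.eta * theta) * N.totalInterf x m)).toReal)
  have hI : Measurable fun p : N.Locations × N.Marks => A.indicator (1 : (Fin N.K → ℝ) → ℝ≥0∞) (δ p.1) :=
    ((measurable_one.indicator hA).comp hδ).comp measurable_fst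
  have hF₁ : Measurable (Function.uncurry F₁) :=
    hI.mul (Measurable.ite (measurableSet_lt measurable_const
      ((Finset.measurable_fun_sum _ fun i _ => N.measurable_nodePower _).div (N.measurable_totalInterf.add measurable_const)))
        measurable_const measurable_const)
  have hF₂ : Measurable (Function.uncurry F₂) := by
    refine hI.mul (Finset.measurable_fun_sum _ fun j _ => Measurable.mul
      (((N.measurable_tailWeight q theta j).comp hδ).comp measurable_fst)
      (measurable_expNeg.comp (Measurable.mul ?_ N.measurable_totalInterf)).ennreal_toReal).ennreal_ofReal
    exact (((((measurable_pi_apply j).comp hδ).comp measurable_fst).pow_const _).mul_const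
      theta).ennreal_ofReal
  have hAd : MeasurableSet (W.dist ⁻¹' A) := W.measurable_dist hA
  have hsinr : MeasurableSet {ω | ENNReal.ofReal theta < W.sinr ω} :=
    measurableSet_lt measurable_const W.measurable_sinr
  have e₁ : P ({ω | ENNReal.ofReal theta < W.sinr ω} ∩ W.dist ⁻¹' A) =
      ∫⁻ ω, F₁ (fun t i => W.loc t i ω)
        (fun t i => W.active t i ω, fun t i => W.gain t i ω) ∂P := by
    rw [← lintegral_indicator_one (hsinr.inter hAd), Set.inter_comm]
    refine lintegral_congr fun ω => ?_
    rw [Set.inter_indicator_one, Pi.mul_apply]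
    congr 1
    simp only [Set.indicator_apply, Set.mem_ofPred_eq, sinr, signal_eq, interference_eq]
    rfl
  have e₂ : ∫⁻ ω in W.dist ⁻¹' A, ENNReal.ofReal (W.locCcdf q theta ω) ∂P =
      ∫⁻ ω, F₂ (fun t i => W.loc t i ω)
        (fun t i => W.active t i ω, fun t i => W.gain t i ω) ∂P := by
    rw [← lintegral_indicator hAd]
    refine lintegral_congr fun ω => ?_
    have h : F₂ (fun t i => W.loc t i ω) (fun t i => W.active t i ω, fun t i => W.gain t i ω) =
        A.indicator 1 (W.dist ω) * ENNReal.ofReal (W.locCcdf q theta ω) := by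
      simp only [locCcdf, interference_eq]
      rfl
    rw [h]
    by_cases hω : W.dist ω ∈ A
    · rw [Set.indicator_of_mem (show ω ∈ W.dist ⁻¹' A from hω), Set.indicator_of_mem hω,
        Pi.one_apply, one_mul]
    · rw [Set.indicator_of_notMem (show ω ∉ W.dist ⁻¹' A from hω), Set.indicator_of_notMem hω,
        zero_mul]
  rw [e₁, e₂, lintegral_indepFun W.measurable_loc W.measurable_marks W.indep_loc_marks hF₁,
    lintegral_indepFun W.measurable_loc W.measurable_marks W.indep_loc_marks hF₂]
  refine lintegral_congr_ae ?_
  filter_upwards [W.ae_dist_pos, W.ae_dist_strictMono, W.ae_marks_interference_ne_top] with ω h1 h2 h3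
  let b := N.pathPower fun t i => W.loc t i ω
  have hinj : Function.Injective fun i => W.dist ω i ^ N.eta := fun i j hij =>
    h2.injective ((Real.rpow_left_inj (h1 i).le (h1 j).le hη.ne').1 hij)
  have hS : Measurable fun ω' => ∑ i : Fin N.K, W.markPower b (0, i) ω' :=
    Finset.measurable_fun_sum _ fun i _ => W.measurable_markPower b _
  have hY : Measurable fun ω' => ∑' k, W.markPower b (N.interferer k) ω' :=
    Measurable.tsum fun k => W.measurable_markPower b _
  have key := measure_lt_div_sum_thinnedExp hq (a := fun i => W.dist ω i ^ N.eta)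
    (R := fun i : Fin N.K => W.markPower b (0, i)) (fun i => W.measurable_markPower b _)
    ((W.iIndepFun_markPower b).precomp fun i j h => Fin.ext (Prod.mk.inj h).2) Finset.univ
    (fun i _ => Real.rpow_pos_of_pos (h1 i) _) hinj.injOn
    (fun i _ => by
      have := W.isThinnedExp_markPower_in b i
      rwa [hIn, show b (0, i) = (W.dist ω i ^ N.eta)⁻¹ from (W.inv_dist_rpow ω i).symm] at this)
    hY (W.indepFun_signal_interference b) h3 ht N.noise_nonneg
  have hms : MeasurableSet {ω' | ENNReal.ofReal theta < (∑ i : Fin N.K, W.markPower b (0, i) ω') /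
      ((∑' k, W.markPower b (N.interferer k) ω') + ENNReal.ofReal N.noise)} :=
    measurableSet_lt measurable_const (hS.div (hY.add measurable_const))
  rw [← lintegral_indicator_one hms] at key
  simp only [F₁, F₂]
  rw [lintegral_const_mul _ ?_, lintegral_const_mul _ ?_]
  · congr 1
    refine Eq.trans (lintegral_congr fun ω' => ?_) key
    simp only [Set.indicator_apply, Set.mem_ofPred_eq, Pi.one_apply]
    rfl
  · refine (Finset.measurable_fun_sum _ fun j _ => Measurable.mul measurable_const
      (measurable_expNeg.comp (Measurable.mul measurable_const hY)).ennreal_toReal).ennreal_ofReal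
  · exact Measurable.ite hms measurable_const measurable_const

end Network

end CoopNetwork

namespace CoopNetwork

open Filter Topology

variable {Ω : Type*} [mΩ : MeasurableSpace Ω] {P : Measure Ω}

/-! ### Conditional expectations -/

/-- Pulling out unbounded coefficients whose products with bounded variables have an integrable
sum. -/
theorem condExp_sum_mul [IsFiniteMeasure P] {m : MeasurableSpace Ω} {ι : Type*} {s : Finset ι}
    {κ Z L : ι → Ω → ℝ} (hκ : ∀ j, StronglyMeasurable[m] (κ j)) (hm : m ≤ mΩ)
    (hZ : ∀ j, Measurable[mΩ] (Z j)) (hZ1 : ∀ j ω, |Z j ω| ≤ 1) (hL : ∀ j ∈ s, P[Z j|m] =ᵐ[P] L j)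
    {V : Ω → ℝ} (hV : Integrable V P) (hVκ : V = fun ω => ∑ j ∈ s, κ j ω * Z j ω) :
    P[V|m] =ᵐ[P] fun ω => ∑ j ∈ s, κ j ω * L j ω := by
  -- A positive `m`-measurable weight that makes every `w * κ j` bounded by 1. The coefficients can
  -- then be pulled out term by term, and the weight is cancelled at the end.
  let w : Ω → ℝ := fun ω => (1 + ∑ j ∈ s, |κ j ω|)⁻¹
  have hpos : ∀ ω, 0 < 1 + ∑ j ∈ s, |κ j ω| := fun ω =>
    add_pos_of_pos_of_nonneg one_pos (Finset.sum_nonneg fun j _ => abs_nonneg _)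
  have hw0 : ∀ ω, 0 < w ω := fun ω => inv_pos.2 (hpos ω)
  have hwm : StronglyMeasurable[m] w := by
    have h : Measurable[m] w := by
      have : ∀ j, Measurable[m] (κ j) := fun j => (hκ j).measurable
      exact Measurable.inv (measurable_const.add
        (Finset.measurable_fun_sum s fun j _ => (this j).abs))
    exact h.stronglyMeasurable
  have hw1 : ∀ ω, w ω ≤ 1 := fun ω => inv_le_one_of_one_le₀
    (le_add_of_nonneg_right (Finset.sum_nonneg fun j _ => abs_nonneg _))
  have hwκ : ∀ j ∈ s, ∀ ω, |w ω * κ j ω| ≤ 1 := fun j hj ω => by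
    rw [abs_mul, abs_of_pos (hw0 ω), inv_mul_le_one₀ (hpos ω)]
    have := Finset.single_le_sum (f := fun j => |κ j ω|) (fun j _ => abs_nonneg _) hj
    linarith
  have hZi : ∀ j, Integrable (Z j) P := fun j =>
    Integrable.of_bound (hZ j).aestronglyMeasurable 1 (Eventually.of_forall (hZ1 j))
  have hwκm : ∀ j, StronglyMeasurable[m] (w * κ j) := fun j => hwm.mul (hκ j)
  have hwκZ : ∀ j ∈ s, Integrable (w * κ j * Z j) P := fun j hj => by
    refine Integrable.of_bound (((hwκm j).mono hm).aestronglyMeasurable.mul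
      (hZ j).aestronglyMeasurable) 1 (Eventually.of_forall fun ω => ?_)
    rw [Pi.mul_apply, Pi.mul_apply, norm_mul]
    exact mul_le_one₀ (hwκ j hj ω) (norm_nonneg _) (hZ1 j ω)
  have hwV : Integrable (w * V) P := by
    refine hV.bdd_mul (c := 1) (hwm.mono hm).aestronglyMeasurable (Eventually.of_forall fun ω => ?_)
    rw [Real.norm_of_nonneg (hw0 ω).le]
    exact hw1 ω
  have h1 : P[w * V|m] =ᵐ[P] w * P[V|m] := condExp_mul_of_stronglyMeasurable_left hwm hwV hV
  have h2 : w * V = ∑ j ∈ s, w * κ j * Z j := by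
    ext ω
    simp only [hVκ, Pi.mul_apply, Finset.sum_apply, Finset.mul_sum, mul_assoc]
  have h3 : P[w * V|m] =ᵐ[P] ∑ j ∈ s, P[w * κ j * Z j|m] := by
    rw [h2]
    exact condExp_finsetSum hwκZ m
  have h4 : ∀ᵐ ω ∂P, ∀ j ∈ s, (P[w * κ j * Z j|m]) ω = w ω * κ j ω * L j ω := by
    refine (ae_ball_iff s.countable_toSet).2 fun j hj => ?_
    filter_upwards [condExp_mul_of_stronglyMeasurable_left (hwκm j) (hwκZ j hj) (hZi j), hL j hj]
      with ω h5 h6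
    rw [h5, Pi.mul_apply, h6, Pi.mul_apply]
  filter_upwards [h1, h3, h4] with ω e1 e2 e3
  rw [e1, Pi.mul_apply, Finset.sum_apply, Finset.sum_congr rfl e3] at e2
  refine mul_left_cancel₀ (hw0 ω).ne' (e2.trans ?_)
  rw [Finset.mul_sum]
  exact Finset.sum_congr rfl fun j _ => mul_assoc _ _ _

namespace Network

variable {N : Params} (W : Network N P)

theorem geometry_le : W.geometry ≤ mΩ := W.measurable_dist.comap_le

/-- The right-hand side is still a conditional expectation, because `locCcdf` depends on the
interference and not only on the geometry. -/
theorem condExp_sinr [IsProbabilityMeasure P] {q : ℝ} (hIn : ∀ i, N.qIn i = q) {theta : ℝ}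
    (ht : 0 ≤ theta) : W.ccdf theta =ᵐ[P] P[W.locCcdf q theta|W.geometry] := by
  have hs : MeasurableSet {ω | ENNReal.ofReal theta < W.sinr ω} :=
    measurableSet_lt measurable_const W.measurable_sinr
  have hV := W.ae_locCcdf_mem hIn ht
  have hVi : Integrable (W.locCcdf q theta) P := by
    refine Integrable.of_bound (W.measurable_locCcdf q theta).aestronglyMeasurable 1 ?_
    filter_upwards [hV] with ω hω
    rw [Real.norm_of_nonneg hω.1]
    exact hω.2
  refine (ae_eq_condExp_of_forall_setIntegral_eq W.geometry_le
    ((integrable_const 1).indicator hs) (fun _ _ _ => integrable_condExp.integrableOn) ?_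
    stronglyMeasurable_condExp.aestronglyMeasurable).symm
  rintro _ ⟨A, hA, rfl⟩ -
  rw [setIntegral_condExp W.geometry_le hVi ⟨A, hA, rfl⟩,
    integral_eq_lintegral_of_nonneg_ae (ae_restrict_of_ae (hV.mono fun ω h => h.1))
      (W.measurable_locCcdf q theta).aestronglyMeasurable, ← W.measure_lt_sinr_inter hIn ht hA,
    setIntegral_indicator hs, setIntegral_const, smul_eq_mul, mul_one, Set.inter_comm]
  rfl

theorem condExp_expNeg_interference [IsProbabilityMeasure P] {s : (Fin N.K → ℝ) → NNReal}
    (hs : Measurable s) :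
    P[fun ω => (expNeg (s (W.dist ω) * W.interference ω)).toReal|W.geometry] =ᵐ[P]
      fun ω => N.interfLaplace (W.dist ω N.last) (s (W.dist ω)) := by
  have hE : Measurable fun ω => expNeg (s (W.dist ω) * W.interference ω) :=
    measurable_expNeg.comp ((hs.comp W.measurable_dist).coe_nnreal_ennreal.mul
      W.measurable_interference)
  have hdm : Measurable[W.geometry] W.dist := comap_measurable _
  have hL : Measurable[W.geometry] fun ω => N.interfLaplace (W.dist ω N.last) (s (W.dist ω)) :=
    @Params.measurable_interfLaplace N Ω W.geometry _ _ ((measurable_pi_apply N.last).comp hdm)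
      ((hs.coe_nnreal_real).comp hdm) (fun ω => W.dist_nonneg ω _) fun ω => NNReal.coe_nonneg _
  have hLi : Integrable (fun ω => N.interfLaplace (W.dist ω N.last) (s (W.dist ω))) P := by
    refine Integrable.of_bound (hL.mono W.geometry_le le_rfl).aestronglyMeasurable 1
      (Eventually.of_forall fun ω => ?_)
    rw [Real.norm_of_nonneg (N.interfLaplace_nonneg _ _)]
    exact N.interfLaplace_le_one (W.dist_nonneg ω _) (NNReal.coe_nonneg _)
  have hEi : Integrable (fun ω => (expNeg (s (W.dist ω) * W.interference ω)).toReal) P := by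
    refine Integrable.of_bound hE.ennreal_toReal.aestronglyMeasurable 1
      (Eventually.of_forall fun ω => ?_)
    rw [Real.norm_of_nonneg ENNReal.toReal_nonneg]
    exact ENNReal.toReal_le_of_le_ofReal zero_le_one (by simpa using expNeg_le_one _)
  refine (ae_eq_condExp_of_forall_setIntegral_eq W.geometry_le hEi
    (fun _ _ _ => hLi.integrableOn) ?_ hL.stronglyMeasurable.aestronglyMeasurable).symm
  rintro _ ⟨A, hA, rfl⟩ -
  have hAd : MeasurableSet (W.dist ⁻¹' A) := W.measurable_dist hA
  have key := W.lintegral_expNeg_interference hs (φ := A.indicator 1) (measurable_one.indicator hA)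
    fun d => Set.indicator_le_self' (fun _ _ => zero_le) d
  have hrew : ∀ f : Ω → ℝ≥0∞, ∫⁻ ω, A.indicator 1 (W.dist ω) * f ω ∂P =
      ∫⁻ ω in W.dist ⁻¹' A, f ω ∂P := fun f => by
    rw [← lintegral_indicator hAd]
    refine lintegral_congr fun ω => ?_
    by_cases hω : W.dist ω ∈ A
    · rw [Set.indicator_of_mem (show ω ∈ W.dist ⁻¹' A from hω), Set.indicator_of_mem hω,
        Pi.one_apply, one_mul]
    · rw [Set.indicator_of_notMem (show ω ∉ W.dist ⁻¹' A from hω), Set.indicator_of_notMem hω,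
        zero_mul]
  rw [hrew, hrew] at key
  rw [integral_eq_lintegral_of_nonneg_ae
      (Eventually.of_forall fun ω => N.interfLaplace_nonneg _ _)
      hLi.aestronglyMeasurable.restrict, ← key,
    integral_toReal hE.aemeasurable (Eventually.of_forall fun ω => (expNeg_ne_top _).lt_top)]

/-- The CCDF given the cluster geometry, as a mixture of Laplace transforms of the interference. -/
theorem ccdf_ae_eq [IsProbabilityMeasure P] {q : ℝ} (hIn : ∀ i, N.qIn i = q) {theta : ℝ}
    (ht : 0 ≤ theta) : W.ccdf theta =ᵐ[P] fun ω => ∑ j, N.tailWeight q theta (W.dist ω) j *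
      N.interfLaplace (W.dist ω N.last) (W.dist ω j ^ N.eta * theta) := by
  have hV := W.ae_locCcdf_mem hIn ht
  have hVi : Integrable (W.locCcdf q theta) P := by
    refine Integrable.of_bound (W.measurable_locCcdf q theta).aestronglyMeasurable 1 ?_
    filter_upwards [hV] with ω hω
    rw [Real.norm_of_nonneg hω.1]
    exact hω.2
  have hdm : Measurable[W.geometry] W.dist := comap_measurable _
  have hs : ∀ j, Measurable fun d : Fin N.K → ℝ => (d j ^ N.eta * theta).toNNReal := fun j => by
    fun_prop
  -- The coefficients are unbounded where two distances nearly coincide. Only the sum, which has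
  -- values in [0, 1], is known to be integrable, not the separate terms.
  refine (W.condExp_sinr hIn ht).trans (condExp_sum_mul (fun j =>
    (((N.measurable_tailWeight q theta j).comp hdm).stronglyMeasurable)) W.geometry_le
    (fun j => ?_) (fun j ω => ?_) (fun j _ => ?_) hVi rfl)
  · exact (measurable_expNeg.comp (((hs j).comp W.measurable_dist).coe_nnreal_ennreal.mul
      W.measurable_interference)).ennreal_toReal
  · rw [abs_of_nonneg ENNReal.toReal_nonneg]
    exact ENNReal.toReal_le_of_le_ofReal zero_le_one (by simpa using expNeg_le_one _)
  · refine (W.condExp_expNeg_interference (hs j)).trans (Eventually.of_forall fun ω => ?_)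
    simp only
    rw [Real.coe_toNNReal _ (mul_nonneg (Real.rpow_nonneg (W.dist_nonneg ω j) _) ht)]

end Network

end CoopNetwork

namespace CoopNetwork

open Filter Topology

/-! ### The coefficients of the mixture -/

/-- Vieta's formulas; the sign in `alpha` comes from evaluating ∏ (X + w) at -x. -/
theorem sum_alpha_mul_pow (s : Multiset ℝ) (x : ℝ) :
    ∑ i ∈ Finset.range (s.card + 1), alpha s i * x ^ i = (s.map fun w => w - x).prod := by
  have h := congrArg (Polynomial.eval (-x)) (Multiset.prod_X_add_C_eq_sum_esymm s)
  rw [Polynomial.eval_multiset_prod, Multiset.map_map, Polynomial.eval_finsetSum] at h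
  simp only [Function.comp_def, Polynomial.eval_add, Polynomial.eval_X, Polynomial.eval_C,
    Polynomial.eval_mul, Polynomial.eval_pow] at h
  rw [← Finset.sum_range_reflect] at h
  have h1 : (s.map fun w => w - x) = s.map fun w => -x + w :=
    Multiset.map_congr rfl fun w _ => by ring
  rw [h1, h]
  refine Finset.sum_congr rfl fun i hi => ?_
  have hi' : i ≤ s.card := Nat.lt_succ_iff.1 (Finset.mem_range.1 hi)
  rw [show s.card + 1 - 1 - i = s.card - i by omega, Nat.sub_sub_self hi', alpha, neg_pow]
  ring

/-- Homogeneity of degree zero, which allows passing from the rates d_i^η to the normalized ω_i^η.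
-/
theorem tailCoeff_div {ι : Type*} [DecidableEq ι] (q : ℝ) (a : ι → ℝ) (s : Finset ι) (j : ι)
    {c : ℝ} (hc : c ≠ 0) : tailCoeff q (fun i => a i / c) s j = tailCoeff q a s j := by
  rw [tailCoeff, tailCoeff]
  congr 1
  refine Finset.prod_congr rfl fun l _ => ?_
  rw [← mul_div_assoc, ← sub_div, ← sub_div, div_div_div_cancel_right₀ hc]

/-- The weights of the mixture are those of the tail of a sum of thinned exponential variables. -/
theorem sum_alpha_div_eq_tailCoeff {ι : Type*} [DecidableEq ι] (s : Finset ι) (w : ι → ℝ) (q : ℝ)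
    {j : ι} (hj : j ∈ s) (hw : w j ≠ 0) :
    (∑ i ∈ Finset.range s.card, alpha (s.val.map w) i * (q ^ i - q ^ s.card) * w j ^ i) /
        (w j * ∏ l ∈ s.erase j, (w l - w j)) = tailCoeff q w s j := by
  have hcard : (s.val.map w).card = s.card := Multiset.card_map _ _
  have h1 : ∀ x : ℝ, ∑ i ∈ Finset.range (s.card + 1), alpha (s.val.map w) i * x ^ i =
      ∏ l ∈ s, (w l - x) := fun x => by
    have := sum_alpha_mul_pow (s.val.map w) x
    rwa [hcard, Multiset.map_map] at this
  -- The term of top degree carries the factor q^K - q^K = 0, so it may be added. This completes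
  -- both sums to the polynomial ∏ (w_l - x), at x = q w_j and at its root x = w_j.
  have h2 : ∑ i ∈ Finset.range s.card, alpha (s.val.map w) i * (q ^ i - q ^ s.card) * w j ^ i =
      ∑ i ∈ Finset.range (s.card + 1), alpha (s.val.map w) i * (q * w j) ^ i -
        q ^ s.card * ∑ i ∈ Finset.range (s.card + 1), alpha (s.val.map w) i * w j ^ i := by
    rw [Finset.mul_sum, ← Finset.sum_sub_distrib, Finset.sum_range_succ _ s.card]
    have h3 : alpha (s.val.map w) s.card * (q * w j) ^ s.card -
        q ^ s.card * (alpha (s.val.map w) s.card * w j ^ s.card) = 0 := by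
      rw [mul_pow]; ring
    rw [h3, add_zero]
    refine Finset.sum_congr rfl fun i _ => ?_
    rw [mul_pow]; ring
  rw [h2, h1, h1, Finset.prod_eq_zero (f := fun l => w l - w j) hj (sub_self _), mul_zero, sub_zero,
    ← Finset.mul_prod_erase s _ hj, tailCoeff, Finset.prod_div_distrib,
    show w j - q * w j = w j * (1 - q) by ring, mul_assoc, mul_div_mul_left _ _ hw, mul_div_assoc]

/-! ### Identification with the stated mixture. -/

namespace Params

variable (N : Params)

theorem omega_rpow {d : Fin N.K → ℝ} (hd : ∀ i, 0 < d i) (i : Fin N.K) :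
    N.omega d i ^ N.eta = d i ^ N.eta / d N.last ^ N.eta :=
  Real.div_rpow (hd i).le (hd _).le _

/-- At s = d_j^η θ the power (s P_m)^(2/η) becomes d_j² (θ P_m)^(2/η), and s d_K^(-η) becomes ω_j^η
θ. The noise factor sits in `tailWeight`. -/
theorem tailWeight_mul_interfLaplace {q theta : ℝ} (ht : 0 ≤ theta) {d : Fin N.K → ℝ}
    (hd : ∀ i, 0 < d i) (j : Fin N.K) :
    N.tailWeight q theta d j * N.interfLaplace (d N.last) (d j ^ N.eta * theta) =
      tailCoeff q (fun i => d i ^ N.eta) Finset.univ j * N.C theta d j := by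
  have hη : 0 < N.eta := by linarith [N.two_lt_eta]
  have hD : ∏ m, N.extrinsic m (d j ^ N.eta * theta) = N.D theta d j := by
    refine Finset.prod_congr rfl fun m _ => ?_
    rw [extrinsic, mul_assoc (d j ^ N.eta), Real.mul_rpow (Real.rpow_nonneg (hd j).le _)
      (mul_nonneg ht (N.power_pos m).le), ← Real.rpow_mul (hd j).le, mul_div_cancel₀ _ hη.ne',
      Real.rpow_two]
    congr 1
    ring
  have hF : d j ^ N.eta * theta * d N.last ^ (-N.eta) = N.omega d j ^ N.eta * theta := by
    rw [N.omega_rpow hd, Real.rpow_neg (hd _).le]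
    ring
  rw [tailWeight, interfLaplace, C, hD, hF]
  ring

theorem mixture_eq {q theta : ℝ} (ht : 0 ≤ theta) {d : Fin N.K → ℝ} (hd : ∀ i, 0 < d i) :
    N.mixture (fun i => alpha (N.Omega d) i * (q ^ i - q ^ N.K)) theta d =
      ∑ j, N.tailWeight q theta d j * N.interfLaplace (d N.last) (d j ^ N.eta * theta) := by
  refine Finset.sum_congr rfl fun j _ => ?_
  rw [N.tailWeight_mul_interfLaplace ht hd]
  congr 1
  have hpos : ∀ i, 0 < d i ^ N.eta := fun i => Real.rpow_pos_of_pos (hd i) _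
  have hw : N.omega d j ^ N.eta ≠ 0 := by
    rw [N.omega_rpow hd]
    exact (div_pos (hpos _) (hpos _)).ne'
  have h := sum_alpha_div_eq_tailCoeff Finset.univ (fun i => N.omega d i ^ N.eta) q
    (Finset.mem_univ j) hw
  rw [Finset.card_univ, Fintype.card_fin] at h
  refine h.trans ?_
  simp_rw [N.omega_rpow hd]
  exact tailCoeff_div _ _ _ _ (hpos _).ne'

/-- Here Ω̂ is Ω scaled by 1/q, so its elementary symmetric function of degree K - i is that of Ω
times q^(i - K), and G = q^K. -/
theorem G_mul_alpha_sub {q : ℝ} (hIn : ∀ i, N.qIn i = q) (hq : 0 < q) (d : Fin N.K → ℝ) {i : ℕ}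
    (hi : i < N.K) : N.G * (alpha (N.OmegaHat d) i - alpha (N.Omega d) i) =
      alpha (N.Omega d) i * (q ^ i - q ^ N.K) := by
  have hG : N.G = q ^ N.K := by
    rw [G, Finset.prod_congr rfl fun i _ => hIn i, Finset.prod_const, Finset.card_univ,
      Fintype.card_fin]
  have hcard : (N.Omega d).card = N.K := by simp [Omega]
  have hhat : N.OmegaHat d = (N.Omega d).map (q⁻¹ • ·) := by
    rw [OmegaHat, Omega, Multiset.map_map]
    refine Multiset.map_congr rfl fun i _ => ?_
    rw [hIn, Function.comp_apply, smul_eq_mul, div_eq_inv_mul]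
  have hq' : q ^ N.K * q⁻¹ ^ (N.K - i) = q ^ i := by
    rw [← Nat.sub_add_cancel hi.le, pow_add, Nat.add_sub_cancel, mul_right_comm, ← mul_pow,
      mul_inv_cancel₀ hq.ne', one_pow, one_mul]
  rw [alpha, alpha, hhat, Multiset.card_map, ← Multiset.pow_smul_esymm, hcard, smul_eq_mul, hG,
    ← hq']
  ring

theorem mul_mixture {c c' : ℕ → ℝ} {a : ℝ} (h : ∀ i < N.K, a * c i = c' i) (theta : ℝ)
    (d : Fin N.K → ℝ) : a * N.mixture c theta d = N.mixture c' theta d := by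
  rw [mixture, mixture, Finset.mul_sum]
  refine Finset.sum_congr rfl fun j _ => ?_
  rw [← mul_assoc, ← mul_div_assoc, Finset.mul_sum]
  congr 2
  refine Finset.sum_congr rfl fun i hi => ?_
  rw [← mul_assoc, h i (Finset.mem_range.1 hi)]

end Params

end CoopNetwork

/-! ### The result for equal transmission probabilities. -/

theorem corollary2 {Ω : Type*} [MeasurableSpace Ω] (P : Measure Ω) [IsProbabilityMeasure P]
    (N : CoopNetwork.Params) (W : CoopNetwork.Network N P)
    (q : ℝ) (hIn : ∀ i, N.qIn i = q) (hOut : N.qOut = q) :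
    (∀ theta : ℝ, 0 ≤ theta →
      W.ccdf theta =ᵐ[P] fun ω =>
        N.mixture (fun i => CoopNetwork.alpha (N.Omega (W.dist ω)) i * (q ^ i - q ^ N.K))
          theta (W.dist ω)) ∧
    (0 < q → ∀ d : Fin N.K → ℝ, (∀ i, 0 < d i) → StrictMono d →
      (∀ i < N.K,
        N.G * (CoopNetwork.alpha (N.OmegaHat d) i - CoopNetwork.alpha (N.Omega d) i) =
          CoopNetwork.alpha (N.Omega d) i * (q ^ i - q ^ N.K)) ∧
      ∀ theta : ℝ, 0 ≤ theta →
        N.G * N.mixture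
            (fun i => CoopNetwork.alpha (N.OmegaHat d) i - CoopNetwork.alpha (N.Omega d) i)
            theta d =
          N.mixture (fun i => CoopNetwork.alpha (N.Omega d) i * (q ^ i - q ^ N.K)) theta d) := by
  refine ⟨fun theta ht => ?_, fun hq d _ _ => ⟨fun i hi => N.G_mul_alpha_sub hIn hq d hi,
    fun theta _ => N.mul_mixture (fun i hi => N.G_mul_alpha_sub hIn hq d hi) theta d⟩⟩
  filter_upwards [W.ccdf_ae_eq hIn ht, W.ae_dist_pos] with ω h1 h2
  rw [h1, N.mixture_eq ht h2]
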